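/- **Theorem 1.** Let $X$ be a smooth scheme over a field $K$ of characteristic $0$. Let $D_{poly}^n(X)$ $(n\ge 0)$ be the sheaf of polydifferential operators: on an affine open $U=\operatorname{Spec}R$ its sections are the $K$-multilinear maps $f:R^{n}\to R$ that are differential operators (of bounded order) in each factor; it is an $\mathcal O_X$-module through the values of $f$. These form a complex $D_{poly}^\bullet(X)$ of $\mathcal O_X$-modules with the Hochschild coboundary $$df(a_0,\dots,a_n)=a_0f(a_1,\dots,a_n)+\sum_{i=1}^n(-1)^if(\dots,a_{i-1}a_i,\dots)+(-1)^{n+1}f(a_0,\dots,a_{n-1})a_n ,$$ and a graded $\mathcal O_X$-algebra with the product $m(D_1,D_2)(a_1,\dots,a_{k+l})=D_1(a_1,\dots,a_k)\,D_2(a_{k+1},\dots,a_{k+l})$, for which $D_{poly}^\bullet(X)$ is the tensor algebra of $D_{poly}^1(X)$. Let $L=L(D_{poly}^1(X))\subset D_{poly}^\bullet(X)$ be the free graded Lie algebra over $\mathcal O_X$ generated by $D_{poly}^1(X)$ in degree $1$, that is, the graded Lie subalgebra (sheaf) of $D_{poly}^\bullet(X)$ generated by $D_{poly}^1(X)$ under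 the bracket $[a,b]=ab-(-1)^{|a||b|}ba$. Then $d$ preserves $L$, so that $L$ is a complex of $\mathcal O_X$-modules. Let $\mathrm{Sym}^\bullet(L)=\bigoplus_k\mathrm{Sym}^k(L)$ be the graded symmetric algebra over $\mathcal O_X$, with product $\mu:\mathrm{Sym}^\bullet(L)\otimes L\to\mathrm{Sym}^\bullet(L)$ and the differential that extends the one of $L$ by the graded Leibniz rule; tensor products are over $\mathcal O_X$ and carry the usual differential. For homogeneous sections $z_1,\dots,z_k,y$ of $L$ of degrees $d_1,\dots,d_k,e$, the following formulas define morphisms of complexes of $\mathcal O_X$-modules: the symmetrization map $I:\mathrm{Sym}^\bullet(L)\to D_{poly}^\bullet(X)$, $$I(z_1\cdots z_k)=\frac1{k!}\sum_{\sigma\in S_k}s(\sigma)\,z_{\sigma(1)}\otimes\cdots\otimes z_{\sigma(k)},$$ where $s(\sigma)$ is the sign with $z_1\cdots z_k=s(\sigma)z_{\sigma(1)}\cdots z_{\sigma(k)}$ in $\mathrm{Sym}^k(L)$; the map $\omega:\mathrm{Sym}^\bullet(L)\otimes L\to\mathrm{Sym}^\bullet(L)\otimes L$, $$\omega(z_1\cdots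 z_k\otimes y)=\sum_{i=1}^k(-1)^{d_i(d_{i+1}+\cdots+d_k)}\,z_1\cdots\widehat{z_i}\cdots z_k\otimes[z_i,y];$$ and the right adjoint action $\mathrm{ad}:\mathrm{Sym}^\bullet(L)\otimes L\to\mathrm{Sym}^\bullet(L)$, $$\mathrm{ad}(z_1\cdots z_k\otimes y)=\sum_{i=1}^k(-1)^{e(d_{i+1}+\cdots+d_k)}\,z_1\cdots[z_i,y]\cdots z_k .$$ The maps $m$ and $\mu$ are morphisms of complexes as well, and $\mu\circ\omega=\mathrm{ad}$. The operator $\omega$ is locally nilpotent, so that the power series $\frac{t}{1-e^{-t}}\in\mathbb Q[[t]]$ can be evaluated at it; this gives a morphism of complexes $\frac{\omega}{1-e^{-\omega}}$ from $\mathrm{Sym}^\bullet(L)\otimes L$ to itself. Finally, $$m\circ(I\otimes\mathrm{id})=I\circ\mu\circ\frac{\omega}{1-e^{-\omega}}\;:\;\mathrm{Sym}^\bullet(L)\otimes L\longrightarrow D_{poly}^\bullet(X)$$ as morphisms of complexes of $\mathcal O_X$-modules. (This is an analog of the formula $d(\exp^{-1})=\mathrm{ad}/(1-e^{-\mathrm{ad}})$.)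 -/

import Mathlib

universe u

namespace DPoly

section Ring

variable {K R : Type u} [CommRing K] [CommRing R] [Algebra K R]

/-- Grothendieck differential operators of order at most `N` on the `K`-algebra `R`. -/
def IsDiffOp : ℕ → (R →ₗ[K] R) → Prop
  | 0, D => ∀ a : R, D ∘ₗ LinearMap.mulLeft K a - LinearMap.mulLeft K a ∘ₗ D = 0
  | N + 1, D => ∀ a : R, IsDiffOp N (D ∘ₗ LinearMap.mulLeft K a - LinearMap.mulLeft K a ∘ₗ D)

/-- A multilinear map `R ^ n → R` is a polydifferential operator if, for some `N`, it is a
differential operator of order at most `N` in each factor. -/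
def IsPolyDiffOp {n : ℕ} (F : MultilinearMap K (fun _ : Fin n => R) R) : Prop :=
  ∃ N : ℕ, ∀ (a : Fin n → R) (i : Fin n), IsDiffOp N (F.toLinearMap a i)

theorem isDiffOp_zero_map (N : ℕ) : IsDiffOp N (0 : R →ₗ[K] R) := by
  induction N with
  | zero => intro a; simp
  | succ N ih => intro a; simpa using ih

theorem IsDiffOp.succ {N : ℕ} {D : R →ₗ[K] R} (h : IsDiffOp N D) : IsDiffOp (N + 1) D := by
  induction N generalizing D with
  | zero => intro a; rw [h a]; exact isDiffOp_zero_map 0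
  | succ N ih => intro a; exact ih (h a)

theorem IsDiffOp.mono {N M : ℕ} (hNM : N ≤ M) {D : R →ₗ[K] R} (h : IsDiffOp N D) :
    IsDiffOp M D := by
  induction hNM with
  | refl => exact h
  | step _ ih => exact ih.succ

theorem IsDiffOp.add {N : ℕ} {D E : R →ₗ[K] R} (h : IsDiffOp N D) (h' : IsDiffOp N E) :
    IsDiffOp N (D + E) := by
  induction N generalizing D E with
  | zero =>
    intro a
    have := congrArg₂ (· + ·) (h a) (h' a)
    simp only [add_zero] at this
    rw [← this, LinearMap.add_comp, LinearMap.comp_add]; abel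
  | succ N ih =>
    intro a
    have := ih (h a) (h' a)
    convert this using 1
    rw [LinearMap.add_comp, LinearMap.comp_add]; abel

theorem IsDiffOp.smul {N : ℕ} {D : R →ₗ[K] R} (c : R) (h : IsDiffOp N D) :
    IsDiffOp N (c • D) := by
  induction N generalizing D with
  | zero =>
    intro a
    have := congrArg (c • ·) (h a)
    simp only [smul_zero] at this
    rw [← this]
    ext x
    simp [mul_sub, mul_left_comm]
  | succ N ih =>
    intro a
    convert ih (h a) using 1
    ext x
    simp [mul_sub, mul_left_comm]

theorem IsDiffOp.comp_mul {N : ℕ} {D : R →ₗ[K] R} (c : R) (h : IsDiffOp N D) :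
    IsDiffOp N (D ∘ₗ LinearMap.mulLeft K c) := by
  induction N generalizing D with
  | zero =>
    intro a
    ext x
    have := LinearMap.congr_fun (h a) (c * x)
    simpa [mul_left_comm] using this
  | succ N ih =>
    intro a
    convert ih (h a) using 1
    ext x
    simp [mul_left_comm]

theorem isDiffOp_mulLeft (N : ℕ) (c : R) : IsDiffOp N (LinearMap.mulLeft K c) := by
  refine IsDiffOp.mono (Nat.zero_le N) fun a => ?_
  ext x
  simp [mul_left_comm]

theorem isDiffOp_congr {N : ℕ} {D E : R →ₗ[K] R} (h : IsDiffOp N D) (e : ∀ x, E x = D x) :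
    IsDiffOp N E := by
  rwa [show E = D from LinearMap.ext e]

theorem isPolyDiffOp_zero (n : ℕ) :
    IsPolyDiffOp (0 : MultilinearMap K (fun _ : Fin n => R) R) :=
  ⟨0, fun _ _ => isDiffOp_congr (isDiffOp_zero_map 0) fun _ => rfl⟩

theorem IsPolyDiffOp.add {n : ℕ} {F G : MultilinearMap K (fun _ : Fin n => R) R}
    (hF : IsPolyDiffOp F) (hG : IsPolyDiffOp G) : IsPolyDiffOp (F + G) := by
  obtain ⟨N, hN⟩ := hF
  obtain ⟨M, hM⟩ := hG
  exact ⟨max N M, fun a i => isDiffOp_congr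
    (((hN a i).mono (le_max_left N M)).add ((hM a i).mono (le_max_right N M))) fun _ => rfl⟩

theorem IsPolyDiffOp.smul {n : ℕ} {F : MultilinearMap K (fun _ : Fin n => R) R} (c : R)
    (hF : IsPolyDiffOp F) : IsPolyDiffOp (c • F) := by
  obtain ⟨N, hN⟩ := hF
  exact ⟨N, fun a i => isDiffOp_congr ((hN a i).smul c) fun _ => rfl⟩

/-- Builds a multilinear map from a function that is linear in each variable. -/
def mkMultilinear {n : ℕ} (g : (Fin n → R) → R)
    (hg : ∀ a i, ∃ T : R →ₗ[K] R, ∀ x, g (Function.update a i x) = T x) :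
    MultilinearMap K (fun _ : Fin n => R) R :=
  MultilinearMap.mk' g
    (by intro a i x y; obtain ⟨T, hT⟩ := hg a i; simp only [hT, map_add])
    (by intro a i c x; obtain ⟨T, hT⟩ := hg a i; simp only [hT, map_smul])

theorem isPolyDiffOp_of_slot {n : ℕ} {F : MultilinearMap K (fun _ : Fin n => R) R} (N : ℕ)
    (h : ∀ a i, ∃ T : R →ₗ[K] R, IsDiffOp N T ∧ ∀ x, F (Function.update a i x) = T x) :
    IsPolyDiffOp F := by
  refine ⟨N, fun a i => ?_⟩
  obtain ⟨T, hT, e⟩ := h a i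
  exact isDiffOp_congr hT fun x => e x

/-! ### The product of cochains -/

theorem cochainMul_slot {k l : ℕ} (F : MultilinearMap K (fun _ : Fin k => R) R)
    (G : MultilinearMap K (fun _ : Fin l => R) R) (a : Fin (k + l) → R) (i : Fin (k + l)) :
    ∃ T : R →ₗ[K] R, (∀ N, (∀ b j, IsDiffOp N (F.toLinearMap b j)) →
        (∀ b j, IsDiffOp N (G.toLinearMap b j)) → IsDiffOp N T) ∧
      ∀ x, F (fun j => Function.update a i x (Fin.castAdd l j)) *
        G (fun j => Function.update a i x (Fin.natAdd k j)) = T x := by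
  induction i using Fin.addCases with
  | left i =>
    have h1 : ∀ z, (fun j => Function.update a (Fin.castAdd l i) z (Fin.castAdd l j))
        = Function.update (fun j => a (Fin.castAdd l j)) i z := by
      intro z; ext j; simp [Function.update_apply]
    have h2 : ∀ z, (fun j => Function.update a (Fin.castAdd l i) z (Fin.natAdd k j))
        = fun j => a (Fin.natAdd k j) := by
      intro z; ext j; rw [Function.update_of_ne]; intro h
      have := congrArg Fin.val h; simp at this; omega
    refine ⟨G (fun j => a (Fin.natAdd k j)) • F.toLinearMap (fun j => a (Fin.castAdd l j)) i,
      fun N hF _ => (hF _ _).smul _, fun x => ?_⟩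
    rw [h1, h2, mul_comm]; rfl
  | right i =>
    have h1 : ∀ z, (fun j => Function.update a (Fin.natAdd k i) z (Fin.natAdd k j))
        = Function.update (fun j => a (Fin.natAdd k j)) i z := by
      intro z; ext j; simp [Function.update_apply]
    have h2 : ∀ z, (fun j => Function.update a (Fin.natAdd k i) z (Fin.castAdd l j))
        = fun j => a (Fin.castAdd l j) := by
      intro z; ext j; rw [Function.update_of_ne]; intro h
      have := congrArg Fin.val h; simp at this; omega
    refine ⟨F (fun j => a (Fin.castAdd l j)) • G.toLinearMap (fun j => a (Fin.natAdd k j)) i,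
      fun N _ hG => (hG _ _).smul _, fun x => ?_⟩
    rw [h1, h2]; rfl

/-- The product `(F G)(a_1, …, a_{k+l}) = F(a_1, …, a_k) G(a_{k+1}, …, a_{k+l})`. -/
def cochainMul {k l : ℕ} (F : MultilinearMap K (fun _ : Fin k => R) R)
    (G : MultilinearMap K (fun _ : Fin l => R) R) :
    MultilinearMap K (fun _ : Fin (k + l) => R) R :=
  mkMultilinear (fun a => F (fun i => a (Fin.castAdd l i)) * G (fun j => a (Fin.natAdd k j)))
    fun a i => (cochainMul_slot F G a i).imp fun _ h => h.2

theorem IsPolyDiffOp.cochainMul {k l : ℕ} {F : MultilinearMap K (fun _ : Fin k => R) R}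
    {G : MultilinearMap K (fun _ : Fin l => R) R} (hF : IsPolyDiffOp F) (hG : IsPolyDiffOp G) :
    IsPolyDiffOp (cochainMul F G) := by
  obtain ⟨N, hN⟩ := hF
  obtain ⟨M, hM⟩ := hG
  exact isPolyDiffOp_of_slot (max N M) fun a i => (cochainMul_slot F G a i).imp fun _ h =>
    ⟨h.1 _ (fun b j => (hN b j).mono (le_max_left N M))
      (fun b j => (hM b j).mono (le_max_right N M)), h.2⟩

/-! ### The Hochschild coboundary -/

theorem hochFirst_slot {n : ℕ} (F : MultilinearMap K (fun _ : Fin n => R) R)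
    (a : Fin (n + 1) → R) (i : Fin (n + 1)) :
    ∃ T : R →ₗ[K] R, (∀ N, (∀ b j, IsDiffOp N (F.toLinearMap b j)) → IsDiffOp N T) ∧
      ∀ x, Function.update a i x 0 * F (fun j => Function.update a i x j.succ) = T x := by
  induction i using Fin.cases with
  | zero =>
    refine ⟨LinearMap.mulLeft K (F (fun j => a j.succ)), fun N _ => isDiffOp_mulLeft N _,
      fun x => ?_⟩
    simp [mul_comm]
  | succ i =>
    have h1 : ∀ z, (fun j : Fin n => Function.update a i.succ z j.succ)
        = Function.update (fun j : Fin n => a j.succ) i z := by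
      intro z; ext j; simp [Function.update_apply]
    refine ⟨a 0 • F.toLinearMap (fun j => a j.succ) i, fun N h => (h _ _).smul _, fun x => ?_⟩
    rw [h1, Function.update_of_ne (Fin.succ_ne_zero i).symm]; rfl

theorem hochLast_slot {n : ℕ} (F : MultilinearMap K (fun _ : Fin n => R) R)
    (a : Fin (n + 1) → R) (i : Fin (n + 1)) :
    ∃ T : R →ₗ[K] R, (∀ N, (∀ b j, IsDiffOp N (F.toLinearMap b j)) → IsDiffOp N T) ∧
      ∀ x, F (fun j => Function.update a i x j.castSucc) *
        Function.update a i x (Fin.last n) = T x := by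
  induction i using Fin.lastCases with
  | last =>
    refine ⟨LinearMap.mulLeft K (F (fun j => a j.castSucc)), fun N _ => isDiffOp_mulLeft N _,
      fun x => ?_⟩
    have h1 : (fun j : Fin n => Function.update a (Fin.last n) x j.castSucc)
        = fun j => a j.castSucc := by
      ext j; rw [Function.update_of_ne (Fin.castSucc_lt_last j).ne]
    rw [h1]; simp
  | cast i =>
    have h1 : ∀ z, (fun j : Fin n => Function.update a i.castSucc z j.castSucc)
        = Function.update (fun j : Fin n => a j.castSucc) i z := by
      intro z; ext j; simp [Function.update_apply]
    refine ⟨a (Fin.last n) • F.toLinearMap (fun j => a j.castSucc) i,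
      fun N h => (h _ _).smul _, fun x => ?_⟩
    rw [h1, Function.update_of_ne (Fin.castSucc_lt_last i).ne', mul_comm]; rfl

theorem contractNth_update {n : ℕ} (j : Fin n) (a : Fin (n + 1) → R) (i : Fin (n + 1)) :
    ∃ (i' : Fin n) (c : R), ∀ x,
      Fin.contractNth j.castSucc (· * ·) (Function.update a i x) =
        Function.update (Fin.contractNth j.castSucc (· * ·) a) i' (c * x) := by
  rcases lt_trichotomy (i : ℕ) (j : ℕ) with h | h | h
  · refine ⟨⟨i, by omega⟩, 1, fun x => ?_⟩
    ext k
    simp only [Fin.contractNth, Function.update_apply, Fin.ext_iff, Fin.val_castSucc,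
      Fin.val_succ, one_mul]
    grind
  · refine ⟨j, a j.succ, fun x => ?_⟩
    ext k
    simp only [Fin.contractNth, Function.update_apply, Fin.ext_iff, Fin.val_castSucc,
      Fin.val_succ]
    have : k = j ∨ (k : ℕ) ≠ j := by rw [Ne, ← Fin.ext_iff]; exact em _
    rcases this with rfl | hk
    · simp [h, mul_comm]
    · grind
  · by_cases h' : (i : ℕ) = j + 1
    · refine ⟨j, a j.castSucc, fun x => ?_⟩
      ext k
      simp only [Fin.contractNth, Function.update_apply, Fin.ext_iff, Fin.val_castSucc,
        Fin.val_succ]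
      have : k = j ∨ (k : ℕ) ≠ j := by rw [Ne, ← Fin.ext_iff]; exact em _
      rcases this with rfl | hk
      · simp [h']
      · grind
    · refine ⟨⟨i - 1, by omega⟩, 1, fun x => ?_⟩
      ext k
      simp only [Fin.contractNth, Function.update_apply, Fin.ext_iff, Fin.val_castSucc,
        Fin.val_succ, one_mul]
      grind

theorem hochMid_slot {n : ℕ} (F : MultilinearMap K (fun _ : Fin n => R) R) (j : Fin n)
    (a : Fin (n + 1) → R) (i : Fin (n + 1)) :
    ∃ T : R →ₗ[K] R, (∀ N, (∀ b j, IsDiffOp N (F.toLinearMap b j)) → IsDiffOp N T) ∧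
      ∀ x, F (Fin.contractNth j.castSucc (· * ·) (Function.update a i x)) = T x := by
  obtain ⟨i', c, h⟩ := contractNth_update j a i
  refine ⟨F.toLinearMap (Fin.contractNth j.castSucc (· * ·) a) i' ∘ₗ LinearMap.mulLeft K c,
    fun N hN => (hN _ _).comp_mul c, fun x => ?_⟩
  rw [h]; rfl

theorem hochD_slot {n : ℕ} (F : MultilinearMap K (fun _ : Fin n => R) R)
    (a : Fin (n + 1) → R) (i : Fin (n + 1)) :
    ∃ T : R →ₗ[K] R, (∀ N, (∀ b j, IsDiffOp N (F.toLinearMap b j)) → IsDiffOp N T) ∧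
      ∀ x, (fun b : Fin (n + 1) → R => b 0 * F (fun i => b i.succ)
        + ∑ j : Fin n, (-1) ^ ((j : ℕ) + 1) * F (Fin.contractNth j.castSucc (· * ·) b)
        + (-1) ^ (n + 1) * (F (fun i => b i.castSucc) * b (Fin.last n)))
          (Function.update a i x) = T x := by
  obtain ⟨T₀, h₀, e₀⟩ := hochFirst_slot F a i
  obtain ⟨T₁, h₁, e₁⟩ := hochLast_slot F a i
  choose T hT e using fun j => hochMid_slot F j a i
  have hs : ∀ N, (∀ b j, IsDiffOp N (F.toLinearMap b j)) → ∀ s : Finset (Fin n),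
      IsDiffOp N (∑ j ∈ s, ((-1) ^ ((j : ℕ) + 1) : R) • T j) := by
    intro N hN s
    induction s using Finset.cons_induction with
    | empty => simpa using isDiffOp_zero_map N
    | cons j s hj ih => rw [Finset.sum_cons]; exact ((hT j N hN).smul _).add ih
  refine ⟨T₀ + ∑ j : Fin n, ((-1) ^ ((j : ℕ) + 1) : R) • T j + ((-1) ^ (n + 1) : R) • T₁,
    fun N hN => ((h₀ N hN).add (hs N hN _)).add ((h₁ N hN).smul _), fun x => ?_⟩
  simp [e₀, e₁, e, LinearMap.sum_apply]

/-- The Hochschild coboundary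
`(dF)(a_0, …, a_n) = a_0 F(a_1, …, a_n) + ∑_{i=1}^n (-1)^i F(…, a_{i-1} a_i, …)
  + (-1)^{n+1} F(a_0, …, a_{n-1}) a_n`. -/
def hochD {n : ℕ} (F : MultilinearMap K (fun _ : Fin n => R) R) :
    MultilinearMap K (fun _ : Fin (n + 1) => R) R :=
  mkMultilinear (fun a => a 0 * F (fun i => a i.succ)
    + ∑ j : Fin n, (-1) ^ ((j : ℕ) + 1) * F (Fin.contractNth j.castSucc (· * ·) a)
    + (-1) ^ (n + 1) * (F (fun i => a i.castSucc) * a (Fin.last n)))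
    fun a i => (hochD_slot F a i).imp fun _ h => h.2

theorem hochD_apply {n : ℕ} (F : MultilinearMap K (fun _ : Fin n => R) R) (a : Fin (n + 1) → R) :
    hochD F a = a 0 * F (fun i => a i.succ)
      + ∑ j : Fin n, (-1) ^ ((j : ℕ) + 1) * F (Fin.contractNth j.castSucc (· * ·) a)
      + (-1) ^ (n + 1) * (F (fun i => a i.castSucc) * a (Fin.last n)) := rfl

theorem IsPolyDiffOp.hochD {n : ℕ} {F : MultilinearMap K (fun _ : Fin n => R) R}
    (hF : IsPolyDiffOp F) : IsPolyDiffOp (hochD F) := by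
  obtain ⟨N, hN⟩ := hF
  exact isPolyDiffOp_of_slot N fun a i => (hochD_slot F a i).imp fun _ h => ⟨h.1 N hN, h.2⟩

/-- Contraction of the `i`-th and `(i+1)`-st entries of a sequence. -/
def contractSeq (i : ℕ) (b : ℕ → R) (k : ℕ) : R :=
  if k < i then b k else if k = i then b k * b (k + 1) else b (k + 1)

/-- `b ↦ b_0 F(b_1, …, b_n) b_{n+1}`. -/
def barEval {n : ℕ} (F : MultilinearMap K (fun _ : Fin n => R) R) (b : ℕ → R) : R :=
  b 0 * F (fun i => b (i + 1)) * b (n + 1)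

theorem barEval_hochD {n : ℕ} (F : MultilinearMap K (fun _ : Fin n => R) R) (b : ℕ → R) :
    barEval (hochD F) b =
      ∑ i ∈ Finset.range (n + 2), (-1) ^ i * barEval F (contractSeq i b) := by
  rw [Finset.sum_range_succ, Finset.sum_range_succ', barEval, hochD_apply, ← Fin.sum_univ_eq_sum_range
    (fun i => (-1) ^ (i + 1) * barEval F (contractSeq (i + 1) b))]
  have h0 : barEval F (contractSeq 0 b) = b 0 * (b 1 * F (fun i => b (i + 2))) * b (n + 2) := by
    simp [barEval, contractSeq, mul_assoc]
  have h1 : barEval F (contractSeq (n + 1) b) =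
      b 0 * (F (fun i => b (i + 1)) * b (n + 1)) * b (n + 2) := by
    simp [barEval, contractSeq, mul_assoc]
  have h2 : ∀ j : Fin n, barEval F (contractSeq (j + 1) b) =
      b 0 * F (Fin.contractNth j.castSucc (· * ·) (fun i : Fin (n + 1) => b (i + 1)))
        * b (n + 2) := by
    intro j
    have hj := j.2
    simp only [barEval, contractSeq]
    rw [if_pos (by omega), if_neg (by omega), if_neg (by omega)]
    congr 3
    ext k
    simp [Fin.contractNth]
  rw [h0, h1]
  simp only [h2]
  simp only [Fin.val_succ, Fin.val_castSucc, Fin.val_last, Fin.val_zero, Nat.zero_add, pow_zero,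
    one_mul, mul_add, add_mul, Finset.mul_sum, Finset.sum_mul]
  rw [add_comm (b 0 * _ * _) (∑ _, _)]
  refine congrArg₂ _ (congrArg₂ _ (Finset.sum_congr rfl fun j _ => ?_) ?_) ?_ <;> ring

theorem contractSeq_comm {i j : ℕ} (h : i ≤ j) (b : ℕ → R) :
    contractSeq i (contractSeq (j + 1) b) = contractSeq j (contractSeq i b) := by
  ext k
  simp only [contractSeq]
  split_ifs <;> first | omega | rfl | (subst_vars; ring_nf)

theorem hochD_hochD {n : ℕ} (F : MultilinearMap K (fun _ : Fin n => R) R) :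
    hochD (hochD F) = 0 := by
  ext a
  set b : ℕ → R := fun k => if h : 1 ≤ k ∧ k - 1 < n + 2 then a ⟨k - 1, h.2⟩ else 1 with hb
  have key : barEval (hochD (hochD F)) b = 0 := by
    simp only [barEval_hochD, Finset.mul_sum]
    rw [← Finset.sum_product']
    refine Finset.sum_involution
      (fun p _ => if p.2 < p.1 then (p.2, p.1 - 1) else (p.2 + 1, p.1)) ?_ ?_ ?_ ?_
    · rintro ⟨i, j⟩ _
      by_cases h : j < i
      · obtain ⟨i, rfl⟩ : ∃ i', i = i' + 1 := ⟨i - 1, by omega⟩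
        simp only [h, if_true, Nat.add_sub_cancel]
        rw [contractSeq_comm (by omega)]
        ring
      · simp only [h, if_false]
        rw [← contractSeq_comm (by omega)]
        ring
    · rintro ⟨i, j⟩ _ _
      by_cases h : j < i
      · simp only [h, if_true, ne_eq, Prod.mk.injEq]; omega
      · simp only [h, if_false, ne_eq, Prod.mk.injEq]; omega
    · rintro ⟨i, j⟩ hij
      simp only [Finset.mem_product, Finset.mem_range] at hij ⊢
      by_cases h : j < i
      · simp only [h, if_true]; omega
      · simp only [h, if_false]; omega
    · rintro ⟨i, j⟩ _
      by_cases h : j < i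
      · have h' : ¬ (i - 1 < j) := by omega
        simp only [h, h', if_true, if_false, Prod.mk.injEq, and_true]; omega
      · have h' : i < j + 1 := by omega
        simp only [h, h', if_true, if_false, Prod.mk.injEq, true_and]; omega
  have e : barEval (hochD (hochD F)) b = hochD (hochD F) a := by
    simp [barEval, hb]
  rw [← e, key]; rfl

end Ring

section Sheaf

open AlgebraicGeometry CategoryTheory Opposite

variable {K : Type u} [Field K] {X : Scheme.{u}} (f : X ⟶ Spec (CommRingCat.of K))

/-- The ring of sections over `V`, regarded as a `K`-algebra through `f : X ⟶ Spec K`. -/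
def Sec (_f : X ⟶ Spec (CommRingCat.of K)) (V : X.Opens) : Type u := Γ(X, V)

noncomputable instance (V : X.Opens) : CommRing (Sec f V) :=
  inferInstanceAs (CommRing Γ(X, V))

/-- The structure homomorphism `K → Γ(X, V)`. -/
noncomputable def secMap (V : X.Opens) : K →+* Γ(X, V) :=
  ((Scheme.ΓSpecIso (CommRingCat.of K)).inv ≫ f.appTop ≫
    X.presheaf.map (homOfLE (le_top : V ≤ ⊤)).op).hom

noncomputable instance (V : X.Opens) : Algebra K (Sec f V) :=
  RingHom.toAlgebra (S := Sec f V) (secMap f V)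

/-- Restriction of functions. -/
noncomputable def secRes {V W : X.Opens} (h : W ≤ V) : Γ(X, V) →+* Γ(X, W) :=
  (X.presheaf.map (homOfLE h).op).hom

theorem secRes_self (V : X.Opens) (x : Γ(X, V)) : secRes (le_refl V) x = x := by
  simp [secRes]

theorem secRes_secRes {V W Z : X.Opens} (h : W ≤ V) (h' : Z ≤ W) (x : Γ(X, V)) :
    secRes h' (secRes h x) = secRes (h'.trans h) x := by
  have : (homOfLE (h'.trans h)).op = (homOfLE h).op ≫ (homOfLE h').op := rfl
  simp [secRes, this]

/-- Restriction of functions, between rings regarded as `K`-algebras. -/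
noncomputable def sRes {V W : X.Opens} (h : W ≤ V) : Sec f V →+* Sec f W := secRes h

/-- Restriction of functions, into a ring regarded as a `K`-algebra. -/
noncomputable def toSec {V W : X.Opens} (h : W ≤ V) : Γ(X, V) →+* Sec f W := secRes h

theorem toSec_secRes {V W Z : X.Opens} (h : W ≤ V) (h' : Z ≤ W) (x : Γ(X, V)) :
    toSec f h' (secRes h x) = toSec f (h'.trans h) x := secRes_secRes h h' x

theorem sRes_toSec {V W Z : X.Opens} (h : W ≤ V) (h' : Z ≤ W) (x : Γ(X, V)) :
    sRes f h' (toSec f h x) = toSec f (h'.trans h) x := secRes_secRes h h' x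

/-- The affine open subschemes contained in `U`. -/
abbrev AffIn (U : X.Opens) : Type u := {V : X.affineOpens // V.1 ≤ U}

/-- Families of `K`-multilinear maps `Γ(X, V) ^ n → Γ(X, V)`, where `V` runs through the affine
open subschemes of `U`. -/
def Fam (U : X.Opens) (n : ℕ) : Type u :=
  ∀ V : AffIn U, MultilinearMap K (fun _ : Fin n => Sec f V.1.1) (Sec f V.1.1)

noncomputable instance (U : X.Opens) (n : ℕ) : AddCommGroup (Fam f U n) :=
  inferInstanceAs (AddCommGroup
    (∀ V : AffIn U, MultilinearMap K (fun _ : Fin n => Sec f V.1.1) (Sec f V.1.1)))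

/-- Functions act on families through the target: `(r F)(a_1, …, a_n) = r F(a_1, …, a_n)`. -/
noncomputable instance (U : X.Opens) (n : ℕ) : Module Γ(X, U) (Fam f U n) :=
  @Module.compHom (∀ V : AffIn U, Sec f V.1.1) Γ(X, U) (Fam f U n) _ _
    (inferInstanceAs (Module (∀ V : AffIn U, Sec f V.1.1)
      (∀ V : AffIn U, MultilinearMap K (fun _ : Fin n => Sec f V.1.1) (Sec f V.1.1)))) _
    (RingHom.pi fun V : AffIn U => toSec f V.2)

theorem Fam.smul_apply {U : X.Opens} {n : ℕ} (r : Γ(X, U)) (F : Fam f U n) (V : AffIn U)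
    (a : Fin n → Sec f V.1.1) : (r • F) V a = toSec f V.2 r * F V a := rfl

/-- The module of polydifferential operators in `n` arguments on `U`. Such an operator is given by
a polydifferential operator on the ring `Γ(X, V)` for each affine open `V` contained in `U`,
compatibly with restriction. -/
noncomputable def polyDiff (U : X.Opens) (n : ℕ) : Submodule Γ(X, U) (Fam f U n) where
  carrier := {F | (∀ V : AffIn U, IsPolyDiffOp (F V)) ∧
    ∀ (V W : AffIn U) (h : W.1.1 ≤ V.1.1) (a : Fin n → Sec f V.1.1),
      sRes f h (F V a) = F W fun i => sRes f h (a i)}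
  zero_mem' := ⟨fun _ => isPolyDiffOp_zero n, fun _ _ h _ => map_zero (sRes f h)⟩
  add_mem' hF hG := ⟨fun V => (hF.1 V).add (hG.1 V), fun V W h a =>
    (map_add (sRes f h) _ _).trans (congrArg₂ (· + ·) (hF.2 V W h a) (hG.2 V W h a))⟩
  smul_mem' r _ hF := ⟨fun V => (hF.1 V).smul _, fun V W h a =>
    (map_mul (sRes f h) _ _).trans
      (congrArg₂ (· * ·) (sRes_toSec f V.2 h r) (hF.2 V W h a))⟩

/-- `D_poly^n(U)`. -/
abbrev PD (U : X.Opens) (n : ℕ) : Type u := polyDiff f U n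

variable {f}

@[ext]
theorem PD.ext {U : X.Opens} {n : ℕ} {F G : PD f U n} (h : ∀ V a, F.1 V a = G.1 V a) : F = G :=
  Subtype.ext (funext fun V => MultilinearMap.ext fun a => h V a)

theorem PD.smul_apply {U : X.Opens} {n : ℕ} (r : Γ(X, U)) (F : PD f U n) (V : AffIn U)
    (a : Fin n → Sec f V.1.1) : (r • F).1 V a = toSec f V.2 r * F.1 V a := rfl

theorem PD.add_apply {U : X.Opens} {n : ℕ} (F G : PD f U n) (V : AffIn U)
    (a : Fin n → Sec f V.1.1) : (F + G).1 V a = F.1 V a + G.1 V a := rfl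

theorem PD.zero_apply {U : X.Opens} {n : ℕ} (V : AffIn U)
    (a : Fin n → Sec f V.1.1) : (0 : PD f U n).1 V a = 0 := rfl

/-- Restriction of polydifferential operators. -/
noncomputable def PD.res {U V : X.Opens} (h : V ≤ U) (n : ℕ) : PD f U n →+ PD f V n where
  toFun F := ⟨fun W => F.1 ⟨W.1, W.2.trans h⟩, fun W => F.2.1 ⟨W.1, W.2.trans h⟩,
    fun W W' h' => F.2.2 ⟨W.1, W.2.trans h⟩ ⟨W'.1, W'.2.trans h⟩ h'⟩
  map_zero' := rfl
  map_add' _ _ := rfl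

theorem PD.res_apply {U V : X.Opens} (h : V ≤ U) (n : ℕ) (F : PD f U n) (W : AffIn V)
    (a : Fin n → Sec f W.1.1) : (PD.res h n F).1 W a = F.1 ⟨W.1, W.2.trans h⟩ a := rfl

theorem PD.res_smul {U V : X.Opens} (h : V ≤ U) {n : ℕ} (r : Γ(X, U)) (F : PD f U n) :
    PD.res h n (r • F) = secRes h r • PD.res h n F := by
  ext W a
  rw [PD.res_apply, PD.smul_apply, PD.smul_apply, PD.res_apply, toSec_secRes]

/-- The product of polydifferential operators. -/
noncomputable def PD.mul {U : X.Opens} {k l : ℕ} (F : PD f U k) (G : PD f U l) : PD f U (k + l) :=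
  ⟨fun V => cochainMul (F.1 V) (G.1 V), fun V => (F.2.1 V).cochainMul (G.2.1 V),
    fun V W h _ => (map_mul (sRes f h) _ _).trans
      (congrArg₂ (· * ·) (F.2.2 V W h _) (G.2.2 V W h _))⟩

theorem PD.mul_apply {U : X.Opens} {k l : ℕ} (F : PD f U k) (G : PD f U l) (V : AffIn U)
    (a : Fin (k + l) → Sec f V.1.1) : (F.mul G).1 V a =
      F.1 V (fun i => a (Fin.castAdd l i)) * G.1 V (fun j => a (Fin.natAdd k j)) := rfl

/-- The unit, in degree zero. -/
noncomputable def PD.one {U : X.Opens} : PD f U 0 :=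
  ⟨fun _ => MultilinearMap.constOfIsEmpty K _ 1, fun _ => ⟨0, fun _ i => i.elim0⟩,
    fun _ _ h _ => map_one (sRes f h)⟩

theorem PD.one_apply {U : X.Opens} (V : AffIn U) (a : Fin 0 → Sec f V.1.1) :
    (PD.one : PD f U 0).1 V a = 1 := rfl

theorem PD.sigma_ext {U : X.Opens} {m n : ℕ} (h : m = n) {F : PD f U m} {G : PD f U n}
    (e : ∀ V a, F.1 V a = G.1 V fun i => a (Fin.cast h.symm i)) :
    (⟨m, F⟩ : GradedMonoid (PD f U)) = ⟨n, G⟩ := by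
  subst h
  exact congrArg _ (PD.ext e)

noncomputable instance (U : X.Opens) : GradedMonoid.GMul (PD f U) := ⟨fun F G => F.mul G⟩

noncomputable instance (U : X.Opens) : GradedMonoid.GOne (PD f U) := ⟨PD.one⟩

noncomputable instance (U : X.Opens) : GradedMonoid.GMonoid (PD f U) where
  one_mul F := PD.sigma_ext (Nat.zero_add _) fun V a => by
    refine (one_mul _).trans ?_
    exact congrArg _ (funext fun i => congrArg a (by ext; simp))
  mul_one F := PD.sigma_ext (Nat.add_zero _) fun V a => by
    refine (mul_one _).trans ?_
    exact congrArg _ (funext fun i => congrArg a (by ext; simp))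
  mul_assoc F G H := PD.sigma_ext (Nat.add_assoc _ _ _) fun V a => by
    refine (mul_assoc (F.2.1 V _) (G.2.1 V _) (H.2.1 V _)).trans ?_
    refine congrArg₂ (· * ·) ?_ (congrArg₂ (· * ·) ?_ ?_) <;>
      exact congrArg _ (funext fun i => congrArg a (by ext; simp [Nat.add_assoc]))

noncomputable instance (U : X.Opens) : DirectSum.GRing (PD f U) where
  mul_zero F := PD.ext fun V _ => mul_zero (F.1 V _)
  zero_mul F := PD.ext fun V _ => zero_mul (F.1 V _)
  mul_add F G H := PD.ext fun V _ => mul_add (F.1 V _) (G.1 V _) (H.1 V _)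
  add_mul F G H := PD.ext fun V _ => add_mul (F.1 V _) (G.1 V _) (H.1 V _)
  natCast m := m • PD.one
  natCast_zero := zero_smul _ _
  natCast_succ _ := succ_nsmul _ _
  intCast m := m • PD.one
  intCast_ofNat _ := natCast_zsmul _ _
  intCast_negSucc_ofNat _ := negSucc_zsmul _ _

/-- The graded bracket `[F, G] = F G - (-1)^{k l} G F`. -/
noncomputable def PD.bracket {U : X.Opens} {k l : ℕ} (F : PD f U k) (G : PD f U l) :
    PD f U (k + l) :=
  F.mul G - (-1 : ℤ) ^ (k * l) • (Nat.add_comm l k ▸ G.mul F)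

/-- The Hochschild coboundary on polydifferential operators. -/
noncomputable def PD.d {U : X.Opens} (n : ℕ) : PD f U n →ₗ[Γ(X, U)] PD f U (n + 1) where
  toFun F := ⟨fun V => hochD (F.1 V), fun V => (F.2.1 V).hochD, fun V W h a => by
    have hc : ∀ j : Fin n, (fun i => sRes f h (Fin.contractNth j.castSucc (· * ·) a i)) =
        Fin.contractNth j.castSucc (· * ·) fun i => sRes f h (a i) := by
      intro j
      ext k
      unfold Fin.contractNth
      split_ifs
      · rfl
      · exact map_mul (sRes f h) _ _
      · rfl
    have hF := F.2.2 V W h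
    refine Eq.trans (congrArg _ (hochD_apply (F.1 V) a)) (Eq.trans ?_ (hochD_apply (F.1 W) _).symm)
    simp only [map_add, map_mul, map_sum, map_pow, map_neg, map_one, hF, hc]⟩
  map_add' F G := PD.ext fun V a => by
    change hochD (F.1 V + G.1 V) a = hochD (F.1 V) a + hochD (G.1 V) a
    simp only [hochD_apply, _root_.add_apply, mul_add, add_mul, Finset.sum_add_distrib]
    ring
  map_smul' r F := PD.ext fun V a => by
    change hochD (toSec f V.2 r • F.1 V) a = toSec f V.2 r * hochD (F.1 V) a
    simp only [hochD_apply, _root_.smul_apply, smul_eq_mul, mul_add, Finset.mul_sum]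
    refine congrArg₂ _ (congrArg₂ _ ?_ (Finset.sum_congr rfl fun j _ => ?_)) ?_ <;> ring

theorem PD.d_d {U : X.Opens} {n : ℕ} (F : PD f U n) : PD.d (n + 1) (PD.d n F) = 0 :=
  PD.ext fun V a => by
    change hochD (hochD (F.1 V)) a = 0
    rw [hochD_hochD]; rfl

theorem PD.res_d {U V : X.Opens} (h : V ≤ U) {n : ℕ} (F : PD f U n) :
    PD.res h (n + 1) (PD.d n F) = PD.d n (PD.res h n F) := rfl

theorem PD.res_mul {U V : X.Opens} (h : V ≤ U) {k l : ℕ} (F : PD f U k) (G : PD f U l) :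
    PD.res h (k + l) (F.mul G) = (PD.res h k F).mul (PD.res h l G) := rfl

theorem PD.res_bracket {U V : X.Opens} (h : V ≤ U) {k l : ℕ} (F : PD f U k) (G : PD f U l) :
    PD.res h (k + l) (F.bracket G) = (PD.res h k F).bracket (PD.res h l G) := by
  have hc : ∀ {m n : ℕ} (e : m = n) (H : PD f U m), PD.res h n (e ▸ H) = e ▸ PD.res h m H := by
    rintro m n rfl H; rfl
  rw [PD.bracket, map_sub, map_zsmul, hc, PD.res_mul, PD.res_mul]; rfl

/-- `LieGen n F` says that `F`, of degree `n`, lies in the graded Lie subalgebra over `Γ(X, U)`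
generated by the differential operators on `U`, placed in degree one. -/
inductive LieGen (U : X.Opens) : ∀ n : ℕ, PD f U n → Prop
  | of (D : PD f U 1) : LieGen U 1 D
  | zero (n : ℕ) : LieGen U n 0
  | add {n : ℕ} {F G : PD f U n} : LieGen U n F → LieGen U n G → LieGen U n (F + G)
  | smul {n : ℕ} (r : Γ(X, U)) {F : PD f U n} : LieGen U n F → LieGen U n (r • F)
  | bracket {k l : ℕ} {F : PD f U k} {G : PD f U l} :
      LieGen U k F → LieGen U l G → LieGen U (k + l) (F.bracket G)

theorem LieGen.res {U V : X.Opens} (h : V ≤ U) {n : ℕ} {F : PD f U n} (hF : LieGen U n F) :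
    LieGen V n (PD.res h n F) := by
  induction hF with
  | of D => exact .of _
  | zero n => rw [map_zero]; exact .zero n
  | add _ _ h1 h2 => rw [map_add]; exact .add h1 h2
  | smul r _ h1 => rw [PD.res_smul]; exact .smul _ h1
  | bracket _ _ h1 h2 => rw [PD.res_bracket]; exact .bracket h1 h2

variable (f)

/-- The degree `n` part of `L(D_poly^1)` over `U`. If `X` is smooth, then `D_poly^•` with its product
is the tensor algebra over `𝒪_X` of the locally free module `D_poly^1`, in degree one, and the free
graded Lie algebra on `D_poly^1` is the graded Lie subalgebra of the tensor algebra generated by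
`D_poly^1`. Its sections are the polydifferential operators that locally lie in the Lie algebra
generated by the differential operators. -/
noncomputable def freeLie (U : X.Opens) (n : ℕ) : Submodule Γ(X, U) (PD f U n) where
  carrier := {F | ∀ x ∈ U, ∃ (V : X.Opens) (h : V ≤ U), x ∈ V ∧ LieGen V n (PD.res h n F)}
  zero_mem' x hx := ⟨U, le_rfl, hx, by rw [map_zero]; exact .zero n⟩
  add_mem' {F G} hF hG x hx := by
    obtain ⟨V, hV, hxV, h1⟩ := hF x hx
    obtain ⟨W, hW, hxW, h2⟩ := hG x hx
    exact ⟨V ⊓ W, inf_le_left.trans hV, ⟨hxV, hxW⟩,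
      .add (h1.res inf_le_left) (h2.res inf_le_right)⟩
  smul_mem' r F hF x hx := by
    obtain ⟨V, hV, hxV, h1⟩ := hF x hx
    exact ⟨V, hV, hxV, by rw [PD.res_smul]; exact .smul _ h1⟩

variable {f}

theorem freeLie_res {U V : X.Opens} (h : V ≤ U) {n : ℕ} {F : PD f U n} (hF : F ∈ freeLie f U n) :
    PD.res h n F ∈ freeLie f V n := by
  intro x hx
  obtain ⟨W, hW, hxW, h1⟩ := hF x (h hx)
  exact ⟨V ⊓ W, inf_le_left, ⟨hx, hxW⟩, h1.res inf_le_right⟩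

theorem freeLie_bracket {U : X.Opens} {k l : ℕ} {F : PD f U k} {G : PD f U l}
    (hF : F ∈ freeLie f U k) (hG : G ∈ freeLie f U l) : F.bracket G ∈ freeLie f U (k + l) := by
  intro x hx
  obtain ⟨V, hV, hxV, h1⟩ := hF x hx
  obtain ⟨W, hW, hxW, h2⟩ := hG x hx
  refine ⟨V ⊓ W, inf_le_left.trans hV, ⟨hxV, hxW⟩, ?_⟩
  rw [PD.res_bracket]
  exact .bracket (h1.res inf_le_left) (h2.res inf_le_right)

end Sheaf

section DG

open scoped TensorProduct

/-- A differential graded module over a commutative ring: the module `carrier` is spanned by the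
submodules `deg n`, `d` raises degrees by one, and `sgn` is the operator `(-1)^n` on `deg n`. -/
structure DGModule (R : Type u) [CommRing R] where
  /-- the underlying module -/
  carrier : Type u
  [grp : AddCommGroup carrier]
  [mod : Module R carrier]
  /-- the elements of degree `n` -/
  deg : ℕ → Submodule R carrier
  /-- the sign operator -/
  sgn : carrier →ₗ[R] carrier
  /-- the differential -/
  d : carrier →ₗ[R] carrier
  iSup_deg : ⨆ n, deg n = ⊤
  sgn_of_mem : ∀ {n : ℕ} {x : carrier}, x ∈ deg n → sgn x = (-1 : R) ^ n • x
  d_mem : ∀ {n : ℕ} {x : carrier}, x ∈ deg n → d x ∈ deg (n + 1)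
  d_d : ∀ x : carrier, d (d x) = 0

namespace DGModule

attribute [instance] DGModule.grp DGModule.mod

instance {R : Type u} [CommRing R] : CoeSort (DGModule R) (Type u) := ⟨DGModule.carrier⟩

variable {R : Type u} [CommRing R]

theorem mem_of_deg (M : DGModule R) (N : Submodule R M) (h : ∀ n, ∀ x ∈ M.deg n, x ∈ N) (x : M) :
    x ∈ N := by
  have : (⊤ : Submodule R M) ≤ N := M.iSup_deg ▸ iSup_le fun n x hx => h n x hx
  exact this trivial

theorem sgn_d (M : DGModule R) (x : M) : M.sgn (M.d x) = - M.d (M.sgn x) := by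
  refine M.mem_of_deg (LinearMap.eqLocus (M.sgn ∘ₗ M.d) (-(M.d ∘ₗ M.sgn))) (fun n x hx => ?_) x
  simp [M.sgn_of_mem (M.d_mem hx), M.sgn_of_mem hx, pow_succ]

theorem sgn_sgn (M : DGModule R) (x : M) : M.sgn (M.sgn x) = x := by
  refine M.mem_of_deg (LinearMap.eqLocus (M.sgn ∘ₗ M.sgn) LinearMap.id) (fun n x hx => ?_) x
  simp [M.sgn_of_mem hx, smul_smul, ← mul_pow]

/-- A morphism of differential graded modules. -/
structure Hom (M N : DGModule R) where
  /-- the underlying linear map -/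
  lin : M →ₗ[R] N
  map_mem : ∀ {n : ℕ} {x : M}, x ∈ M.deg n → lin x ∈ N.deg n
  map_d : ∀ x : M, lin (M.d x) = N.d (lin x)

theorem Hom.map_sgn {M N : DGModule R} (F : Hom M N) (x : M) :
    F.lin (M.sgn x) = N.sgn (F.lin x) := by
  refine M.mem_of_deg (LinearMap.eqLocus (F.lin ∘ₗ M.sgn) (N.sgn ∘ₗ F.lin)) (fun n x hx => ?_) x
  simp [M.sgn_of_mem hx, N.sgn_of_mem (F.map_mem hx)]

/-- The differential graded module `⨁ n, M n` of a cochain complex of modules. -/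
noncomputable def ofComplex (M : ℕ → Type u) [∀ n, AddCommGroup (M n)] [∀ n, Module R (M n)]
    (d : ∀ n, M n →ₗ[R] M (n + 1)) (hd : ∀ n x, d (n + 1) (d n x) = 0) : DGModule R where
  carrier := DirectSum ℕ M
  deg n := LinearMap.range (DirectSum.lof R ℕ M n)
  sgn := DirectSum.toModule R ℕ _ fun n => (-1 : R) ^ n • DirectSum.lof R ℕ M n
  d := DirectSum.toModule R ℕ _ fun n => DirectSum.lof R ℕ M (n + 1) ∘ₗ d n
  iSup_deg := by
    rw [eq_top_iff]
    rintro x -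
    induction x using DirectSum.induction_on with
    | zero => exact zero_mem _
    | of n x => exact Submodule.mem_iSup_of_mem n ⟨x, rfl⟩
    | add x y hx hy => exact add_mem hx hy
  sgn_of_mem := by
    rintro n _ ⟨x, rfl⟩
    simp
  d_mem := by
    rintro n _ ⟨x, rfl⟩
    simp
  d_d x := by
    induction x using DirectSum.induction_on with
    | zero => simp
    | of n x =>
      rw [← DirectSum.lof_eq_of R]
      simp [hd]
    | add x y hx hy => rw [map_add, map_add, hx, hy, add_zero]

/-! ### The graded symmetric algebra -/

/-- Graded commutativity. (If `2` is invertible in `R`, elements of odd degree have square zero.) -/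
inductive SymRel (L : DGModule R) : TensorAlgebra R L → TensorAlgebra R L → Prop
  | comm {p q : ℕ} {x y : L} (hx : x ∈ L.deg p) (hy : y ∈ L.deg q) :
      SymRel L (TensorAlgebra.ι R x * TensorAlgebra.ι R y)
        ((-1 : R) ^ (p * q) • (TensorAlgebra.ι R y * TensorAlgebra.ι R x))

/-- The graded symmetric algebra of `L` over `R`. -/
def SymAlg (L : DGModule R) : Type u := RingQuot (SymRel L)

namespace SymAlg

noncomputable instance (L : DGModule R) : Ring (SymAlg L) :=
  inferInstanceAs (Ring (RingQuot (SymRel L)))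

noncomputable instance (L : DGModule R) : Algebra R (SymAlg L) :=
  inferInstanceAs (Algebra R (RingQuot (SymRel L)))

variable (L : DGModule R)

/-- The projection from the tensor algebra. -/
noncomputable def mk : TensorAlgebra R L →ₐ[R] SymAlg L := RingQuot.mkAlgHom R (SymRel L)

/-- The canonical map from `L` to its symmetric algebra. -/
noncomputable def ι : L →ₗ[R] SymAlg L := (mk L).toLinearMap ∘ₗ TensorAlgebra.ι R

variable {L}

theorem ι_comm {p q : ℕ} {x y : L} (hx : x ∈ L.deg p) (hy : y ∈ L.deg q) :
    ι L x * ι L y = (-1 : R) ^ (p * q) • (ι L y * ι L x) := by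
  have h : mk L _ = mk L _ := RingQuot.mkAlgHom_rel R (SymRel.comm hx hy)
  rw [map_mul, map_smul, map_mul] at h
  exact h

/-- The universal property of the symmetric algebra. -/
noncomputable def lift {B : Type u} [Ring B] [Algebra R B] (g : L →ₗ[R] B)
    (hg : ∀ {p q : ℕ} {x y : L}, x ∈ L.deg p → y ∈ L.deg q →
      g x * g y = (-1 : R) ^ (p * q) • (g y * g x)) : SymAlg L →ₐ[R] B :=
  RingQuot.liftAlgHom R ⟨TensorAlgebra.lift R g, by
    rintro _ _ ⟨hx, hy⟩
    simpa using hg hx hy⟩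

theorem lift_ι {B : Type u} [Ring B] [Algebra R B] (g : L →ₗ[R] B)
    (hg : ∀ {p q : ℕ} {x y : L}, x ∈ L.deg p → y ∈ L.deg q →
      g x * g y = (-1 : R) ^ (p * q) • (g y * g x)) (x : L) : lift g hg (ι L x) = g x := by
  refine (RingQuot.liftAlgHom_mkAlgHom_apply R _ _ _).trans ?_
  exact TensorAlgebra.lift_ι_apply _ _

theorem mem_of_mul (N : Submodule R (SymAlg L)) (h1 : 1 ∈ N)
    (h : ∀ p, ∀ x ∈ L.deg p, ∀ s ∈ N, ι L x * s ∈ N) (s : SymAlg L) : s ∈ N := by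
  have h' : ∀ (x : L), ∀ s ∈ N, ι L x * s ∈ N := by
    intro x s hs
    exact L.mem_of_deg (N.comap ((LinearMap.mulRight R s) ∘ₗ ι L)) (fun p x hx => h p x hx s hs) x
  have key : ∀ (t : TensorAlgebra R L), ∀ s ∈ N, mk L t * s ∈ N := by
    intro t
    induction t using TensorAlgebra.induction with
    | algebraMap r =>
      intro s hs
      rw [AlgHom.commutes, ← Algebra.smul_def]
      exact N.smul_mem r hs
    | ι x => exact h' x
    | mul a b ha hb =>
      intro s hs
      rw [map_mul, mul_assoc]
      exact ha _ (hb s hs)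
    | add a b ha hb =>
      intro s hs
      rw [map_add, add_mul]
      exact N.add_mem (ha s hs) (hb s hs)
  obtain ⟨t, rfl⟩ := RingQuot.mkAlgHom_surjective R (SymRel L) s
  have := key t 1 h1
  rwa [mul_one] at this

/-- The products of homogeneous elements of `L` of total degree `n`. -/
inductive Mono (L : DGModule R) : ℕ → SymAlg L → Prop
  | one : Mono L 0 1
  | mul {p n : ℕ} {x : L} {s : SymAlg L} (hx : x ∈ L.deg p) (hs : Mono L n s) :
      Mono L (p + n) (ι L x * s)

theorem sgn_rel {p q : ℕ} {x y : L} (hx : x ∈ L.deg p) (hy : y ∈ L.deg q) :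
    (ι L ∘ₗ L.sgn) x * (ι L ∘ₗ L.sgn) y =
      (-1 : R) ^ (p * q) • ((ι L ∘ₗ L.sgn) y * (ι L ∘ₗ L.sgn) x) := by
  simp only [LinearMap.comp_apply, L.sgn_of_mem hx, L.sgn_of_mem hy, map_smul, smul_mul_smul_comm,
    ι_comm hx hy, smul_smul]
  congr 1; ring

variable (L) in
/-- The sign operator of the symmetric algebra. -/
noncomputable def sgn : SymAlg L →ₐ[R] SymAlg L := lift (ι L ∘ₗ L.sgn) sgn_rel

theorem sgn_ι_mul (x : L) (s : SymAlg L) : sgn L (ι L x * s) = ι L (L.sgn x) * sgn L s := by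
  rw [map_mul]; exact congrArg (· * sgn L s) (lift_ι _ sgn_rel x)

variable (L) in
/-- `x ↦ ((s, t) ↦ (x s, (d x) s + (sgn x) t))`. -/
noncomputable def dAux : L →ₗ[R] Module.End R (SymAlg L × SymAlg L) where
  toFun x := LinearMap.prod (LinearMap.mulLeft R (ι L x) ∘ₗ LinearMap.fst R _ _)
    (LinearMap.mulLeft R (ι L (L.d x)) ∘ₗ LinearMap.fst R _ _ +
      LinearMap.mulLeft R (ι L (L.sgn x)) ∘ₗ LinearMap.snd R _ _)
  map_add' x y := by
    ext <;> simp [add_mul]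
  map_smul' r x := by
    ext <;> simp

theorem dAux_apply (x : L) (s t : SymAlg L) :
    dAux L x (s, t) = (ι L x * s, ι L (L.d x) * s + ι L (L.sgn x) * t) := rfl

theorem dAux_rel {p q : ℕ} {x y : L} (hx : x ∈ L.deg p) (hy : y ∈ L.deg q) :
    dAux L x * dAux L y = (-1 : R) ^ (p * q) • (dAux L y * dAux L x) := by
  refine LinearMap.ext fun ⟨s, t⟩ => ?_
  have e1 := ι_comm hx hy
  have e2 := ι_comm (L.d_mem hx) hy
  have e3 := ι_comm hx (L.d_mem hy)
  have h1 : (-1 : R) ^ (p + (p * q + p)) = (-1) ^ (p * q) := by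
    rw [show p + (p * q + p) = p * q + 2 * p by ring, pow_add, pow_mul]; simp
  simp only [Module.End.mul_apply, LinearMap.smul_apply, dAux_apply, Prod.smul_mk, mul_add,
    ← mul_assoc, L.sgn_of_mem hx, L.sgn_of_mem hy, map_smul, smul_mul_assoc, mul_smul_comm, e1,
    e2, e3, smul_add, smul_smul, Prod.mk.injEq, true_and, ← pow_add, mul_one, h1]
  rw [← add_assoc, ← add_assoc, add_comm ((-1 : R) ^ ((p + 1) * q) • _)]
  rw [show (p + 1) * q = p * q + q by ring, show q + p + p * q = p * q + (p + q) by ring, add_assoc]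

variable (L) in
/-- The algebra homomorphism extending `dAux`. -/
noncomputable def dHom : SymAlg L →ₐ[R] Module.End R (SymAlg L × SymAlg L) :=
  lift (dAux L) dAux_rel

variable (L) in
/-- The differential of the symmetric algebra: the graded derivation extending that of `L`. -/
noncomputable def d : SymAlg L →ₗ[R] SymAlg L :=
  LinearMap.snd R _ _ ∘ₗ LinearMap.applyₗ ((1, 0) : SymAlg L × SymAlg L) ∘ₗ (dHom L).toLinearMap

theorem dHom_ι (x : L) : dHom L (ι L x) = dAux L x := lift_ι _ dAux_rel x

theorem dHom_one_zero (s : SymAlg L) : dHom L s (1, 0) = (s, d L s) := by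
  refine Prod.ext ?_ rfl
  refine mem_of_mul (LinearMap.eqLocus (LinearMap.fst R _ _ ∘ₗ
    LinearMap.applyₗ ((1, 0) : SymAlg L × SymAlg L) ∘ₗ (dHom L).toLinearMap) LinearMap.id) ?_ ?_ s
  · simp
  · intro p x _ s hs
    change (dHom L (ι L x * s) (1, 0)).1 = ι L x * s
    change (dHom L s (1, 0)).1 = s at hs
    rw [map_mul, Module.End.mul_apply, dHom_ι]
    exact congrArg (ι L x * ·) hs

theorem d_one : d L 1 = 0 := by
  simp [d]

theorem d_ι_mul (x : L) (s : SymAlg L) :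
    d L (ι L x * s) = ι L (L.d x) * s + ι L (L.sgn x) * d L s := by
  have h : dHom L (ι L x * s) (1, 0) = dAux L x (dHom L s (1, 0)) := by
    rw [map_mul, Module.End.mul_apply, dHom_ι]
  rw [dHom_one_zero, dHom_one_zero, dAux_apply] at h
  exact congrArg Prod.snd h

variable (L) in
/-- The elements of degree `n` of the symmetric algebra. -/
noncomputable def deg (n : ℕ) : Submodule R (SymAlg L) := Submodule.span R {s | Mono L n s}

theorem one_mem_deg : (1 : SymAlg L) ∈ deg L 0 := Submodule.subset_span .one

theorem ι_mul_mem_deg {p n : ℕ} {x : L} {s : SymAlg L} (hx : x ∈ L.deg p) (hs : s ∈ deg L n) :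
    ι L x * s ∈ deg L (p + n) := by
  induction hs using Submodule.span_induction with
  | mem s hs => exact Submodule.subset_span (.mul hx hs)
  | zero => rw [mul_zero]; exact zero_mem _
  | add a b _ _ ha hb => rw [mul_add]; exact add_mem ha hb
  | smul r a _ ha => rw [mul_smul_comm]; exact Submodule.smul_mem _ _ ha

/-- Induction on elements of the symmetric algebra. -/
theorem induction {P : SymAlg L → Prop} (h0 : P 0) (h1 : P 1)
    (hadd : ∀ a b, P a → P b → P (a + b)) (hsmul : ∀ (r : R) a, P a → P (r • a))
    (hmul : ∀ x a, P a → P (ι L x * a)) (s : SymAlg L) : P s :=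
  mem_of_mul
    { carrier := {s | P s}
      zero_mem' := h0
      add_mem' := fun {a b} ha hb => hadd a b ha hb
      smul_mem' := fun r a ha => hsmul r a ha } h1 (fun _ x _ s hs => hmul x s hs) s

end SymAlg

/-- The graded symmetric algebra of `L`, with the differential that extends the one of `L` by the
graded Leibniz rule. -/
noncomputable def sym (L : DGModule R) : DGModule R where
  carrier := SymAlg L
  deg := SymAlg.deg L
  sgn := (SymAlg.sgn L).toLinearMap
  d := SymAlg.d L
  iSup_deg := by
    rw [eq_top_iff]
    rintro s -
    refine SymAlg.mem_of_mul _ (Submodule.mem_iSup_of_mem 0 SymAlg.one_mem_deg) ?_ s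
    intro p x hx s hs
    refine Submodule.iSup_induction (SymAlg.deg L)
      (motive := fun s => SymAlg.ι L x * s ∈ ⨆ n, SymAlg.deg L n) hs ?_ ?_ ?_
    · intro n s hs
      exact Submodule.mem_iSup_of_mem (p + n) (SymAlg.ι_mul_mem_deg hx hs)
    · rw [mul_zero]; exact zero_mem _
    · intro a b ha hb; rw [mul_add]; exact add_mem ha hb
  sgn_of_mem {n s} hs := by
    induction hs using Submodule.span_induction with
    | mem s hs =>
      induction hs with
      | one => simp
      | mul hx _ ih =>
        rw [AlgHom.toLinearMap_apply] at ih ⊢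
        rw [SymAlg.sgn_ι_mul, ih, L.sgn_of_mem hx, map_smul, smul_mul_smul_comm, pow_add]
    | zero => simp
    | add a b _ _ ha hb => rw [map_add, ha, hb, smul_add]
    | smul r a _ ha => rw [map_smul, ha, smul_comm]
  d_mem {n s} hs := by
    induction hs using Submodule.span_induction with
    | mem s hs =>
      induction hs with
      | one => rw [SymAlg.d_one]; exact zero_mem _
      | @mul p n x s hx hs ih =>
        rw [SymAlg.d_ι_mul, L.sgn_of_mem hx, map_smul, smul_mul_assoc]
        refine add_mem ?_ (Submodule.smul_mem _ _
          (SymAlg.ι_mul_mem_deg (n := n + 1) hx ih))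
        have := SymAlg.ι_mul_mem_deg (L.d_mem hx) (Submodule.subset_span hs)
        rwa [Nat.add_right_comm] at this
    | zero => rw [map_zero]; exact zero_mem _
    | add a b _ _ ha hb => rw [map_add]; exact add_mem ha hb
    | smul r a _ ha => rw [map_smul]; exact Submodule.smul_mem _ _ ha
  d_d s := by
    refine SymAlg.mem_of_mul (LinearMap.ker (SymAlg.d L ∘ₗ SymAlg.d L)) ?_ ?_ s
    · simp [SymAlg.d_one]
    · intro p x hx s hs
      simp only [LinearMap.mem_ker, LinearMap.comp_apply] at hs ⊢
      simp [SymAlg.d_ι_mul, hs, L.d_d, L.sgn_d, L.sgn_sgn]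

/-! ### Tensor products -/

/-- The elements of degree `n` of a tensor product. -/
def tensorDeg (M N : DGModule R) (n : ℕ) : Submodule R (M ⊗[R] N) :=
  Submodule.span R {t | ∃ p q : ℕ, p + q = n ∧ ∃ x ∈ M.deg p, ∃ y ∈ N.deg q, x ⊗ₜ[R] y = t}

theorem tmul_mem_tensorDeg {M N : DGModule R} {p q n : ℕ} (h : p + q = n) {x : M} {y : N}
    (hx : x ∈ M.deg p) (hy : y ∈ N.deg q) : x ⊗ₜ[R] y ∈ tensorDeg M N n :=
  Submodule.subset_span ⟨p, q, h, x, hx, y, hy, rfl⟩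

theorem tensorDeg_le {M N : DGModule R} {n : ℕ} {E : Submodule R (M ⊗[R] N)}
    (h : ∀ p q : ℕ, p + q = n → ∀ x ∈ M.deg p, ∀ y ∈ N.deg q, x ⊗ₜ[R] y ∈ E) :
    tensorDeg M N n ≤ E := by
  refine Submodule.span_le.2 ?_
  rintro _ ⟨p, q, e, x, hx, y, hy, rfl⟩
  exact h p q e x hx y hy

/-- The differential `d (x ⊗ y) = d x ⊗ y + (-1)^p x ⊗ d y` for `x` of degree `p`. -/
noncomputable def tensorD (M N : DGModule R) : M ⊗[R] N →ₗ[R] M ⊗[R] N :=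
  TensorProduct.map M.d LinearMap.id + TensorProduct.map M.sgn N.d

theorem tensorD_tmul {M N : DGModule R} (x : M) (y : N) :
    tensorD M N (x ⊗ₜ[R] y) = M.d x ⊗ₜ[R] y + M.sgn x ⊗ₜ[R] N.d y := rfl

/-- The tensor product of differential graded modules. -/
noncomputable def tensor (M N : DGModule R) : DGModule R where
  carrier := M ⊗[R] N
  deg := tensorDeg M N
  sgn := TensorProduct.map M.sgn N.sgn
  d := tensorD M N
  iSup_deg := by
    rw [eq_top_iff]
    rintro t -
    induction t using TensorProduct.induction_on with
    | zero => exact zero_mem _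
    | tmul x y =>
      refine M.mem_of_deg
        (Submodule.comap ((TensorProduct.mk R M N).flip y) (⨆ n, tensorDeg M N n))
        (fun p x hx => ?_) x
      refine N.mem_of_deg (Submodule.comap (TensorProduct.mk R M N x) (⨆ n, tensorDeg M N n))
        (fun q y hy => ?_) y
      exact Submodule.mem_iSup_of_mem (p + q) (tmul_mem_tensorDeg rfl hx hy)
    | add a b ha hb => exact add_mem ha hb
  sgn_of_mem {n t} ht := by
    refine tensorDeg_le (E := LinearMap.eqLocus (TensorProduct.map M.sgn N.sgn)
      ((-1 : R) ^ n • LinearMap.id)) ?_ ht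
    rintro p q rfl x hx y hy
    simp only [LinearMap.mem_eqLocus, TensorProduct.map_tmul, M.sgn_of_mem hx, N.sgn_of_mem hy,
      TensorProduct.smul_tmul_smul, pow_add, LinearMap.smul_apply, LinearMap.id_apply]
  d_mem {n t} ht := by
    refine tensorDeg_le (E := (tensorDeg M N (n + 1)).comap (tensorD M N)) ?_ ht
    rintro p q rfl x hx y hy
    change tensorD M N _ ∈ tensorDeg M N (p + q + 1)
    rw [tensorD_tmul, M.sgn_of_mem hx, ← TensorProduct.smul_tmul']
    exact add_mem (tmul_mem_tensorDeg (by omega) (M.d_mem hx) hy)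
      (Submodule.smul_mem _ _ (tmul_mem_tensorDeg (by omega) hx (N.d_mem hy)))
  d_d t := by
    refine LinearMap.congr_fun (f := tensorD M N ∘ₗ tensorD M N) (g := 0)
      (TensorProduct.ext' fun x y => ?_) t
    simp [tensorD_tmul, M.d_d, N.d_d, M.sgn_d, TensorProduct.neg_tmul]

/-- The map `F ⊗ id`. -/
noncomputable def Hom.tensorId {M M' : DGModule R} (F : Hom M M') (N : DGModule R) :
    Hom (M.tensor N) (M'.tensor N) where
  lin := (TensorProduct.map F.lin LinearMap.id : M ⊗[R] N →ₗ[R] M' ⊗[R] N)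
  map_mem {n t} ht := by
    refine tensorDeg_le (E := (tensorDeg M' N n).comap
      (TensorProduct.map F.lin LinearMap.id)) ?_ ht
    rintro p q rfl x hx y hy
    exact tmul_mem_tensorDeg rfl (F.map_mem hx) hy
  map_d t := by
    refine LinearMap.congr_fun (f := (TensorProduct.map F.lin LinearMap.id) ∘ₗ tensorD M N)
      (g := tensorD M' N ∘ₗ (TensorProduct.map F.lin LinearMap.id))
      (TensorProduct.ext' fun x y => ?_) t
    simp [tensorD_tmul, F.map_d, F.map_sgn]

/-! ### Change of rings -/

/-- A morphism of differential graded modules over a ring homomorphism. -/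
structure Res {S : Type u} [CommRing S] (φ : R →+* S) (M : DGModule R) (N : DGModule S) where
  /-- the underlying additive map -/
  add : M →+ N
  map_smul : ∀ (r : R) (x : M), add (r • x) = φ r • add x
  map_mem : ∀ {n : ℕ} {x : M}, x ∈ M.deg n → add x ∈ N.deg n
  map_d : ∀ x : M, add (M.d x) = N.d (add x)

variable {S : Type u} [CommRing S] {φ : R →+* S}

theorem Res.map_sgn {M : DGModule R} {N : DGModule S} (F : Res φ M N) (x : M) :
    F.add (M.sgn x) = N.sgn (F.add x) := by
  let E : Submodule R M :=
    { carrier := {x | F.add (M.sgn x) = N.sgn (F.add x)}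
      zero_mem' := by change F.add (M.sgn 0) = N.sgn (F.add 0); simp
      add_mem' := fun {a b} ha hb => by
        change F.add (M.sgn (a + b)) = N.sgn (F.add (a + b))
        rw [map_add, map_add, map_add, map_add]; exact congrArg₂ _ ha hb
      smul_mem' := fun r a ha => by
        change F.add (M.sgn (r • a)) = N.sgn (F.add (r • a))
        rw [LinearMap.map_smul, F.map_smul, F.map_smul, LinearMap.map_smul]; exact congrArg _ ha }
  refine M.mem_of_deg E (fun n x hx => ?_) x
  change F.add (M.sgn x) = N.sgn (F.add x)
  rw [M.sgn_of_mem hx, N.sgn_of_mem (F.map_mem hx), F.map_smul]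
  simp

/-- Functoriality of the tensor product. -/
noncomputable def tensorRes {M M' : DGModule R} {N N' : DGModule S} (F : Res φ M N)
    (F' : Res φ M' N') : M ⊗[R] M' →+ N ⊗[S] N' :=
  TensorProduct.liftAddHom
    { toFun := fun x => ((TensorProduct.mk S N N' (F.add x)).toAddMonoidHom).comp F'.add
      map_zero' := by ext; simp
      map_add' := fun x y => by ext; simp }
    (fun r x y => by simp [F.map_smul, F'.map_smul])

theorem tensorRes_tmul {M M' : DGModule R} {N N' : DGModule S} (F : Res φ M N)
    (F' : Res φ M' N') (x : M) (y : M') :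
    tensorRes F F' (x ⊗ₜ[R] y) = F.add x ⊗ₜ[S] F'.add y := rfl

theorem tensorRes_smul {M M' : DGModule R} {N N' : DGModule S} (F : Res φ M N)
    (F' : Res φ M' N') (r : R) (t : M ⊗[R] M') :
    tensorRes F F' (r • t) = φ r • tensorRes F F' t := by
  induction t using TensorProduct.induction_on with
  | zero => rw [smul_zero, map_zero, smul_zero]
  | tmul x y =>
    rw [TensorProduct.smul_tmul', tensorRes_tmul, tensorRes_tmul, F.map_smul,
      TensorProduct.smul_tmul']
  | add a b ha hb => rw [smul_add, map_add, map_add, ha, hb, smul_add]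

/-- Functoriality of the tensor product. -/
noncomputable def Res.tensor {M M' : DGModule R} {N N' : DGModule S} (F : Res φ M N)
    (F' : Res φ M' N') : Res φ (M.tensor M') (N.tensor N') where
  add := tensorRes F F'
  map_smul := tensorRes_smul F F'
  map_mem {n t} ht := by
    refine tensorDeg_le (E :=
      { carrier := {t | tensorRes F F' t ∈ tensorDeg N N' n}
        zero_mem' := by
          change tensorRes F F' 0 ∈ tensorDeg N N' n
          rw [map_zero]; exact zero_mem _
        add_mem' := fun {a b} ha hb => by
          change tensorRes F F' (a + b) ∈ tensorDeg N N' n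
          rw [map_add]; exact add_mem ha hb
        smul_mem' := fun r a ha => by
          change tensorRes F F' (r • a) ∈ tensorDeg N N' n
          rw [tensorRes_smul]; exact Submodule.smul_mem _ _ ha }) ?_ ht
    rintro p q e x hx y hy
    exact tmul_mem_tensorDeg e (F.map_mem hx) (F'.map_mem hy)
  map_d t := by
    change tensorRes F F' (tensorD M M' t) = tensorD N N' (tensorRes F F' t)
    induction t using TensorProduct.induction_on with
    | zero => simp
    | tmul x y =>
      rw [tensorD_tmul, map_add, tensorRes_tmul, tensorRes_tmul, tensorRes_tmul, tensorD_tmul,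
        F.map_d, F.map_sgn, F'.map_d]
    | add a b ha hb => simp only [map_add, ha, hb]

/-- A ring homomorphism `R → S` turns an algebra over `S` into one over `R`. -/
@[reducible]
noncomputable def symAlgebra (φ : R →+* S) (N : DGModule S) : Algebra R (SymAlg N) :=
  ((algebraMap S (SymAlg N)).comp φ).toAlgebra' fun r s => Algebra.commutes (φ r) s

theorem symAlgebra_smul (N : DGModule S) (r : R) (s : SymAlg N) :
    (symAlgebra φ N).toSMul.smul r s = φ r • s := by
  let _ := symAlgebra φ N
  exact (Algebra.smul_def r s).trans (Algebra.smul_def (φ r) s).symm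

/-- `x ↦ ι (F x)`. -/
noncomputable def symResLin {M : DGModule R} {N : DGModule S} (F : Res φ M N) :
    letI := symAlgebra φ N
    M →ₗ[R] SymAlg N :=
  letI := symAlgebra φ N
  { toFun := fun x => SymAlg.ι N (F.add x)
    map_add' := fun x y => by rw [map_add, map_add]
    map_smul' := fun r x => by
      rw [F.map_smul, map_smul]; exact (symAlgebra_smul N r _).symm }

theorem symResLin_rel {M : DGModule R} {N : DGModule S} (F : Res φ M N) {p q : ℕ} {x y : M}
    (hx : x ∈ M.deg p) (hy : y ∈ M.deg q) :
    letI := symAlgebra φ N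
    symResLin F x * symResLin F y = (-1 : R) ^ (p * q) • (symResLin F y * symResLin F x) := by
  refine (SymAlg.ι_comm (F.map_mem hx) (F.map_mem hy)).trans ?_
  refine Eq.trans ?_ (symAlgebra_smul N _ _).symm
  rw [map_pow, map_neg, map_one]; rfl

/-- Functoriality of the symmetric algebra. -/
noncomputable def symRes {M : DGModule R} {N : DGModule S} (F : Res φ M N) :
    SymAlg M →+* SymAlg N :=
  letI := symAlgebra φ N
  (SymAlg.lift (B := SymAlg N) (symResLin F) (symResLin_rel F)).toRingHom

theorem symRes_ι {M : DGModule R} {N : DGModule S} (F : Res φ M N) (x : M) :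
    symRes F (SymAlg.ι M x) = SymAlg.ι N (F.add x) := by
  let _ := symAlgebra φ N
  exact SymAlg.lift_ι (B := SymAlg N) (symResLin F) (symResLin_rel F) x

theorem symRes_smul {M : DGModule R} {N : DGModule S} (F : Res φ M N) (r : R) (s : SymAlg M) :
    symRes F (r • s) = φ r • symRes F s := by
  let _ := symAlgebra φ N
  exact ((SymAlg.lift (B := SymAlg N) (symResLin F) (symResLin_rel F)).map_smul_of_tower r s).trans
    (symAlgebra_smul N r _)

theorem symRes_mem {M : DGModule R} {N : DGModule S} (F : Res φ M N) {n : ℕ} {s : SymAlg M}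
    (hs : s ∈ SymAlg.deg M n) : symRes F s ∈ SymAlg.deg N n := by
  induction hs using Submodule.span_induction with
  | mem s hs =>
    induction hs with
    | one => rw [map_one]; exact SymAlg.one_mem_deg
    | mul hx _ ih =>
      rw [map_mul, symRes_ι]; exact SymAlg.ι_mul_mem_deg (F.map_mem hx) ih
  | zero => rw [map_zero]; exact zero_mem _
  | add a b _ _ ha hb => rw [map_add]; exact add_mem ha hb
  | smul r a _ ha => rw [symRes_smul]; exact Submodule.smul_mem _ _ ha

/-- Functoriality of the symmetric algebra. -/
noncomputable def Res.sym {M : DGModule R} {N : DGModule S} (F : Res φ M N) :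
    Res φ M.sym N.sym where
  add := (symRes F : SymAlg M →+* SymAlg N).toAddMonoidHom
  map_smul := symRes_smul F
  map_mem := symRes_mem F
  map_d s := by
    change symRes F (SymAlg.d M s) = SymAlg.d N (symRes F s)
    induction s using SymAlg.induction with
    | h0 => simp
    | h1 => simp [SymAlg.d_one]
    | hadd a b ha hb => simp only [map_add, ha, hb]
    | hsmul r a ha => rw [LinearMap.map_smul, symRes_smul, symRes_smul, LinearMap.map_smul, ha]
    | hmul x a ha =>
      rw [SymAlg.d_ι_mul, map_add, map_mul, map_mul, map_mul, symRes_ι, symRes_ι, symRes_ι,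
        SymAlg.d_ι_mul, F.map_d, F.map_sgn, ha]

end DGModule

end DG

section Complexes

open AlgebraicGeometry CategoryTheory Opposite
open scoped TensorProduct

/-- A presheaf of differential graded `𝒪_X`-modules. -/
structure DGPresheaf (X : Scheme.{u}) where
  /-- the sections over `U` -/
  obj (U : X.Opens) : DGModule Γ(X, U)
  /-- the restriction maps -/
  res {U V : X.Opens} (h : V ≤ U) : DGModule.Res (secRes h) (obj U) (obj V)
  res_self : ∀ (U : X.Opens) (x : obj U), (res (le_refl U)).add x = x
  res_res : ∀ {U V W : X.Opens} (h : V ≤ U) (h' : W ≤ V) (x : obj U),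
    (res h').add ((res h).add x) = (res (h'.trans h)).add x

namespace DGPresheaf

variable {X : Scheme.{u}}

/-- A morphism of presheaves of differential graded `𝒪_X`-modules. -/
structure Hom (M N : DGPresheaf X) where
  /-- the map on sections over `U` -/
  app (U : X.Opens) : DGModule.Hom (M.obj U) (N.obj U)
  naturality : ∀ {U V : X.Opens} (h : V ≤ U) (x : M.obj U),
    (app V).lin ((M.res h).add x) = (N.res h).add ((app U).lin x)

/-- The composition: first `F`, then `G`. -/
noncomputable def Hom.comp {M N P : DGPresheaf X} (F : Hom M N) (G : Hom N P) : Hom M P where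
  app U :=
    { lin := (G.app U).lin ∘ₗ (F.app U).lin
      map_mem := fun hx => (G.app U).map_mem ((F.app U).map_mem hx)
      map_d := fun x => by
        rw [LinearMap.comp_apply, LinearMap.comp_apply, (F.app U).map_d, (G.app U).map_d] }
  naturality h x := by
    rw [LinearMap.comp_apply, LinearMap.comp_apply, F.naturality, G.naturality]

/-- The presheaf tensor product. -/
noncomputable def tensor (M N : DGPresheaf X) : DGPresheaf X where
  obj U := (M.obj U).tensor (N.obj U)
  res h := (M.res h).tensor (N.res h)
  res_self U t := by
    change DGModule.tensorRes _ _ t = t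
    induction t using TensorProduct.induction_on with
    | zero => rw [map_zero]
    | tmul x y => rw [DGModule.tensorRes_tmul, M.res_self, N.res_self]
    | add a b ha hb => rw [map_add, ha, hb]
  res_res h h' t := by
    change DGModule.tensorRes _ _ (DGModule.tensorRes _ _ t) = DGModule.tensorRes _ _ t
    induction t using TensorProduct.induction_on with
    | zero => simp only [map_zero]
    | tmul x y => simp only [DGModule.tensorRes_tmul, M.res_res, N.res_res]
    | add a b ha hb => rw [map_add, map_add, map_add, ha, hb]

/-- The morphism `F ⊗ id`. -/
noncomputable def Hom.tensorId {M M' : DGPresheaf X} (F : Hom M M') (N : DGPresheaf X) :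
    Hom (M.tensor N) (M'.tensor N) where
  app U := (F.app U).tensorId (N.obj U)
  naturality {U V} h t := by
    change TensorProduct.map (F.app V).lin LinearMap.id (DGModule.tensorRes _ _ t) =
      DGModule.tensorRes _ _ (TensorProduct.map (F.app U).lin LinearMap.id t)
    induction t using TensorProduct.induction_on with
    | zero => simp only [map_zero]
    | tmul x y =>
      rw [DGModule.tensorRes_tmul, TensorProduct.map_tmul, TensorProduct.map_tmul,
        DGModule.tensorRes_tmul, F.naturality]; rfl
    | add a b ha hb => simp only [map_add, ha, hb]

/-- The presheaf of graded symmetric algebras. -/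
noncomputable def sym (M : DGPresheaf X) : DGPresheaf X where
  obj U := (M.obj U).sym
  res h := (M.res h).sym
  res_self U s := by
    change DGModule.symRes (M.res (le_refl U)) s = s
    induction s using DGModule.SymAlg.induction with
    | h0 => rw [map_zero]
    | h1 => rw [map_one]
    | hadd a b ha hb => rw [map_add, ha, hb]
    | hsmul r a ha => rw [DGModule.symRes_smul, ha, secRes_self]
    | hmul x a ha => rw [map_mul, DGModule.symRes_ι, ha, M.res_self]
  res_res h h' s := by
    change DGModule.symRes (M.res h') (DGModule.symRes (M.res h) s) =
      DGModule.symRes (M.res (h'.trans h)) s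
    induction s using DGModule.SymAlg.induction with
    | h0 => simp only [map_zero]
    | h1 => simp only [map_one]
    | hadd a b ha hb => rw [map_add, map_add, map_add, ha, hb]
    | hsmul r a ha =>
      rw [DGModule.symRes_smul, DGModule.symRes_smul, DGModule.symRes_smul, ha, secRes_secRes]
    | hmul x a ha =>
      rw [map_mul, map_mul, map_mul, DGModule.symRes_ι, DGModule.symRes_ι, DGModule.symRes_ι, ha,
        M.res_res]

/-! ### The associated complex of sheaves -/

/-- The sections over `U` of degree `n`. -/
def DegSec (M : DGPresheaf X) (n : ℕ) (U : X.Opensᵒᵖ) : Type u := (M.obj U.unop).deg n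

noncomputable instance (M : DGPresheaf X) (n : ℕ) (U : X.Opensᵒᵖ) :
    AddCommGroup (M.DegSec n U) :=
  inferInstanceAs (AddCommGroup ((M.obj U.unop).deg n))

noncomputable instance (M : DGPresheaf X) (n : ℕ) (U : X.Opensᵒᵖ) :
    Module (X.ringCatSheaf.obj.obj U) (M.DegSec n U) :=
  inferInstanceAs (Module Γ(X, U.unop) ((M.obj U.unop).deg n))

/-- The presheaf of `𝒪_X`-modules of elements of degree `n`. -/
noncomputable def presheafDeg (M : DGPresheaf X) (n : ℕ) : X.PresheafOfModules where
  obj U := ModuleCat.of (X.ringCatSheaf.obj.obj U) (M.DegSec n U)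
  map {U V} i := ModuleCat.ofHom
    (Y := (ModuleCat.restrictScalars (X.ringCatSheaf.obj.map i).hom).obj
      (ModuleCat.of (X.ringCatSheaf.obj.obj V) (M.DegSec n V)))
    { toFun := fun x => (⟨(M.res i.unop.le).add x.1, (M.res i.unop.le).map_mem x.2⟩ : M.DegSec n V)
      map_add' := fun x y => Subtype.ext (map_add (M.res i.unop.le).add x.1 y.1)
      map_smul' := fun r x => Subtype.ext ((M.res i.unop.le).map_smul r x.1) }
  map_id U := by
    ext x
    exact Subtype.ext (M.res_self U.unop x.1)
  map_comp {U V W} i j := by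
    ext x
    exact Subtype.ext (M.res_res i.unop.le j.unop.le x.1).symm

/-- The differential in degree `n`. -/
noncomputable def presheafD (M : DGPresheaf X) (n : ℕ) :
    M.presheafDeg n ⟶ M.presheafDeg (n + 1) where
  app U := ModuleCat.ofHom (((M.obj U.unop).d.domRestrict _).codRestrict ((M.obj U.unop).deg (n + 1))
    fun x => (M.obj U.unop).d_mem x.2)
  naturality {U V} i := by
    ext x
    exact Subtype.ext ((M.res i.unop.le).map_d x.1).symm

/-- The complex of presheaves of `𝒪_X`-modules. -/
noncomputable def presheafComplex (M : DGPresheaf X) : CochainComplex X.PresheafOfModules ℕ :=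
  CochainComplex.of M.presheafDeg M.presheafD fun n => by
    ext U x
    exact Subtype.ext ((M.obj U.unop).d_d x.1)

/-- The morphism in degree `n`. -/
noncomputable def Hom.presheafDeg {M N : DGPresheaf X} (F : Hom M N) (n : ℕ) :
    M.presheafDeg n ⟶ N.presheafDeg n where
  app U := ModuleCat.ofHom (((F.app U.unop).lin.domRestrict _).codRestrict ((N.obj U.unop).deg n)
    fun x => (F.app U.unop).map_mem x.2)
  naturality {U V} i := by
    ext x
    exact Subtype.ext (F.naturality i.unop.le x.1)

/-- The morphism of complexes of presheaves of `𝒪_X`-modules. -/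
noncomputable def Hom.presheafComplex {M N : DGPresheaf X} (F : Hom M N) :
    M.presheafComplex ⟶ N.presheafComplex :=
  CochainComplex.ofHom F.presheafDeg fun n => by
    simp only [DGPresheaf.presheafComplex, CochainComplex.of_d]
    ext U x
    exact Subtype.ext ((F.app U.unop).map_d x.1).symm

end DGPresheaf

/-- Sheafification of presheaves of `𝒪_X`-modules. -/
noncomputable def sheafify (X : Scheme.{u}) : X.PresheafOfModules ⥤ X.Modules :=
  PresheafOfModules.sheafification (𝟙 X.ringCatSheaf.obj)

instance (X : Scheme.{u}) : (sheafify X).PreservesZeroMorphisms := by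
  have : (sheafify X).IsLeftAdjoint :=
    (PresheafOfModules.sheafificationAdjunction (𝟙 X.ringCatSheaf.obj)).isLeftAdjoint
  infer_instance

/-- The complex of sheaves of `𝒪_X`-modules associated with `M`. -/
noncomputable def DGPresheaf.complex {X : Scheme.{u}} (M : DGPresheaf X) :
    CochainComplex X.Modules ℕ :=
  ((sheafify X).mapHomologicalComplex (ComplexShape.up ℕ)).obj M.presheafComplex

/-- The morphism of complexes of sheaves of `𝒪_X`-modules associated with `F`. -/
noncomputable def DGPresheaf.Hom.complex {X : Scheme.{u}} {M N : DGPresheaf X} (F : Hom M N) :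
    M.complex ⟶ N.complex :=
  ((sheafify X).mapHomologicalComplex (ComplexShape.up ℕ)).map F.presheafComplex

end Complexes

section Statement

open AlgebraicGeometry CategoryTheory Opposite
open scoped TensorProduct

variable {K : Type u} [Field K] {X : Scheme.{u}} (f : X ⟶ Spec (CommRingCat.of K))

theorem directSum_map_smul {R S : Type u} [CommRing R] [CommRing S] {φ : R →+* S}
    {M N : ℕ → Type u} [∀ n, AddCommGroup (M n)] [∀ n, Module R (M n)]
    [∀ n, AddCommGroup (N n)] [∀ n, Module S (N n)]
    (r : ∀ n, M n →+ N n) (hs : ∀ n (c : R) (x : M n), r n (c • x) = φ c • r n x) (c : R)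
    (x : DirectSum ℕ M) : DirectSum.map r (c • x) = φ c • DirectSum.map r x := by
  induction x using DirectSum.induction_on with
  | zero => simp
  | of n x =>
    rw [← DirectSum.lof_eq_of R, ← map_smul, DirectSum.lof_eq_of, DirectSum.lof_eq_of,
      DirectSum.map_of, DirectSum.map_of, hs, ← DirectSum.lof_eq_of S, ← DirectSum.lof_eq_of S,
      map_smul]
  | add x y hx hy => rw [smul_add, map_add, map_add, hx, hy, smul_add]

/-- The morphism of direct sums given by a morphism of complexes over a ring homomorphism. -/
noncomputable def resOfComplex {R S : Type u} [CommRing R] [CommRing S] {φ : R →+* S}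
    {M N : ℕ → Type u} [∀ n, AddCommGroup (M n)] [∀ n, Module R (M n)]
    [∀ n, AddCommGroup (N n)] [∀ n, Module S (N n)]
    {d : ∀ n, M n →ₗ[R] M (n + 1)} {hd : ∀ n x, d (n + 1) (d n x) = 0}
    {d' : ∀ n, N n →ₗ[S] N (n + 1)} {hd' : ∀ n x, d' (n + 1) (d' n x) = 0}
    (r : ∀ n, M n →+ N n) (hs : ∀ n (c : R) (x : M n), r n (c • x) = φ c • r n x)
    (hr : ∀ n (x : M n), r (n + 1) (d n x) = d' n (r n x)) :
    DGModule.Res φ (DGModule.ofComplex M d hd) (DGModule.ofComplex N d' hd') where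
  add := (DirectSum.map r : DirectSum ℕ M →+ DirectSum ℕ N)
  map_smul := directSum_map_smul r hs
  map_mem := by
    rintro n _ ⟨x, rfl⟩
    exact ⟨r n x, (DirectSum.map_of r n x).symm⟩
  map_d x := by
    change DirectSum.map r (DirectSum.toModule R ℕ _ _ x) =
      DirectSum.toModule S ℕ _ _ (DirectSum.map r x)
    induction x using DirectSum.induction_on with
    | zero => simp
    | of n x =>
      rw [DirectSum.map_of, ← DirectSum.lof_eq_of R, ← DirectSum.lof_eq_of S,
        DirectSum.toModule_lof, DirectSum.toModule_lof, LinearMap.comp_apply, LinearMap.comp_apply,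
        ← hr]
      exact DirectSum.map_of r _ _
    | add x y hx hy => simp only [map_add, hx, hy]

/-- The presheaf (in fact a sheaf in each degree) `D_poly^•` of polydifferential operators, with
the Hochschild coboundary. -/
noncomputable def Dpoly : DGPresheaf X where
  obj U := DGModule.ofComplex (PD f U) PD.d fun _ F => PD.d_d F
  res h := resOfComplex (PD.res h) (fun _ r F => PD.res_smul h r F) fun _ F => PD.res_d h F
  res_self U x := by
    change DirectSum.map (PD.res (le_refl U)) x = x
    induction x using DirectSum.induction_on with
    | zero => rw [map_zero]
    | of n x => rw [DirectSum.map_of]; rfl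
    | add x y hx hy => rw [map_add, hx, hy]
  res_res h h' x := by
    change DirectSum.map (PD.res h') (DirectSum.map (PD.res h) x) =
      DirectSum.map (PD.res (h'.trans h)) x
    induction x using DirectSum.induction_on with
    | zero => simp only [map_zero]
    | of n x => rw [DirectSum.map_of, DirectSum.map_of, DirectSum.map_of]; rfl
    | add x y hx hy => simp only [map_add, hx, hy]

/-- The Hochschild coboundary preserves the free Lie algebra. -/
def PreservesFreeLie : Prop :=
  ∀ (U : X.Opens) (n : ℕ), ∀ F ∈ freeLie f U n, PD.d n F ∈ freeLie f U (n + 1)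

variable {f}

/-- Restriction of sections of the free Lie algebra. -/
noncomputable def freeLieRes {U V : X.Opens} (h : V ≤ U) (n : ℕ) :
    freeLie f U n →+ freeLie f V n where
  toFun F := ⟨PD.res h n F.1, freeLie_res h F.2⟩
  map_zero' := rfl
  map_add' _ _ := rfl

/-- The free graded Lie algebra `L(D_poly^1)` with the Hochschild coboundary. -/
noncomputable def Lie (hL : PreservesFreeLie f) : DGPresheaf X where
  obj U := DGModule.ofComplex (fun n => freeLie f U n)
    (fun n => (PD.d n).restrict (hL U n)) fun _ x => Subtype.ext (PD.d_d x.1)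
  res h := resOfComplex (freeLieRes h) (fun _ r F => Subtype.ext (PD.res_smul h r F.1))
    fun _ F => Subtype.ext (PD.res_d h F.1)
  res_self U x := by
    change DirectSum.map (freeLieRes (le_refl U)) x = x
    induction x using DirectSum.induction_on with
    | zero => rw [map_zero]
    | of n x => rw [DirectSum.map_of]; rfl
    | add x y hx hy => rw [map_add, hx, hy]
  res_res h h' x := by
    change DirectSum.map (freeLieRes h') (DirectSum.map (freeLieRes h) x) =
      DirectSum.map (freeLieRes (h'.trans h)) x
    induction x using DirectSum.induction_on with
    | zero => simp only [map_zero]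
    | of n x => rw [DirectSum.map_of, DirectSum.map_of, DirectSum.map_of]; rfl
    | add x y hx hy => simp only [map_add, hx, hy]

/-! ### The arrows of the diagram -/

/-- The bracket of the free Lie algebra. -/
noncomputable def lieBracket {U : X.Opens} {p q : ℕ} (z : freeLie f U p) (y : freeLie f U q) :
    freeLie f U (p + q) :=
  ⟨z.1.bracket y.1, freeLie_bracket z.2 y.2⟩

/-- A polydifferential operator in `n` arguments, as a homogeneous element of `D_poly^•`. -/
noncomputable def pdOf {U : X.Opens} {n : ℕ} (F : PD f U n) : DirectSum ℕ (PD f U) :=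
  DirectSum.of (PD f U) n F

/-- A homogeneous element of the free Lie algebra. -/
noncomputable def lieOf (hL : PreservesFreeLie f) {U : X.Opens} {n : ℕ} (F : freeLie f U n) :
    (Lie hL).obj U :=
  DirectSum.of (fun n => freeLie f U n) n F

/-- A homogeneous element of the free Lie algebra, as an element of its symmetric algebra. -/
noncomputable def symOf (hL : PreservesFreeLie f) {U : X.Opens} {n : ℕ} (F : freeLie f U n) :
    DGModule.SymAlg ((Lie hL).obj U) :=
  DGModule.SymAlg.ι _ (lieOf hL F)

/-- The Koszul sign: the sign `s(σ)` such that `z_1 ⋯ z_k = s(σ) z_{σ(1)} ⋯ z_{σ(k)}` for graded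
commuting elements `z_i` of degree `d i`. -/
def koszulSign {k : ℕ} (d : Fin k → ℕ) (σ : Equiv.Perm (Fin k)) : ℤ :=
  ∏ i : Fin k, ∏ j : Fin k, if i < j ∧ σ j < σ i then (-1) ^ (d (σ i) * d (σ j)) else 1

/-- `m (a ⊗ y) = a y`, the multiplication of `D_poly^•`, for `y` in the free Lie algebra. -/
def IsMultiplication {hL : PreservesFreeLie f}
    (m : DGPresheaf.Hom ((Dpoly f).tensor (Lie hL)) (Dpoly f)) : Prop :=
  ∀ (U : X.Opens) (a : DirectSum ℕ (PD f U)) (n : ℕ) (y : freeLie f U n),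
    (m.app U).lin ((show (Dpoly f).obj U from a) ⊗ₜ[Γ(X, U)] lieOf hL y) = a * pdOf y.1

/-- `μ (s ⊗ y) = s y`, the product of the symmetric algebra. -/
def IsSymProduct {hL : PreservesFreeLie f}
    (μ : DGPresheaf.Hom ((Lie hL).sym.tensor (Lie hL)) (Lie hL).sym) : Prop :=
  ∀ (U : X.Opens) (s : DGModule.SymAlg ((Lie hL).obj U)) (y : (Lie hL).obj U),
    (μ.app U).lin ((show (Lie hL).sym.obj U from s) ⊗ₜ[Γ(X, U)] y) = s * DGModule.SymAlg.ι _ y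

/-- The symmetrization map
`I (z_1 ⋯ z_k) = (1 / k!) ∑_σ s(σ) z_{σ(1)} ⋯ z_{σ(k)}` for homogeneous `z_i` of degree `d i`. -/
def IsSymmetrization {hL : PreservesFreeLie f}
    (I : DGPresheaf.Hom (Lie hL).sym (Dpoly f)) : Prop :=
  ∀ (U : X.Opens) (k : ℕ) (d : Fin k → ℕ) (z : ∀ i, freeLie f U (d i)),
    (I.app U).lin (List.ofFn fun i => symOf hL (z i)).prod =
      secMap f U (k.factorial : K)⁻¹ •
        ∑ σ : Equiv.Perm (Fin k), koszulSign d σ • (List.ofFn fun i => pdOf (z (σ i)).1).prod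

/-- `ω (z_1 ⋯ z_k ⊗ y) =
  ∑_i (-1)^{d_i (d_{i+1} + ⋯ + d_k)} z_1 ⋯ (omit z_i) ⋯ z_k ⊗ [z_i, y]`. -/
def IsOmega {hL : PreservesFreeLie f}
    (ω : DGPresheaf.Hom ((Lie hL).sym.tensor (Lie hL)) ((Lie hL).sym.tensor (Lie hL))) : Prop :=
  ∀ (U : X.Opens) (k : ℕ) (d : Fin k → ℕ) (z : ∀ i, freeLie f U (d i)) (e : ℕ)
    (y : freeLie f U e),
    (ω.app U).lin ((show (Lie hL).sym.obj U from (List.ofFn fun i => symOf hL (z i)).prod)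
        ⊗ₜ[Γ(X, U)] lieOf hL y) =
      ∑ i : Fin k, (-1 : ℤ) ^ (d i * ∑ j ∈ Finset.Ioi i, d j) •
        ((show (Lie hL).sym.obj U from ((List.ofFn fun i => symOf hL (z i)).eraseIdx i).prod)
          ⊗ₜ[Γ(X, U)] lieOf hL (lieBracket (z i) y))

/-- The right adjoint action, by graded derivations:
`ad (z_1 ⋯ z_k ⊗ y) = ∑_i (-1)^{e (d_{i+1} + ⋯ + d_k)} z_1 ⋯ [z_i, y] ⋯ z_k` for `y` of
degree `e`. -/
def IsRightAdjoint {hL : PreservesFreeLie f}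
    (ad : DGPresheaf.Hom ((Lie hL).sym.tensor (Lie hL)) (Lie hL).sym) : Prop :=
  ∀ (U : X.Opens) (k : ℕ) (d : Fin k → ℕ) (z : ∀ i, freeLie f U (d i)) (e : ℕ)
    (y : freeLie f U e),
    (ad.app U).lin ((show (Lie hL).sym.obj U from (List.ofFn fun i => symOf hL (z i)).prod)
        ⊗ₜ[Γ(X, U)] lieOf hL y) =
      ∑ i : Fin k, (-1 : ℤ) ^ (e * ∑ j ∈ Finset.Ioi i, d j) •
        ((List.ofFn fun i => symOf hL (z i)).set i (symOf hL (lieBracket (z i) y))).prod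

/-- The power series `t / (1 - exp (-t))`. -/
noncomputable def todd : PowerSeries ℚ := bernoulli'PowerSeries ℚ

theorem todd_mul : todd * (1 - PowerSeries.evalNegHom (PowerSeries.exp ℚ)) = PowerSeries.X := by
  have h := bernoulli'PowerSeries_mul_exp_sub_one ℚ
  have h' := PowerSeries.exp_mul_exp_neg_eq_one (A := ℚ)
  calc todd * (1 - PowerSeries.evalNegHom (PowerSeries.exp ℚ))
      = bernoulli'PowerSeries ℚ * (PowerSeries.exp ℚ - 1) *
          PowerSeries.evalNegHom (PowerSeries.exp ℚ) := by
        rw [todd]; linear_combination (-bernoulli'PowerSeries ℚ) * h'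
    _ = PowerSeries.X := by rw [h, mul_assoc, h', mul_one]

/-- `φ = c(ω)` for the power series `c` and a locally nilpotent endomorphism `ω`. -/
def IsPowerSeriesEval (f : X ⟶ Spec (CommRingCat.of K)) (c : PowerSeries ℚ)
    {M : DGPresheaf X} (ω φ : DGPresheaf.Hom M M) : Prop :=
  ∀ (U : X.Opens) (x : M.obj U), ∃ N : ℕ,
    ((ω.app U).lin ^ N : Module.End Γ(X, U) (M.obj U)) x = 0 ∧
    (φ.app U).lin x = ∑ j ∈ Finset.range N, secMap f U ((PowerSeries.coeff j c : ℚ) : K) •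
      ((ω.app U).lin ^ j : Module.End Γ(X, U) (M.obj U)) x

end Statement

end DPoly

open AlgebraicGeometry CategoryTheory

/-! There are two things to prove: the Hochschild coboundary `d` preserves L, and the symmetrization
map I satisfies the stated identity.

Since `d` is a graded derivation of the product (`hochD_cochainMul`), it is one of the bracket
(`PD.d_bracket`). Hence it is enough that `d D` is, locally, a sum of brackets for every
differential operator D. Near each point of a smooth scheme there are coordinates x_i with dual
derivations ∂_i. If D has order at most n, then n D - ∑ [D, x_i] ∂_i has smaller order
(`IsCoordinates.euler`), so in characteristic 0 induction on the order writes D as a combination of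
words in the ∂_i. Words are treated by induction on their length: d(id) = ½ [id, id], and d(v ∘ F) =
v ∘ dF - [v, F] for a vector field v (`VectorField.d_comp`), where v ∘ _ sends brackets to sums of
brackets.

For the identity, let Δ : Sym L → Sym L ⊗ L be the coaction that extracts one letter, so that ω =
(id ⊗ [ , ]) ∘ (Δ ⊗ id). Let O_0 be the augmentation followed by the unit, and O_{k+1} = m ∘ (O_k ⊗
id) ∘ Δ; on Sym^k one has I = O_k / k!. The last letter of an ordering of s y is either y or a
letter z of s. Therefore O_{k+1} μ = m (O_k ⊗ id) + T (O_k μ), where T extracts z from s and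
multiplies by it at the far right. Put W(l, i) = m (O_l ⊗ id) ω^i. The relation ± a y z = a z y - a
[z, y] gives T W(l, 0) = W(l+1, 0) - W(l, 1) (`insertOp_orderings`), and T commutes with
precomposition by ω because Δ is graded cocommutative (`braid_coaction₂`, `moveLast_adTensor`).
Pascal's rule then yields O_{k+1} μ = ∑ (-1)^i C(k+1, i+1) W(k-i, i) (`orderings_symMul`). Division
by (k+1)! turns this into I μ = m (I ⊗ id) (1 - e^{-ω}) / ω, and multiplication by the inverse
series t / (1 - e^{-t}) gives the claim.

The second argument uses only that m is a right action of L. It is carried out over every open set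
separately; all maps are compatible with restriction, so the identity holds for presheaves, and
sheafification transports it. -/

namespace DPoly

/-! ### Differential operators in coordinates, and their generation by derivations in characteristic
0. -/

section DifferentialOperators

variable {K R : Type u} [CommRing K] [CommRing R] [Algebra K R]

/-- The commutator of a linear map with multiplication by `a`. -/
def commMul (D : R →ₗ[K] R) (a : R) : R →ₗ[K] R :=
  D ∘ₗ LinearMap.mulLeft K a - LinearMap.mulLeft K a ∘ₗ D

theorem commMul_apply (D : R →ₗ[K] R) (a x : R) : commMul D a x = D (a * x) - a * D x := rfl

theorem commMul_comm (D : R →ₗ[K] R) (a b : R) :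
    commMul (commMul D a) b = commMul (commMul D b) a := by
  ext x
  simp only [commMul_apply, mul_left_comm b a]
  ring

/-- Differential operators of order less than `n`. -/
def IsDiffOpLT : ℕ → (R →ₗ[K] R) → Prop
  | 0, D => D = 0
  | n + 1, D => IsDiffOp n D

/-- With the shift by one, level 0 means D = 0 and one recursion covers all levels, so inductions on
the order can start from the zero operator. -/
theorem isDiffOpLT_succ {n : ℕ} {D : R →ₗ[K] R} :
    IsDiffOpLT (n + 1) D ↔ ∀ a, IsDiffOpLT n (commMul D a) := by
  cases n <;> rfl

theorem isDiffOpLT_zero_map (n : ℕ) : IsDiffOpLT n (0 : R →ₗ[K] R) := by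
  cases n
  · rfl
  · exact isDiffOp_zero_map _

theorem IsDiffOpLT.add {n : ℕ} {D E : R →ₗ[K] R} (h : IsDiffOpLT n D) (h' : IsDiffOpLT n E) :
    IsDiffOpLT n (D + E) := by
  cases n with
  | zero => rw [show D = 0 from h, show E = 0 from h', add_zero]; exact isDiffOpLT_zero_map 0
  | succ n => exact IsDiffOp.add h h'

theorem IsDiffOpLT.smul {n : ℕ} {D : R →ₗ[K] R} (c : R) (h : IsDiffOpLT n D) :
    IsDiffOpLT n (c • D) := by
  cases n with
  | zero => rw [show D = 0 from h, smul_zero]; exact isDiffOpLT_zero_map 0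
  | succ n => exact IsDiffOp.smul c h

theorem IsDiffOpLT.sub {n : ℕ} {D E : R →ₗ[K] R} (h : IsDiffOpLT n D) (h' : IsDiffOpLT n E) :
    IsDiffOpLT n (D - E) := by
  have e : D - E = D + (-1 : R) • E := by ext; simp [sub_eq_add_neg]
  rw [e]
  exact h.add (h'.smul (-1))

theorem IsDiffOpLT.sum {α : Type*} {n : ℕ} {D : α → R →ₗ[K] R} (s : Finset α)
    (h : ∀ i ∈ s, IsDiffOpLT n (D i)) : IsDiffOpLT n (∑ i ∈ s, D i) := by
  classical
  induction s using Finset.induction_on with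
  | empty => exact isDiffOpLT_zero_map n
  | insert i s hi ih =>
    rw [Finset.sum_insert hi]
    exact (h i (Finset.mem_insert_self i s)).add
      (ih fun j hj => h j (Finset.mem_insert_of_mem hj))

theorem IsDiffOpLT.comp_mul {n : ℕ} {D : R →ₗ[K] R} (c : R) (h : IsDiffOpLT n D) :
    IsDiffOpLT n (D ∘ₗ LinearMap.mulLeft K c) := by
  cases n with
  | zero => rw [show D = 0 from h, LinearMap.zero_comp]; exact isDiffOpLT_zero_map 0
  | succ n => exact IsDiffOp.comp_mul c h

/-- Leibniz rule for δ (a x). The second term does not involve δ as an operator, which is why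
composing with a derivation raises the order by at most one. -/
theorem commMul_comp_derivation (D : R →ₗ[K] R) (δ : Derivation K R R) (a : R) :
    commMul (D ∘ₗ δ.toLinearMap) a =
      commMul D a ∘ₗ δ.toLinearMap + D ∘ₗ LinearMap.mulLeft K (δ a) := by
  ext x
  simp [commMul_apply, mul_comm x]
  ring

theorem commMul_derivation_comp (D : R →ₗ[K] R) (δ : Derivation K R R) (a : R) :
    commMul (δ.toLinearMap ∘ₗ D) a = δ.toLinearMap ∘ₗ commMul D a + δ a • D := by
  ext x
  simp [commMul_apply]
  ring

theorem IsDiffOpLT.comp_derivation {n : ℕ} {D : R →ₗ[K] R} (δ : Derivation K R R)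
    (h : IsDiffOpLT n D) : IsDiffOpLT (n + 1) (D ∘ₗ δ.toLinearMap) := by
  induction n generalizing D with
  | zero => rw [show D = 0 from h, LinearMap.zero_comp]; exact isDiffOpLT_zero_map _
  | succ n ih =>
    rw [isDiffOpLT_succ]
    intro a
    rw [commMul_comp_derivation]
    exact (ih (isDiffOpLT_succ.1 h a)).add (h.comp_mul _)

theorem IsDiffOpLT.derivation_comp {n : ℕ} {D : R →ₗ[K] R} (δ : Derivation K R R)
    (h : IsDiffOpLT n D) : IsDiffOpLT (n + 1) (δ.toLinearMap ∘ₗ D) := by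
  induction n generalizing D with
  | zero => rw [show D = 0 from h, LinearMap.comp_zero]; exact isDiffOpLT_zero_map _
  | succ n ih =>
    rw [isDiffOpLT_succ]
    intro a
    rw [commMul_derivation_comp]
    exact (ih (isDiffOpLT_succ.1 h a)).add (h.smul _)

theorem IsDiffOpLT.eq_mulLeft {D : R →ₗ[K] R} (h : IsDiffOpLT 1 D) :
    D = D 1 • LinearMap.id := by
  ext x
  have := LinearMap.congr_fun (isDiffOpLT_succ.1 h x) 1
  simp only [commMul_apply, LinearMap.zero_apply, mul_one] at this
  simp [sub_eq_zero.1 this, mul_comm]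

/-- Elements `x i` whose differentials generate the Kähler differentials, together with
derivations `∂ i` such that `∂ i (x j) = δ_{ij}`. -/
structure IsCoordinates {ι : Type*} [DecidableEq ι] (x : ι → R) (δ : ι → Derivation K R R) :
    Prop where
  span_D : Submodule.span R (Set.range fun i => KaehlerDifferential.D K R (x i)) = ⊤
  apply_eq : ∀ i j, δ i (x j) = if i = j then 1 else 0

/-- A derivation factors through the Kähler differentials, which the dx_i span. The target is an
arbitrary module because restriction to a smaller open set produces derivations with values in
another ring. -/
theorem derivation_eq_zero_of_span {ι : Type*} {x : ι → R}
    (hx : Submodule.span R (Set.range fun i => KaehlerDifferential.D K R (x i)) = ⊤)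
    {M : Type*} [AddCommGroup M] [Module R M] [Module K M] [IsScalarTower K R M]
    (δ : Derivation K R M) (h : ∀ i, δ (x i) = 0) : δ = 0 := by
  have : δ.liftKaehlerDifferential = 0 := by
    refine LinearMap.ext_on_range (v := fun i => KaehlerDifferential.D K R (x i)) hx fun i => ?_
    rw [Derivation.liftKaehlerDifferential_comp_D, h, LinearMap.zero_apply]
  rw [← δ.liftKaehlerDifferential_comp, this]
  ext; rfl

/-- An operator of order one, up to its constant term, is a derivation. -/
def IsDiffOpLT.toDerivation {D : R →ₗ[K] R} (h : IsDiffOpLT 2 D) : Derivation K R R :=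
  Derivation.mk' (D - D 1 • LinearMap.id) fun a b => by
    have h1 := LinearMap.congr_fun (isDiffOpLT_succ.1 h a).eq_mulLeft b
    simp only [commMul_apply, mul_one, LinearMap.smul_apply, LinearMap.id_apply,
      smul_eq_mul] at h1
    simp only [LinearMap.sub_apply, LinearMap.smul_apply, LinearMap.id_apply, smul_eq_mul]
    linear_combination h1

section Words

variable {ι : Type*} {δ : ι → Derivation K R R}

/-- Compositions of coordinate derivations. -/
def derivationWord (δ : ι → Derivation K R R) (l : List ι) : R →ₗ[K] R :=
  l.foldr (fun i D => (δ i).toLinearMap ∘ₗ D) LinearMap.id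

/-- Words grow on the left by definition, whereas the Euler operator composes with ∂_i on the right.
-/
theorem derivationWord_append_singleton (l : List ι) (i : ι) :
    derivationWord δ (l ++ [i]) = derivationWord δ l ∘ₗ (δ i).toLinearMap := by
  induction l with
  | nil => rfl
  | cons j l ih => exact congrArg ((δ j).toLinearMap ∘ₗ ·) ih

theorem comp_mem_span_derivationWord {D : R →ₗ[K] R}
    (h : D ∈ Submodule.span R (Set.range (derivationWord δ))) (i : ι) :
    D ∘ₗ (δ i).toLinearMap ∈ Submodule.span R (Set.range (derivationWord δ)) := by
  induction h using Submodule.span_induction with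
  | mem D hD =>
    obtain ⟨l, rfl⟩ := hD
    exact Submodule.subset_span ⟨l ++ [i], derivationWord_append_singleton l i⟩
  | zero => rw [LinearMap.zero_comp]; exact zero_mem _
  | add D E _ _ hD hE => rw [LinearMap.add_comp]; exact add_mem hD hE
  | smul c D _ hD => exact Submodule.smul_mem _ c hD

end Words

section Coordinates

variable {ι : Type*} [DecidableEq ι] {x : ι → R} {δ : ι → Derivation K R R}

/-- The order of a differential operator is determined by its commutators with coordinates. -/
theorem IsCoordinates.isDiffOpLT_succ_of (hx : IsCoordinates x δ) {N n : ℕ} {D : R →ₗ[K] R}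
    (hD : IsDiffOpLT N D) (h : ∀ i, IsDiffOpLT n (commMul D (x i))) : IsDiffOpLT (n + 1) D := by
  induction N generalizing n D with
  | zero => rw [show D = 0 from hD]; exact isDiffOpLT_zero_map _
  | succ N ih =>
    cases n with
    | succ n =>
      -- Commutators with b and with x_i commute, so [D, b] satisfies the same hypothesis with both
      -- N and n lowered by one.
      refine isDiffOpLT_succ.2 fun b => ih (isDiffOpLT_succ.1 hD b) fun i => ?_
      rw [commMul_comm]
      exact isDiffOpLT_succ.1 (h i) b
    | zero =>
      -- Here D commutes with all coordinates, and hence so does every [D, b]. By induction [D, b]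
      -- has order 0, so D is a constant plus a derivation; that derivation kills the coordinates
      -- and vanishes.
      have h2 : IsDiffOpLT 2 D := by
        refine isDiffOpLT_succ.2 fun b => ih (isDiffOpLT_succ.1 hD b) fun i => ?_
        rw [commMul_comm, show commMul D (x i) = 0 from h i]
        change commMul 0 b = 0
        ext; simp [commMul_apply]
      have h3 : h2.toDerivation = 0 := by
        refine derivation_eq_zero_of_span hx.span_D _ fun i => ?_
        have := LinearMap.congr_fun (h i) 1
        simp only [commMul_apply, mul_one, LinearMap.zero_apply] at this
        change D (x i) - D 1 * x i = 0
        rw [mul_comm, this]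
      intro a
      ext b
      have h4 : ∀ c, D c = D 1 * c := fun c => sub_eq_zero.1 (DFunLike.congr_fun h3 c)
      simp only [LinearMap.sub_apply, LinearMap.comp_apply, LinearMap.mulLeft_apply,
        LinearMap.zero_apply]
      rw [h4 (a * b), h4 b]; ring

/-- The commutators with the coordinates again vanish on S and are zero by induction, so D is
multiplication by D 1 = 0. With S the image of a restriction map, this shows that an operator on a
chart determines its restrictions to smaller affine open sets. -/
theorem IsCoordinates.eq_zero_of_forall (hx : IsCoordinates x δ) {N : ℕ} {D : R →ₗ[K] R}
    (hD : IsDiffOpLT N D) (S : Subring R) (hS : ∀ i, x i ∈ S) (h : ∀ a ∈ S, D a = 0) :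
    D = 0 := by
  induction N generalizing D with
  | zero => exact hD
  | succ N ih =>
    have h1 : IsDiffOpLT 1 D := by
      refine hx.isDiffOpLT_succ_of hD fun i => ih (isDiffOpLT_succ.1 hD _) fun a ha => ?_
      rw [commMul_apply, h _ ha, h _ (S.mul_mem (hS i) ha), mul_zero, sub_zero]
    rw [h1.eq_mulLeft, h 1 S.one_mem, zero_smul]

variable [Fintype ι]

/-- The Euler operator acts on operators of order `n` by `n`, up to operators of lower order. -/
theorem IsCoordinates.euler (hx : IsCoordinates x δ) {n : ℕ} {D : R →ₗ[K] R}
    (hD : IsDiffOpLT (n + 1) D) :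
    IsDiffOpLT n ((n : R) • D - ∑ i, commMul D (x i) ∘ₗ (δ i).toLinearMap) := by
  induction n generalizing D with
  | zero =>
    have : ∀ i, commMul D (x i) = 0 := fun i => isDiffOpLT_succ.1 hD (x i)
    simp only [this, LinearMap.zero_comp, Finset.sum_const_zero]
    simpa using isDiffOpLT_zero_map 0
  | succ n ih =>
    refine hx.isDiffOpLT_succ_of (N := n + 2) ((hD.smul _).sub
      (IsDiffOpLT.sum _ fun i _ => (isDiffOpLT_succ.1 hD _).comp_derivation _)) fun j => ?_
    -- Bracketing the expression for D with x_j gives the same expression for [D, x_j], with n in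
    -- place of n + 1: since ∂_i x_j is 1 or 0, the Leibniz term in the sum is exactly one copy of
    -- [D, x_j].
    convert ih (isDiffOpLT_succ.1 hD (x j)) using 1
    have h1 : commMul D (x j) = ∑ i, commMul D (x i) ∘ₗ LinearMap.mulLeft K (δ i (x j)) := by
      rw [Finset.sum_eq_single j]
      · rw [hx.apply_eq, if_pos rfl]; ext; simp
      · intro i _ hij
        rw [hx.apply_eq, if_neg hij]; ext; simp
      · simp
    have h2 : ∑ i, commMul (commMul D (x j)) (x i) ∘ₗ (δ i).toLinearMap + commMul D (x j) =
        ∑ i, commMul (commMul D (x i) ∘ₗ (δ i).toLinearMap) (x j) := by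
      refine (congrArg _ h1).trans ?_
      rw [← Finset.sum_add_distrib]
      refine Finset.sum_congr rfl fun i _ => ?_
      rw [commMul_comp_derivation, commMul_comm]
    rw [eq_sub_of_add_eq h2]
    ext a
    simp only [commMul_apply, LinearMap.sub_apply, LinearMap.smul_apply, LinearMap.sum_apply,
      Finset.sum_sub_distrib, smul_eq_mul, Nat.cast_succ]
    rw [mul_sub, Finset.mul_sum]
    ring

end Coordinates

end DifferentialOperators

/-- By the Euler identity a positive multiple of D is an operator of lower order plus terms [D, x_i]
∂_i with [D, x_i] of lower order. Characteristic 0 is needed to divide by the order. -/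
theorem IsCoordinates.mem_span_derivationWord {K R : Type u} [Field K] [CharZero K] [CommRing R]
    [Algebra K R] {ι : Type*} [DecidableEq ι] [Fintype ι] {x : ι → R} {δ : ι → Derivation K R R}
    (hx : IsCoordinates x δ) {n : ℕ} {D : R →ₗ[K] R} (hD : IsDiffOpLT n D) :
    D ∈ Submodule.span R (Set.range (derivationWord δ)) := by
  induction n generalizing D with
  | zero => rw [show D = 0 from hD]; exact zero_mem _
  | succ n ih =>
    cases n with
    | zero =>
      rw [hD.eq_mulLeft]
      exact Submodule.smul_mem _ _ (Submodule.subset_span ⟨[], rfl⟩)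
    | succ n =>
      have h1 : ((n + 1 : ℕ) : R) • D ∈ Submodule.span R (Set.range (derivationWord δ)) := by
        rw [← sub_add_cancel (((n + 1 : ℕ) : R) • D)
          (∑ i, commMul D (x i) ∘ₗ (δ i).toLinearMap)]
        exact add_mem (ih (hx.euler hD)) (Submodule.sum_mem _ fun i _ =>
          comp_mem_span_derivationWord (ih (isDiffOpLT_succ.1 hD _)) i)
      have h2 := Submodule.smul_mem _ (algebraMap K R ((n + 1 : ℕ) : K)⁻¹) h1
      rwa [smul_smul, ← map_natCast (algebraMap K R), ← map_mul,
        inv_mul_cancel₀ (Nat.cast_ne_zero.2 n.succ_ne_zero), map_one, one_smul] at h2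

end DPoly

/-! ### Coordinates on smooth schemes. -/

namespace DPoly

section Coordinates

open KaehlerDifferential

/-- In a standard smooth presentation, the variables outside the range of `P.map`, those not solved
for by the Jacobian, have differentials that form a basis. -/
theorem exists_kaehlerDifferential_basis (K R : Type u) [CommRing K] [CommRing R] [Algebra K R]
    [Algebra.IsStandardSmooth K R] : ∃ (ι : Type) (_ : Fintype ι) (x : ι → R)
      (b : Module.Basis ι R (Ω[R⁄K])), ∀ i, b i = D K R (x i) := by
  obtain ⟨ι, σ, _, _, ⟨P⟩⟩ := Algebra.IsStandardSmooth.out (R := K) (S := R)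
  exact ⟨((Set.range P.map)ᶜ : Set ι), Fintype.ofFinite _, fun k => P.val k, P.basisKaehler,
    fun k => P.basisKaehler_apply k⟩

/-- Coordinates remain coordinates on formally étale extensions. -/
theorem exists_isCoordinates_of_formallyEtale {K R S : Type u} [CommRing K] [CommRing R]
    [CommRing S] [Algebra K R] [Algebra K S] [Algebra R S] [IsScalarTower K R S]
    [Algebra.FormallyEtale R S] {ι : Type} [DecidableEq ι] {x : ι → R}
    (b : Module.Basis ι R (Ω[R⁄K])) (hb : ∀ i, b i = D K R (x i)) :
    ∃ δ : ι → Derivation K S S, IsCoordinates (fun i => algebraMap R S (x i)) δ := by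
  let c : Module.Basis ι S (Ω[S⁄K]) :=
    (Algebra.TensorProduct.basis S b).map (tensorKaehlerEquivOfFormallyEtale K R S)
  have hc : ∀ i, c i = D K S (algebraMap R S (x i)) := by
    intro i
    simp only [c, Module.Basis.map_apply, Algebra.TensorProduct.basis_apply, hb,
      tensorKaehlerEquivOfFormallyEtale_apply, mapBaseChange_tmul, one_smul, map_D]
  -- The derivations are the coordinate functionals of the base-changed basis, composed with the
  -- universal derivation.
  refine ⟨fun i => (c.coord i).compDer (D K S), ?_, fun i j => ?_⟩
  · rw [← c.span_eq]
    exact congrArg _ (congrArg _ (funext fun i => (hc i).symm))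
  · change c.coord i (D K S (algebraMap R S (x j))) = _
    rw [← hc, Module.Basis.coord_apply, Module.Basis.repr_self, Finsupp.single_apply]
    simp only [eq_comm]

end Coordinates

section Charts

open AlgebraicGeometry CategoryTheory Opposite

variable {K : Type u} [Field K] {X : Scheme.{u}} (f : X ⟶ Spec (CommRingCat.of K))

/-- The restriction map is the map on affine opens induced by the identity of X, which is étale. -/
theorem secRes_etale {V W : X.Opens} (hV : IsAffineOpen V) (hW : IsAffineOpen W) (h : W ≤ V) :
    (secRes h).Etale := by
  have e : (𝟙 X : X ⟶ X).appLE V W h = X.presheaf.map (homOfLE h).op := by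
    simp only [Scheme.Hom.appLE, Scheme.Hom.id_app]
    exact Category.id_comp _
  have := (𝟙 X : X ⟶ X).etale_appLE hV hW h
  rwa [e] at this

theorem secRes_secMap {V W : X.Opens} (h : W ≤ V) (c : K) :
    secRes h (secMap f V c) = secMap f W c := by
  have : (homOfLE (le_top : W ≤ ⊤)).op = (homOfLE (le_top : V ≤ ⊤)).op ≫ (homOfLE h).op := rfl
  simp [secRes, secMap, this]

/-- Spec K is a single point, so an open set containing the image of x is everything, and what
remains is the isomorphism of K with the global sections of Spec K. -/
theorem secMap_isStandardSmooth {U : (Spec (CommRingCat.of K)).Opens} {V : X.Opens}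
    (e : V ≤ f ⁻¹ᵁ U) {x : X} (hx : x ∈ V) (h : (f.appLE U V e).hom.IsStandardSmooth) :
    (secMap f V).IsStandardSmooth := by
  have hU : U = ⊤ := by
    have : Subsingleton (Spec (CommRingCat.of K)) :=
      inferInstanceAs (Subsingleton (PrimeSpectrum K))
    rw [eq_top_iff]
    intro y _
    rw [Subsingleton.elim y (f x)]
    exact e hx
  subst hU
  have h1 := RingHom.isStandardSmooth_respectsIso.2 (f.appLE ⊤ V e).hom
    (Scheme.ΓSpecIso (CommRingCat.of K)).symm.commRingCatIsoToRingEquiv h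
  exact h1

/-- The functions t are chosen once on V and serve every affine W inside V, because W → V is étale;
only the dual derivations depend on W. -/
theorem exists_coordinates [Smooth f] (x : X) : ∃ V : X.affineOpens, x ∈ V.1 ∧
    ∃ (ι : Type) (_ : Fintype ι) (_ : DecidableEq ι) (t : ι → Γ(X, V.1)),
      ∀ (W : X.Opens) (_ : IsAffineOpen W) (h : W ≤ V.1),
        ∃ δ : ι → Derivation K (Sec f W) (Sec f W),
          IsCoordinates (fun i => toSec f h (t i)) δ := by
  classical
  obtain ⟨U, _, V, hV, hx, e, hs⟩ := Smooth.exists_isStandardSmooth f x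
  have h1 : Algebra.IsStandardSmooth K (Sec f V) := secMap_isStandardSmooth f e hx hs
  obtain ⟨ι, hι, t, b, hb⟩ := exists_kaehlerDifferential_basis K (Sec f V)
  refine ⟨⟨V, hV⟩, hx, ι, hι, inferInstance, t, fun W hW h => ?_⟩
  let _ : Algebra (Sec f V) (Sec f W) := (sRes f h).toAlgebra
  have : IsScalarTower K (Sec f V) (Sec f W) :=
    IsScalarTower.of_algebraMap_eq fun c => (secRes_secMap f h c).symm
  have : Algebra.Etale (Sec f V) (Sec f W) := secRes_etale hV hW h
  exact exists_isCoordinates_of_formallyEtale b hb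

end Charts

end DPoly

/-! ### The coboundary of a differential operator is locally a sum of brackets. -/

namespace DPoly

section Ring

variable {K R : Type u} [CommRing K] [CommRing R] [Algebra K R]

theorem IsPolyDiffOp.derivation_comp {n : ℕ} {F : MultilinearMap K (fun _ : Fin n => R) R}
    (δ : Derivation K R R) (hF : IsPolyDiffOp F) :
    IsPolyDiffOp (δ.toLinearMap.compMultilinearMap F) := by
  obtain ⟨N, hN⟩ := hF
  exact ⟨N + 1, fun a i => isDiffOp_congr
    (IsDiffOpLT.derivation_comp (n := N + 1) δ (hN a i)) fun _ => rfl⟩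

theorem hochD_one_apply (F : MultilinearMap K (fun _ : Fin 1 => R) R) (a : Fin 2 → R) :
    hochD F a = a 0 * F (fun _ => a 1) - F (fun _ => a 0 * a 1) + F (fun _ => a 0) * a 1 := by
  have h : (Fin.contractNth (0 : Fin 1).castSucc (· * ·) a) = fun _ => a 0 * a 1 := by
    ext k
    obtain rfl : k = 0 := Subsingleton.elim _ _
    simp [Fin.contractNth]
  rw [hochD_apply, Fin.sum_univ_one, h,
    show (fun i : Fin 1 => a i.succ) = fun _ => a 1 from
      funext fun i => by rw [Subsingleton.elim i 0]; rfl,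
    show (fun i : Fin 1 => a i.castSucc) = fun _ => a 0 from
      funext fun i => by rw [Subsingleton.elim i 0]; rfl]
  simp
  ring

end Ring

section Sheaf

open AlgebraicGeometry CategoryTheory Opposite

variable {K : Type u} [Field K] {X : Scheme.{u}} {f : X ⟶ Spec (CommRingCat.of K)}
  {U : X.Opens}

theorem PD.cast_apply {m n : ℕ} (h : m = n) (F : PD f U m) (V : AffIn U)
    (a : Fin n → Sec f V.1.1) : (h ▸ F : PD f U n).1 V a = F.1 V fun i => a (Fin.cast h i) := by
  subst h; rfl

/-- In degree one the sign is (-1)^{1·1}, so the bracket is the anticommutator. -/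
theorem PD.bracket_one_apply (F G : PD f U 1) (V : AffIn U) (a : Fin 2 → Sec f V.1.1) :
    (F.bracket G).1 V a = F.1 V (fun _ => a 0) * G.1 V (fun _ => a 1) +
      G.1 V (fun _ => a 0) * F.1 V (fun _ => a 1) := by
  have e : F.bracket G = F.mul G + G.mul F := by
    rw [PD.bracket]
    simp
  have h0 : ∀ H : PD f U 1, H.1 V (fun i => a (Fin.castAdd 1 i)) = H.1 V fun _ => a 0 := fun H =>
    congrArg _ (funext fun i => by rw [Subsingleton.elim i 0]; rfl)
  have h1 : ∀ H : PD f U 1, H.1 V (fun i => a (Fin.natAdd 1 i)) = H.1 V fun _ => a 1 := fun H =>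
    congrArg _ (funext fun i => by rw [Subsingleton.elim i 0]; rfl)
  rw [e, PD.add_apply, PD.mul_apply, PD.mul_apply, h0, h0, h1, h1]

theorem PD.d_one_apply (F : PD f U 1) (V : AffIn U) (a : Fin 2 → Sec f V.1.1) :
    (PD.d 1 F).1 V a = a 0 * F.1 V (fun _ => a 1) - F.1 V (fun _ => a 0 * a 1) +
      F.1 V (fun _ => a 0) * a 1 := hochD_one_apply _ _

variable (f U) in
/-- A vector field on `U`: a compatible family of derivations. -/
structure VectorField where
  /-- the derivation of `Γ(X, V)` -/
  der (V : AffIn U) : Derivation K (Sec f V.1.1) (Sec f V.1.1)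
  res_der : ∀ (V W : AffIn U) (h : W.1.1 ≤ V.1.1) (a : Sec f V.1.1),
    sRes f h (der V a) = der W (sRes f h a)

/-- The composition of a polydifferential operator with a vector field. -/
noncomputable def VectorField.comp (v : VectorField f U) (n : ℕ) : PD f U n →+ PD f U n where
  toFun F := ⟨fun V => (v.der V).toLinearMap.compMultilinearMap (F.1 V),
    fun V => (F.2.1 V).derivation_comp _,
    fun V W h _ => (v.res_der V W h _).trans (congrArg _ (F.2.2 V W h _))⟩
  map_zero' := PD.ext fun V _ => map_zero (v.der V)
  map_add' F G := PD.ext fun V a => map_add (v.der V) (F.1 V a) (G.1 V a)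

theorem VectorField.comp_apply (v : VectorField f U) {n : ℕ} (F : PD f U n) (V : AffIn U)
    (a : Fin n → Sec f V.1.1) : (v.comp n F).1 V a = v.der V (F.1 V a) := rfl

/-- The identity, as a differential operator. -/
noncomputable def PD.idOp : PD f U 1 :=
  ⟨fun _ => MultilinearMap.ofSubsingleton K _ _ 0 LinearMap.id,
    fun _ => ⟨0, fun a i => isDiffOp_congr (isDiffOp_mulLeft 0 1) fun x => by
      obtain rfl : i = 0 := Subsingleton.elim _ _
      simp⟩, fun _ _ _ _ => rfl⟩

theorem PD.idOp_apply (V : AffIn U) (a : Fin 1 → Sec f V.1.1) :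
    (PD.idOp : PD f U 1).1 V a = a 0 := rfl

variable (f U) in
/-- The sums of brackets of differential operators. -/
noncomputable def bracketSums : AddSubgroup (PD f U 2) :=
  AddSubgroup.closure {H | ∃ F G : PD f U 1, F.bracket G = H}

theorem bracket_mem_bracketSums (F G : PD f U 1) : (F.bracket G : PD f U 2) ∈ bracketSums f U :=
  AddSubgroup.subset_closure ⟨F, G, rfl⟩

theorem smul_mem_bracketSums (r : Γ(X, U)) {H : PD f U 2} (h : H ∈ bracketSums f U) :
    r • H ∈ bracketSums f U := by
  induction h using AddSubgroup.closure_induction with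
  | mem H hH =>
    obtain ⟨F, G, rfl⟩ := hH
    have e : r • (F.bracket G : PD f U 2) = (r • F).bracket G := PD.ext fun V a => by
      rw [PD.smul_apply, PD.bracket_one_apply, PD.bracket_one_apply, PD.smul_apply, PD.smul_apply]
      ring
    rw [e]
    exact bracket_mem_bracketSums _ _
  | zero => rw [smul_zero]; exact zero_mem _
  | add F G _ _ hF hG => rw [smul_add]; exact add_mem hF hG
  | neg F _ hF => rw [smul_neg]; exact neg_mem hF

/-- The values of [F, G] are sums of products of values of F and G, so the Leibniz rule gives v ∘
[F, G] = [v ∘ F, G] + [F, v ∘ G]. -/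
theorem VectorField.comp_mem_bracketSums (v : VectorField f U) {H : PD f U 2}
    (h : H ∈ bracketSums f U) : v.comp 2 H ∈ bracketSums f U := by
  induction h using AddSubgroup.closure_induction with
  | mem H hH =>
    obtain ⟨F, G, rfl⟩ := hH
    have e : v.comp 2 (F.bracket G : PD f U 2) =
        ((v.comp 1 F).bracket G + F.bracket (v.comp 1 G) : PD f U 2) := PD.ext fun V a => by
      rw [VectorField.comp_apply, PD.add_apply, PD.bracket_one_apply, PD.bracket_one_apply,
        PD.bracket_one_apply]
      simp only [VectorField.comp_apply, map_add, Derivation.leibniz, smul_eq_mul]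
      ring
    rw [e]
    exact add_mem (bracket_mem_bracketSums _ _) (bracket_mem_bracketSums _ _)
  | zero => rw [map_zero]; exact zero_mem _
  | add F G _ _ hF hG => rw [map_add]; exact add_mem hF hG
  | neg F _ hF => rw [map_neg]; exact neg_mem hF

/-- Composition with v fails to commute with the coboundary only in the two outer terms, where v
also differentiates the factors a_0 and a_1. The excess v(a_0) F(a_1) + F(a_0) v(a_1) is the bracket
of v, viewed as an operator, with F. -/
theorem VectorField.d_comp (v : VectorField f U) (F : PD f U 1) :
    PD.d 1 (v.comp 1 F) =
      (v.comp 2 (PD.d 1 F) - (v.comp 1 PD.idOp).bracket F : PD f U 2) := PD.ext fun V a => by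
  have e : ∀ G H : PD f U 2, (G - H).1 V a = G.1 V a - H.1 V a := fun _ _ => rfl
  rw [e, PD.d_one_apply, PD.bracket_one_apply]
  simp only [VectorField.comp_apply, PD.d_one_apply, PD.idOp_apply, map_add, map_sub,
    Derivation.leibniz, smul_eq_mul]
  ring

theorem toSec_secMap {V : X.Opens} (h : V ≤ U) (c : K) :
    toSec f h (secMap f U c) = algebraMap K (Sec f V) c := secRes_secMap f h c

/-- d(id) = ½ [id, id], since d(id) takes the value a_0 a_1 and [id, id] the value 2 a_0 a_1. -/
theorem d_idOp_mem_bracketSums [CharZero K] :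
    (PD.d 1 PD.idOp : PD f U 2) ∈ bracketSums f U := by
  have h1 := smul_mem_bracketSums (secMap f U 2⁻¹)
    (bracket_mem_bracketSums (PD.idOp (f := f) (U := U)) PD.idOp)
  convert h1 using 1
  refine PD.ext fun V a => ?_
  rw [PD.d_one_apply, PD.smul_apply, PD.bracket_one_apply]
  simp only [PD.idOp_apply]
  have h2 : toSec f V.2 (secMap f U 2⁻¹) * 2 = 1 := by
    rw [toSec_secMap, ← map_ofNat (algebraMap K (Sec f V.1.1)) 2, ← map_mul, inv_mul_cancel₀ two_ne_zero, map_one]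
  linear_combination (-(a 0 * a 1)) * h2

/-- A differential operator on `V`, as a linear map. -/
noncomputable def PD.lin (F : PD f U 1) (V : AffIn U) : Sec f V.1.1 →ₗ[K] Sec f V.1.1 where
  toFun x := F.1 V fun _ => x
  map_add' x y := by
    have h : ∀ z, (fun _ : Fin 1 => z) = Function.update (0 : Fin 1 → Sec f V.1.1) 0 z := fun z =>
      funext fun i => by rw [Subsingleton.elim i 0, Function.update_self]
    rw [h, h, h, MultilinearMap.map_update_add]
  map_smul' c x := by
    have h : ∀ z, (fun _ : Fin 1 => z) = Function.update (0 : Fin 1 → Sec f V.1.1) 0 z := fun z =>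
      funext fun i => by rw [Subsingleton.elim i 0, Function.update_self]
    rw [h, h, MultilinearMap.map_update_smul, RingHom.id_apply]

theorem PD.isDiffOpLT_lin (F : PD f U 1) (V : AffIn U) : ∃ N, IsDiffOpLT N (F.lin V) := by
  obtain ⟨N, hN⟩ := F.2.1 V
  refine ⟨N + 1, isDiffOp_congr (hN 0 0) fun x => congrArg _ (funext fun i => ?_)⟩
  rw [Subsingleton.elim i 0, Function.update_self]

theorem PD.ext_lin {F G : PD f U 1} (h : ∀ V, F.lin V = G.lin V) : F = G := PD.ext fun V a => by
  rw [show a = fun _ => a 0 from funext fun i => by rw [Subsingleton.elim i 0]]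
  exact LinearMap.congr_fun (h V) (a 0)

section Chart

variable {ι : Type} [DecidableEq ι] {hU : IsAffineOpen U} {t : ι → Γ(X, U)}
  {δ : ∀ V : AffIn U, ι → Derivation K (Sec f V.1.1) (Sec f V.1.1)}

/-- Restricting after ∂_i on V, and applying ∂_i on W after restricting, are two derivations from
functions on V to functions on W that agree on the coordinates. -/
theorem IsCoordinates.res_apply
    (h : ∀ V : AffIn U, IsCoordinates (fun i => toSec f V.2 (t i)) (δ V))
    (V W : AffIn U) (e : W.1.1 ≤ V.1.1) (i : ι) (a : Sec f V.1.1) :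
    sRes f e (δ V i a) = δ W i (sRes f e a) := by
  let _ : Algebra (Sec f V.1.1) (Sec f W.1.1) := (sRes f e).toAlgebra
  have : IsScalarTower K (Sec f V.1.1) (Sec f W.1.1) :=
    IsScalarTower.of_algebraMap_eq fun c => (secRes_secMap f e c).symm
  let d1 : Derivation K (Sec f V.1.1) (Sec f W.1.1) :=
    (δ W i).compAlgebraMap (Sec f V.1.1)
  let d2 : Derivation K (Sec f V.1.1) (Sec f W.1.1) :=
    (Algebra.linearMap (Sec f V.1.1) (Sec f W.1.1)).compDer (δ V i)
  have h0 : d2 - d1 = 0 := by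
    refine derivation_eq_zero_of_span (h V).span_D _ fun j => ?_
    change sRes f e (δ V i (toSec f V.2 (t j))) - δ W i (sRes f e (toSec f V.2 (t j))) = 0
    rw [sRes_toSec, (h V).apply_eq, (h W).apply_eq]
    split_ifs <;> simp
  exact sub_eq_zero.1 (DFunLike.congr_fun h0 a)

/-- The coordinate vector fields. -/
noncomputable def coordinateField
    (h : ∀ V : AffIn U, IsCoordinates (fun i => toSec f V.2 (t i)) (δ V)) (i : ι) :
    VectorField f U where
  der V := δ V i
  res_der V W e a := IsCoordinates.res_apply h V W e i a

/-- Compositions of coordinate vector fields. -/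
noncomputable def fieldWord
    (h : ∀ V : AffIn U, IsCoordinates (fun i => toSec f V.2 (t i)) (δ V)) (l : List ι) :
    PD f U 1 :=
  l.foldr (fun i F => (coordinateField h i).comp 1 F) PD.idOp

theorem fieldWord_lin
    (h : ∀ V : AffIn U, IsCoordinates (fun i => toSec f V.2 (t i)) (δ V)) (l : List ι)
    (V : AffIn U) : (fieldWord h l).lin V = derivationWord (δ V) l := by
  induction l with
  | nil => rfl
  | cons i l ih => exact congrArg ((δ V i).toLinearMap ∘ₗ ·) ih

theorem d_fieldWord_mem_bracketSums [CharZero K]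
    (h : ∀ V : AffIn U, IsCoordinates (fun i => toSec f V.2 (t i)) (δ V)) (l : List ι) :
    (PD.d 1 (fieldWord h l) : PD f U 2) ∈ bracketSums f U := by
  induction l with
  | nil => exact d_idOp_mem_bracketSums
  | cons i l ih =>
    change PD.d 1 ((coordinateField h i).comp 1 (fieldWord h l)) ∈ bracketSums f U
    rw [VectorField.d_comp]
    exact sub_mem (VectorField.comp_mem_bracketSums _ ih) (bracket_mem_bracketSums _ _)

/-- On a chart, the coboundary of a differential operator is a sum of brackets. -/
theorem d_mem_bracketSums [CharZero K] [Fintype ι] (hU : IsAffineOpen U)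
    (h : ∀ V : AffIn U, IsCoordinates (fun i => toSec f V.2 (t i)) (δ V)) (D : PD f U 1) :
    (PD.d 1 D : PD f U 2) ∈ bracketSums f U := by
  let T : AffIn U := ⟨⟨U, hU⟩, le_rfl⟩
  -- The words in the ∂_i and their coefficients are defined on all of U, so an operator on the ring
  -- of the chart U itself extends to a compatible family on all smaller affine open sets.
  have key : ∀ E ∈ Submodule.span (Sec f U) (Set.range (derivationWord (δ T))),
      ∃ F ∈ Submodule.span Γ(X, U) (Set.range (fieldWord h)), F.lin T = E := by
    intro E hE
    induction hE using Submodule.span_induction with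
    | mem E hE =>
      obtain ⟨l, rfl⟩ := hE
      exact ⟨_, Submodule.subset_span ⟨l, rfl⟩, fieldWord_lin h l T⟩
    | zero => exact ⟨0, zero_mem _, rfl⟩
    | add E E' _ _ hE hE' =>
      obtain ⟨F, hF, rfl⟩ := hE
      obtain ⟨F', hF', rfl⟩ := hE'
      exact ⟨F + F', add_mem hF hF', rfl⟩
    | smul c E _ hE =>
      obtain ⟨F, hF, rfl⟩ := hE
      refine ⟨(show Γ(X, U) from c) • F, Submodule.smul_mem _ _ hF, LinearMap.ext fun x => ?_⟩
      refine (PD.smul_apply _ F T _).trans ?_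
      exact congrArg (· * F.1 T fun _ => x) (secRes_self U c)
  obtain ⟨N, hN⟩ := D.isDiffOpLT_lin T
  obtain ⟨F, hF, hFD⟩ := key _ ((h T).mem_span_derivationWord hN)
  -- D and F agree on U by construction. On a smaller V their difference kills the functions
  -- restricted from U, among them the coordinates, so it vanishes.
  have e : D = F := by
    refine PD.ext_lin fun V => ?_
    obtain ⟨N, hN⟩ := (D - F).isDiffOpLT_lin V
    have h0 : (D - F).lin V = 0 := by
      refine (h V).eq_zero_of_forall hN (sRes f V.2).range
        (fun i => ⟨t i, rfl⟩) ?_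
      rintro _ ⟨a, rfl⟩
      refine ((D - F).2.2 T V V.2 fun _ => a).symm.trans ?_
      have : (D - F).1 T (fun _ => a) = 0 :=
        sub_eq_zero.2 (LinearMap.congr_fun hFD a).symm
      rw [this, map_zero]
    exact sub_eq_zero.1 h0
  rw [e]
  clear e hFD
  induction hF using Submodule.span_induction with
  | mem E hE =>
    obtain ⟨l, rfl⟩ := hE
    exact d_fieldWord_mem_bracketSums h l
  | zero => rw [map_zero]; exact zero_mem _
  | add E E' _ _ hE hE' => rw [map_add]; exact add_mem hE hE'
  | smul c E _ hE => rw [map_smul]; exact smul_mem_bracketSums c hE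

end Chart

theorem lieGen_of_mem_bracketSums {H : PD f U 2} (h : H ∈ bracketSums f U) : LieGen U 2 H := by
  induction h using AddSubgroup.closure_induction with
  | mem H hH =>
    obtain ⟨F, G, rfl⟩ := hH
    exact .bracket (.of F) (.of G)
  | zero => exact .zero 2
  | add F G _ _ hF hG => exact .add hF hG
  | neg F _ hF => rw [← neg_one_smul Γ(X, U)]; exact .smul _ hF

/-- Membership in L is local, so around each point one may pass to an affine neighbourhood inside
both U and a coordinate chart. -/
theorem d_mem_freeLie_of_degree_one [CharZero K] [Smooth f] (D : PD f U 1) :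
    PD.d 1 D ∈ freeLie f U 2 := by
  intro x hx
  obtain ⟨V, hxV, ι, _, _, t, ht⟩ := exists_coordinates f x
  obtain ⟨W, hW, hxW, hWU⟩ :=
    X.isBasis_affineOpens.exists_subset_of_mem_open (a := x) (u := ((V.1 ⊓ U : X.Opens) : Set X))
      ⟨hxV, hx⟩ (V.1 ⊓ U).2
  obtain ⟨W, hW, rfl⟩ := hW
  have hWU' : W ≤ U := fun y hy => (hWU hy).2
  have hWV : W ≤ V.1 := fun y hy => (hWU hy).1
  choose δ hδ using ht
  refine ⟨W, hWU', hxW, ?_⟩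
  rw [PD.res_d]
  refine lieGen_of_mem_bracketSums (d_mem_bracketSums (t := fun i => secRes hWV (t i))
    (δ := fun Z => δ Z.1.1 Z.1.2 (Z.2.trans hWV)) hW (fun Z => ?_) _)
  simp only [toSec_secRes]
  exact hδ _ _ _

end Sheaf

end DPoly

/-! ### The graded Leibniz rule, and stability of the free Lie algebra under the coboundary. -/

namespace DPoly

section Ring

variable {K R : Type u} [CommRing K] [CommRing R] [Algebra K R]

/-- The k + l contractions split into those of neighbours among the first k + 1 entries, seen only
by F, and those among the last l + 1, seen only by G. The last term of dF times G and the first term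
of F times dG both insert the middle entry a_k, with opposite signs, and cancel. -/
theorem hochD_cochainMul {k l : ℕ} (F : MultilinearMap K (fun _ : Fin k => R) R)
    (G : MultilinearMap K (fun _ : Fin l => R) R) (a : Fin (k + l + 1) → R) :
    hochD (cochainMul F G) a =
      cochainMul (hochD F) G (fun i => a (Fin.cast (Nat.add_right_comm k 1 l) i)) +
        (-1) ^ k * cochainMul F (hochD G) a := by
  have e : ∀ {p q : ℕ} (F : MultilinearMap K (fun _ : Fin p => R) R)
      (G : MultilinearMap K (fun _ : Fin q => R) R) (a : Fin (p + q) → R),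
      cochainMul F G a = F (fun i => a (Fin.castAdd q i)) * G (fun j => a (Fin.natAdd p j)) :=
    fun _ _ _ => rfl
  rw [e (hochD F) G, e F (hochD G), hochD_apply, hochD_apply, hochD_apply, Fin.sum_univ_add]
  have h1 : ∀ j : Fin k, cochainMul F G
      (Fin.contractNth (Fin.castAdd l j).castSucc (· * ·) a) =
      F (Fin.contractNth j.castSucc (· * ·)
        (fun i => a (Fin.cast (Nat.add_right_comm k 1 l) (Fin.castAdd l i)))) *
      G (fun i => a (Fin.cast (Nat.add_right_comm k 1 l) (Fin.natAdd (k + 1) i))) := by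
    intro j
    have hj := j.2
    rw [e]
    refine congrArg₂ _ (congrArg _ (funext fun i => ?_)) (congrArg _ (funext fun i => ?_))
    · simp only [Fin.contractNth]
      rfl
    · simp only [Fin.contractNth, Fin.val_natAdd, Fin.val_castSucc, Fin.val_castAdd]
      rw [if_neg (by omega), if_neg (by omega)]
      refine congrArg a (Fin.ext ?_)
      simp; omega
  have h2 : ∀ j : Fin l, cochainMul F G
      (Fin.contractNth (Fin.natAdd k j).castSucc (· * ·) a) =
      F (fun i => a (Fin.castAdd (l + 1) i)) *
      G (Fin.contractNth j.castSucc (· * ·) (fun i => a (Fin.natAdd k i))) := by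
    intro j
    rw [e]
    refine congrArg₂ _ (congrArg _ (funext fun i => ?_)) (congrArg _ (funext fun i => ?_))
    · have hi := i.2
      simp only [Fin.contractNth, Fin.val_natAdd, Fin.val_castSucc, Fin.val_castAdd]
      rw [if_pos (by omega)]
      rfl
    · simp only [Fin.contractNth, Fin.val_natAdd, Fin.val_castSucc, add_lt_add_iff_left,
        add_right_inj]
      rfl
  have h3 : cochainMul F G (fun i => a i.succ) =
      F (fun i => a (Fin.cast (Nat.add_right_comm k 1 l) (Fin.castAdd l i.succ))) *
      G (fun i => a (Fin.cast (Nat.add_right_comm k 1 l) (Fin.natAdd (k + 1) i))) := by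
    rw [e]
    refine congrArg₂ _ (congrArg _ (funext fun i => congrArg a (Fin.ext ?_)))
      (congrArg _ (funext fun i => congrArg a (Fin.ext ?_))) <;> (simp; try omega)
  have h4 : cochainMul F G (fun i => a i.castSucc) =
      F (fun i => a (Fin.castAdd (l + 1) i)) *
      G (fun i => a (Fin.natAdd k i.castSucc)) := rfl
  have h5 : (fun i : Fin k => a (Fin.cast (Nat.add_right_comm k 1 l)
      (Fin.castAdd l i.castSucc))) = fun i => a (Fin.castAdd (l + 1) i) := rfl
  have h6 : (fun i : Fin l => a (Fin.cast (Nat.add_right_comm k 1 l)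
      (Fin.natAdd (k + 1) i))) = fun i : Fin l => a (Fin.natAdd k i.succ) :=
    funext fun i => congrArg a (Fin.ext (by simp; omega))
  have h7 : Fin.cast (Nat.add_right_comm k 1 l) (Fin.castAdd l (Fin.last k)) =
      Fin.natAdd k (0 : Fin (l + 1)) := Fin.ext (by simp)
  have h8 : Fin.cast (Nat.add_right_comm k 1 l) (Fin.castAdd l (0 : Fin (k + 1))) =
      (0 : Fin (k + l + 1)) := Fin.ext (by simp)
  have h9 : Fin.natAdd k (Fin.last l) = Fin.last (k + l) := Fin.ext (by simp)
  simp only [h1, h2, h3, h4, h5, h6, h7, h8, h9, add_mul, mul_add, Finset.sum_mul, Finset.mul_sum,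
    Fin.val_castAdd, Fin.val_natAdd]
  have s1 : ∀ x y z : R, x * (y * z) = x * y * z := fun x y z => (mul_assoc x y z).symm
  have s2 : ∀ (j : ℕ) (A B : R), (-1) ^ (k + j + 1) * (A * B) =
      (-1) ^ k * (A * ((-1) ^ (j + 1) * B)) := by
    intro j A B; ring
  simp only [s2]
  simp only [pow_succ]
  ring_nf

end Ring

section Sheaf

open AlgebraicGeometry CategoryTheory Opposite

variable {K : Type u} [Field K] {X : Scheme.{u}} {f : X ⟶ Spec (CommRingCat.of K)}
  {U : X.Opens}

theorem pdOf_cast {m n : ℕ} (h : m = n) (F : PD f U m) : pdOf (h ▸ F : PD f U n) = pdOf F := by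
  subst h; rfl

theorem pdOf_injective (n : ℕ) : Function.Injective (pdOf : PD f U n → _) :=
  DirectSum.of_injective n

theorem pdOf_add {n : ℕ} (F G : PD f U n) : pdOf (F + G) = pdOf F + pdOf G :=
  map_add (DirectSum.of (PD f U) n) F G

theorem pdOf_sub {n : ℕ} (F G : PD f U n) : pdOf (F - G) = pdOf F - pdOf G :=
  map_sub (DirectSum.of (PD f U) n) F G

theorem pdOf_zsmul {n : ℕ} (c : ℤ) (F : PD f U n) : pdOf (c • F) = c • pdOf F :=
  map_zsmul (DirectSum.of (PD f U) n) c F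

theorem pdOf_mul {k l : ℕ} (F : PD f U k) (G : PD f U l) : pdOf (F.mul G) = pdOf F * pdOf G :=
  (DirectSum.of_mul_of F G).symm

/-- In the direct sum the transport along l + k = k + l disappears. Graded identities are therefore
verified there by ring algebra and brought back by `pdOf_injective`. -/
theorem pdOf_bracket {k l : ℕ} (F : PD f U k) (G : PD f U l) :
    pdOf (F.bracket G) = pdOf F * pdOf G - (-1 : ℤ) ^ (k * l) • (pdOf G * pdOf F) := by
  rw [PD.bracket, pdOf_sub, pdOf_zsmul, pdOf_cast, pdOf_mul, pdOf_mul]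

theorem PD.d_mul {k l : ℕ} (F : PD f U k) (G : PD f U l) :
    PD.d (k + l) (F.mul G) = (Nat.add_right_comm k 1 l ▸ (PD.d k F).mul G) +
      (-1 : ℤ) ^ k • (F.mul (PD.d l G) : PD f U (k + l + 1)) := PD.ext fun V a => by
  rw [PD.add_apply, PD.cast_apply]
  refine (hochD_cochainMul (F.1 V) (G.1 V) a).trans (congrArg _ ?_)
  have e : ∀ (c : ℤ) (H : PD f U (k + l + 1)), (c • H).1 V a = (c : Sec f V.1.1) * H.1 V a :=
    fun c H => zsmul_eq_mul _ _
  rw [e]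
  push_cast
  rfl

theorem pdOf_d_mul {k l : ℕ} (F : PD f U k) (G : PD f U l) :
    pdOf (PD.d (k + l) (F.mul G)) = pdOf (PD.d k F) * pdOf G +
      (-1 : ℤ) ^ k • (pdOf F * pdOf (PD.d l G)) := by
  rw [PD.d_mul, pdOf_add, pdOf_cast, pdOf_zsmul, pdOf_mul]
  exact congrArg _ (congrArg _ (pdOf_mul _ _))

theorem pdOf_d_cast {m n : ℕ} (h : m = n) (F : PD f U m) :
    pdOf (PD.d n (h ▸ F : PD f U n)) = pdOf (PD.d m F) := by
  subst h; rfl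

theorem pdOf_d_bracket {k l : ℕ} (F : PD f U k) (G : PD f U l) :
    pdOf (PD.d (k + l) (F.bracket G)) = pdOf ((PD.d k F).bracket G) +
      (-1 : ℤ) ^ k • pdOf (F.bracket (PD.d l G)) := by
  rw [PD.bracket, map_sub, map_zsmul, pdOf_sub, pdOf_zsmul, pdOf_d_cast, pdOf_d_mul, pdOf_d_mul,
    pdOf_bracket, pdOf_bracket]
  simp only [smul_add, smul_sub, smul_smul]
  have h1 : (-1 : ℤ) ^ (k * l) * (-1) ^ l = (-1) ^ ((k + 1) * l) := by
    rw [← pow_add]; congr 1; ring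
  have h2 : (-1 : ℤ) ^ k * (-1) ^ (k * (l + 1)) = (-1) ^ (k * l) := by
    rw [← pow_add, show k + k * (l + 1) = k * l + 2 * k by ring, pow_add, pow_mul (-1 : ℤ) 2 k]
    simp
  rw [h1, h2]
  abel

theorem PD.d_bracket {k l : ℕ} (F : PD f U k) (G : PD f U l) :
    PD.d (k + l) (F.bracket G) = (Nat.add_right_comm k 1 l ▸ (PD.d k F).bracket G) +
      (-1 : ℤ) ^ k • (F.bracket (PD.d l G) : PD f U (k + l + 1)) := by
  refine pdOf_injective _ ?_
  rw [pdOf_d_bracket, pdOf_add, pdOf_cast, pdOf_zsmul]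

theorem cast_mem_freeLie {m n : ℕ} (h : m = n) {F : PD f U m} (hF : F ∈ freeLie f U m) :
    (h ▸ F : PD f U n) ∈ freeLie f U n := by
  subst h; exact hF

theorem LieGen.mem_freeLie {n : ℕ} {F : PD f U n} (hF : LieGen U n F) : F ∈ freeLie f U n :=
  fun _ hx => ⟨U, le_rfl, hx, hF.res le_rfl⟩

/-- The conclusion is membership in the sheaf rather than `LieGen`: the coboundary of a generator is
a sum of brackets only after restriction to charts. -/
theorem LieGen.d_mem_freeLie [CharZero K] [Smooth f] {n : ℕ} {F : PD f U n} (hF : LieGen U n F) :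
    PD.d n F ∈ freeLie f U (n + 1) := by
  induction hF with
  | of D => exact d_mem_freeLie_of_degree_one D
  | zero n => rw [map_zero]; exact zero_mem _
  | add _ _ h1 h2 => rw [map_add]; exact add_mem h1 h2
  | smul r _ h1 => rw [map_smul]; exact Submodule.smul_mem _ r h1
  | bracket hF hG h1 h2 =>
    rw [PD.d_bracket]
    exact add_mem (cast_mem_freeLie _ (freeLie_bracket h1 hG.mem_freeLie))
      (zsmul_mem (freeLie_bracket hF.mem_freeLie h2) _)

/-- The Hochschild coboundary preserves the free Lie algebra. -/
theorem preservesFreeLie [CharZero K] [Smooth f] : PreservesFreeLie f := by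
  intro U n F hF x hx
  obtain ⟨V, hV, hxV, h1⟩ := hF x hx
  obtain ⟨W, hW, hxW, h2⟩ := h1.d_mem_freeLie x hxV
  exact ⟨W, hW.trans hV, hxW, h2⟩

end Sheaf

end DPoly

/-! ### Koszul signs, and the coaction on the graded symmetric algebra. -/

namespace DPoly

open scoped TensorProduct

namespace DGModule

section Braiding

variable {R : Type u} [CommRing R] (M N : DGModule R)

variable {M} in
theorem linearMap_ext {P : Type*} [AddCommGroup P] [Module R P] {F G : M →ₗ[R] P}
    (h : ∀ n, ∀ x ∈ M.deg n, F x = G x) : F = G :=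
  LinearMap.ext fun x => M.mem_of_deg (LinearMap.eqLocus F G) h x

/-- Iterates of the sign operator. -/
def sgnPow (p : ℕ) : M →ₗ[R] M := (M.sgn : Module.End R M) ^ p

variable {M N}

theorem sgnPow_zero (x : M) : M.sgnPow 0 x = x := rfl

theorem sgnPow_succ (p : ℕ) (x : M) : M.sgnPow (p + 1) x = M.sgnPow p (M.sgn x) := by
  rw [sgnPow, pow_succ]; rfl

/-- Thus `sgnPow p` is the Koszul sign for moving an element of degree p past x, expressed linearly
in x without fixing the degree of x. -/
theorem sgnPow_of_mem {n : ℕ} {x : M} (hx : x ∈ M.deg n) (p : ℕ) :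
    M.sgnPow p x = (-1 : R) ^ (p * n) • x := by
  induction p with
  | zero => simp [sgnPow_zero]
  | succ p ih =>
    rw [sgnPow_succ, M.sgn_of_mem hx, map_smul, ih, smul_smul, ← pow_add]
    congr 2; ring

theorem sgnPow_of_even {p : ℕ} (hp : Even p) (x : M) : M.sgnPow p x = x := by
  obtain ⟨k, rfl⟩ := hp
  induction k with
  | zero => rfl
  | succ k ih => rw [show k + 1 + (k + 1) = k + k + 1 + 1 by ring, sgnPow_succ, sgnPow_succ, sgn_sgn, ih]

theorem sgnPow_of_odd {p : ℕ} (hp : Odd p) (x : M) : M.sgnPow p x = M.sgn x := by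
  obtain ⟨k, rfl⟩ := hp
  rw [sgnPow_succ, sgnPow_of_even (even_two_mul k)]

theorem sgnPow_d (p : ℕ) (x : M) : M.sgnPow p (M.d x) = (-1 : R) ^ p • M.d (M.sgnPow p x) := by
  induction p generalizing x with
  | zero => simp [sgnPow_zero]
  | succ p ih => rw [sgnPow_succ, sgn_d, map_neg, ih, sgnPow_succ, pow_succ]; simp

theorem sgnPow_sgn (p : ℕ) (x : M) : M.sgnPow p (M.sgn x) = M.sgn (M.sgnPow p x) := by
  rw [← sgnPow_succ, sgnPow, pow_succ']; rfl

theorem sgnPow_mem {n : ℕ} {x : M} (hx : x ∈ M.deg n) (p : ℕ) : M.sgnPow p x ∈ M.deg n := by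
  rw [sgnPow_of_mem hx]; exact Submodule.smul_mem _ _ hx

variable [Algebra ℚ R]

variable (M N) in
/-- The braiding `x ⊗ y ↦ (-1)^{pq} y ⊗ x` for `x`, `y` of degree `p`, `q`. -/
noncomputable def braid : M ⊗[R] N →ₗ[R] N ⊗[R] M :=
  -- With s the sign operator, ½ (1 + s ⊗ 1 + 1 ⊗ s - s ⊗ s) is -1 on odd ⊗ odd and 1 in the other
  -- three parities. This avoids a decomposition into degrees, which a `DGModule` does not provide.
  algebraMap ℚ R 2⁻¹ • ((TensorProduct.comm R M N).toLinearMap ∘ₗ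
    (LinearMap.id + TensorProduct.map M.sgn LinearMap.id + TensorProduct.map LinearMap.id N.sgn -
      TensorProduct.map M.sgn N.sgn))

theorem half_smul_add (x : M) : algebraMap ℚ R 2⁻¹ • (x + x) = x := by
  rw [← two_smul R x, smul_smul, ← map_ofNat (algebraMap ℚ R) 2, ← map_mul,
    inv_mul_cancel₀ two_ne_zero, map_one, one_smul]

theorem braid_tmul (x : M) (y : N) : braid M N (x ⊗ₜ[R] y) =
    algebraMap ℚ R 2⁻¹ • (y ⊗ₜ[R] x + y ⊗ₜ[R] M.sgn x + N.sgn y ⊗ₜ[R] x -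
      N.sgn y ⊗ₜ[R] M.sgn x) := by
  simp [braid]

theorem half_smul_add_tmul (y : N) (x : M) :
    algebraMap ℚ R 2⁻¹ • (y ⊗ₜ[R] x + y ⊗ₜ[R] x) = y ⊗ₜ[R] x :=
  half_smul_add (M := N.tensor M) (y ⊗ₜ[R] x)

theorem braid_of_mem_left {p : ℕ} {x : M} (hx : x ∈ M.deg p) (y : N) :
    braid M N (x ⊗ₜ[R] y) = N.sgnPow p y ⊗ₜ[R] x := by
  rw [braid_tmul, M.sgn_of_mem hx]
  rcases Nat.even_or_odd p with hp | hp
  · rw [sgnPow_of_even hp, hp.neg_one_pow, one_smul, add_sub_cancel_right, half_smul_add_tmul]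
  · rw [sgnPow_of_odd hp, hp.neg_one_pow, neg_one_smul, TensorProduct.tmul_neg,
      TensorProduct.tmul_neg, add_neg_cancel, zero_add, sub_neg_eq_add, half_smul_add_tmul]

theorem braid_of_mem_right {q : ℕ} (x : M) {y : N} (hy : y ∈ N.deg q) :
    braid M N (x ⊗ₜ[R] y) = y ⊗ₜ[R] M.sgnPow q x := by
  rw [braid_tmul, N.sgn_of_mem hy]
  rcases Nat.even_or_odd q with hp | hp
  · rw [sgnPow_of_even hp, hp.neg_one_pow, one_smul, add_right_comm, add_sub_cancel_right,
      half_smul_add_tmul]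
  · rw [sgnPow_of_odd hp, hp.neg_one_pow, neg_one_smul, TensorProduct.neg_tmul,
      TensorProduct.neg_tmul, add_right_comm, add_neg_cancel, zero_add, sub_neg_eq_add,
      half_smul_add_tmul]

theorem braid_of_mem {p q : ℕ} {x : M} {y : N} (hx : x ∈ M.deg p) (hy : y ∈ N.deg q) :
    braid M N (x ⊗ₜ[R] y) = (-1 : R) ^ (p * q) • (y ⊗ₜ[R] x) := by
  rw [braid_of_mem_left hx, sgnPow_of_mem hy, TensorProduct.smul_tmul']

end Braiding

namespace SymAlg

variable {R : Type u} [CommRing R] {L : DGModule R}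

/-- Induction on elements of the symmetric algebra, by homogeneous factors. -/
theorem homogeneous_induction {P : SymAlg L → Prop} (h0 : P 0) (h1 : P 1)
    (hadd : ∀ a b, P a → P b → P (a + b)) (hsmul : ∀ (r : R) a, P a → P (r • a))
    (hmul : ∀ p, ∀ x ∈ L.deg p, ∀ a, P a → P (ι L x * a)) (s : SymAlg L) : P s :=
  mem_of_mul
    { carrier := {s | P s}
      zero_mem' := h0
      add_mem' := fun {a b} ha hb => hadd a b ha hb
      smul_mem' := fun r a ha => hsmul r a ha } h1 hmul s

theorem linearMap_ext {P : Type*} [AddCommGroup P] [Module R P] {F G : SymAlg L →ₗ[R] P}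
    (h1 : F 1 = G 1)
    (h : ∀ p, ∀ x ∈ L.deg p, ∀ s, F s = G s → F (ι L x * s) = G (ι L x * s)) : F = G :=
  LinearMap.ext fun s => mem_of_mul (LinearMap.eqLocus F G) h1 h s

variable (L) in
/-- Iterates of the sign operator of the symmetric algebra. -/
noncomputable def sgnPow (p : ℕ) : SymAlg L →ₗ[R] SymAlg L := DGModule.sgnPow (sym L) p

theorem sgnPow_succ (p : ℕ) (s : SymAlg L) : sgnPow L (p + 1) s = sgnPow L p (sgn L s) :=
  DGModule.sgnPow_succ (M := sym L) p s

theorem sgnPow_one (p : ℕ) : sgnPow L p 1 = 1 := by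
  induction p with
  | zero => rfl
  | succ p ih => rw [sgnPow_succ, map_one, ih]

theorem sgnPow_mul (p : ℕ) (s t : SymAlg L) : sgnPow L p (s * t) = sgnPow L p s * sgnPow L p t := by
  induction p generalizing s t with
  | zero => rfl
  | succ p ih => rw [sgnPow_succ, map_mul, ih, sgnPow_succ, sgnPow_succ]

theorem sgnPow_ι (p : ℕ) (x : L) : sgnPow L p (ι L x) = ι L (L.sgnPow p x) := by
  induction p generalizing x with
  | zero => rfl
  | succ p ih =>
    rw [sgnPow_succ, DGModule.sgnPow_succ, ← ih]
    exact congrArg _ (lift_ι _ sgn_rel x)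

theorem sgnPow_ι_mul {q : ℕ} {x : L} (hx : x ∈ L.deg q) (p : ℕ) (s : SymAlg L) :
    sgnPow L p (ι L x * s) = (-1 : R) ^ (p * q) • (ι L x * sgnPow L p s) := by
  rw [sgnPow_mul, sgnPow_ι, DGModule.sgnPow_of_mem hx, map_smul, smul_mul_assoc]

theorem sgnPow_d (p : ℕ) (s : SymAlg L) : sgnPow L p (d L s) = (-1 : R) ^ p • d L (sgnPow L p s) :=
  DGModule.sgnPow_d (M := sym L) p s

theorem sgnPow_sgn (p : ℕ) (s : SymAlg L) : sgnPow L p (sgn L s) = sgn L (sgnPow L p s) :=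
  DGModule.sgnPow_sgn (M := sym L) p s

theorem sgnPow_mem {n : ℕ} {s : SymAlg L} (hs : s ∈ deg L n) (p : ℕ) :
    sgnPow L p s ∈ deg L n :=
  DGModule.sgnPow_mem (M := sym L) hs p

/-! ### The coaction -/

variable (L) in
/-- Left multiplication by `x` on `Sym L ⊗ L`. -/
noncomputable def leftMul (x : L) : SymAlg L ⊗[R] L →ₗ[R] SymAlg L ⊗[R] L :=
  TensorProduct.map (LinearMap.mulLeft R (ι L x)) LinearMap.id

theorem leftMul_tmul (x : L) (s : SymAlg L) (y : L) :
    leftMul L x (s ⊗ₜ[R] y) = (ι L x * s) ⊗ₜ[R] y := rfl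

theorem leftMul_add (x y : L) : leftMul L (x + y) = leftMul L x + leftMul L y := by
  ext; simp [leftMul_tmul, add_mul, TensorProduct.add_tmul]

theorem leftMul_smul (r : R) (x : L) : leftMul L (r • x) = r • leftMul L x := by
  ext; simp [leftMul_tmul, TensorProduct.smul_tmul']

theorem leftMul_comm {p q : ℕ} {x y : L} (hx : x ∈ L.deg p) (hy : y ∈ L.deg q)
    (t : SymAlg L ⊗[R] L) :
    leftMul L x (leftMul L y t) = (-1 : R) ^ (p * q) • leftMul L y (leftMul L x t) := by
  induction t using TensorProduct.induction_on with
  | zero => simp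
  | tmul s z =>
    rw [leftMul_tmul, leftMul_tmul, leftMul_tmul, leftMul_tmul, ← mul_assoc, ι_comm hx hy,
      smul_mul_assoc, mul_assoc, TensorProduct.smul_tmul']
  | add a b ha hb => simp only [map_add, smul_add, ha, hb]

variable [Algebra ℚ R]

variable (L) in
/-- `x ↦ (s ↦ ± s ⊗ x)`. -/
noncomputable def appendLin : L →ₗ[R] SymAlg L →ₗ[R] SymAlg L ⊗[R] L :=
  (TensorProduct.mk R L (SymAlg L)).compr₂ (braid L (sym L))

theorem appendLin_apply {p : ℕ} {x : L} (hx : x ∈ L.deg p) (s : SymAlg L) :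
    appendLin L x s = sgnPow L p s ⊗ₜ[R] x :=
  braid_of_mem_left (N := sym L) hx s

variable (L) in
/-- `x ↦ ((s, t) ↦ (x s, x t ± s ⊗ x))`. -/
noncomputable def coactionAux : L →ₗ[R] Module.End R (SymAlg L × SymAlg L ⊗[R] L) where
  toFun x := LinearMap.prod (LinearMap.mulLeft R (ι L x) ∘ₗ LinearMap.fst R _ _)
    (leftMul L x ∘ₗ LinearMap.snd R _ _ + appendLin L x ∘ₗ LinearMap.fst R _ _)
  map_add' x y := by
    refine LinearMap.ext fun ⟨s, t⟩ => Prod.ext ?_ ?_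
    · simp [add_mul]
    · simp [leftMul_add]; abel
  map_smul' r x := by
    refine LinearMap.ext fun ⟨s, t⟩ => Prod.ext ?_ ?_
    · simp
    · simp [leftMul_smul]

theorem coactionAux_apply (x : L) (s : SymAlg L) (t : SymAlg L ⊗[R] L) :
    coactionAux L x (s, t) = (ι L x * s, leftMul L x t + appendLin L x s) := rfl

/-- Exchanging x and y interchanges the term that extracts y with the one that extracts x, and the
leftover sign is a square. This is what lets the construction descend to the symmetric algebra. -/
theorem coactionAux_rel {p q : ℕ} {x y : L} (hx : x ∈ L.deg p) (hy : y ∈ L.deg q) :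
    coactionAux L x * coactionAux L y =
      (-1 : R) ^ (p * q) • (coactionAux L y * coactionAux L x) := by
  refine LinearMap.ext fun ⟨s, t⟩ => ?_
  have h1 : ((-1 : R) ^ (p * q)) * (-1) ^ (q * p) = 1 := by
    rw [mul_comm q p, ← mul_pow]; simp
  simp only [Module.End.mul_apply, LinearMap.smul_apply, coactionAux_apply, Prod.smul_mk,
    Prod.mk.injEq]
  refine ⟨by rw [← mul_assoc, ι_comm hx hy, smul_mul_assoc, mul_assoc], ?_⟩
  rw [map_add, map_add, leftMul_comm hx hy, appendLin_apply hy, appendLin_apply hx,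
    appendLin_apply hx, appendLin_apply hy, sgnPow_ι_mul hx, sgnPow_ι_mul hy, leftMul_tmul,
    leftMul_tmul, smul_add, smul_add, ← TensorProduct.smul_tmul', ← TensorProduct.smul_tmul',
    smul_smul, h1, one_smul]
  abel

variable (L) in
/-- The algebra homomorphism extending `coactionAux`. -/
noncomputable def coactionHom : SymAlg L →ₐ[R] Module.End R (SymAlg L × SymAlg L ⊗[R] L) :=
  lift (B := Module.End R (SymAlg L × SymAlg L ⊗[R] L)) (coactionAux L) coactionAux_rel

theorem coactionHom_ι (x : L) : coactionHom L (ι L x) = coactionAux L x :=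
  lift_ι (B := Module.End R (SymAlg L × SymAlg L ⊗[R] L)) _ coactionAux_rel x

variable (L) in
/-- The coaction `z_1 ⋯ z_k ↦ ∑ i, ± z_1 ⋯ (omit z_i) ⋯ z_k ⊗ z_i`. -/
noncomputable def coaction : SymAlg L →ₗ[R] SymAlg L ⊗[R] L :=
  LinearMap.snd R _ _ ∘ₗ LinearMap.applyₗ ((1, 0) : SymAlg L × SymAlg L ⊗[R] L) ∘ₗ
    (coactionHom L).toLinearMap

/-- The coaction is not multiplicative, so it cannot be defined by the universal property directly;
its graph is obtained as the orbit of (1, 0) under an algebra homomorphism. -/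
theorem coactionHom_one_zero (s : SymAlg L) : coactionHom L s (1, 0) = (s, coaction L s) := by
  refine Prod.ext ?_ rfl
  refine LinearMap.congr_fun (f := LinearMap.fst R _ _ ∘ₗ
    LinearMap.applyₗ ((1, 0) : SymAlg L × SymAlg L ⊗[R] L) ∘ₗ (coactionHom L).toLinearMap)
    (g := LinearMap.id) (linearMap_ext ?_ ?_) s
  · simp
  · intro p x _ s hs
    change (coactionHom L (ι L x * s) (1, 0)).1 = ι L x * s
    change (coactionHom L s (1, 0)).1 = s at hs
    rw [map_mul, Module.End.mul_apply, coactionHom_ι]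
    exact congrArg (ι L x * ·) hs

theorem coaction_one : coaction L 1 = 0 := by
  simp [coaction]

/-- The extracted letter either comes from s, or is x itself, which has to pass s on its way to the
right. This recursion is the source of the properties of the coaction below. -/
theorem coaction_ι_mul {p : ℕ} {x : L} (hx : x ∈ L.deg p) (s : SymAlg L) :
    coaction L (ι L x * s) = leftMul L x (coaction L s) + sgnPow L p s ⊗ₜ[R] x := by
  have h : coactionHom L (ι L x * s) (1, 0) = coactionAux L x (coactionHom L s (1, 0)) := by
    rw [map_mul, Module.End.mul_apply, coactionHom_ι]
  rw [coactionHom_one_zero, coactionHom_one_zero, coactionAux_apply, appendLin_apply hx] at h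
  exact congrArg Prod.snd h

end SymAlg

end DGModule

end DPoly

/-! ### Compatibility of the coaction with differentials, products and restriction; cocommutativity.
-/

namespace DPoly

open scoped TensorProduct

namespace DGModule

namespace SymAlg

variable {R : Type u} [CommRing R] {L : DGModule R}

theorem map_leftMul (g : SymAlg L →ₗ[R] SymAlg L) (h : L →ₗ[R] L) (x x' : L) (c : R)
    (hg : ∀ s, g (ι L x * s) = c • (ι L x' * g s)) (t : SymAlg L ⊗[R] L) :
    TensorProduct.map g h (leftMul L x t) = c • leftMul L x' (TensorProduct.map g h t) := by
  induction t using TensorProduct.induction_on with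
  | zero => simp
  | tmul s y =>
    rw [leftMul_tmul, TensorProduct.map_tmul, hg, TensorProduct.map_tmul, leftMul_tmul,
      TensorProduct.smul_tmul']
  | add a b ha hb => simp only [map_add, smul_add, ha, hb]

variable (L) in
/-- The differential of `Sym L ⊗ L`. -/
noncomputable def dTensor : SymAlg L ⊗[R] L →ₗ[R] SymAlg L ⊗[R] L :=
  TensorProduct.map (d L) LinearMap.id + TensorProduct.map (sgn L).toLinearMap L.d

theorem dTensor_tmul (s : SymAlg L) (y : L) :
    dTensor L (s ⊗ₜ[R] y) = d L s ⊗ₜ[R] y + sgn L s ⊗ₜ[R] L.d y := rfl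

theorem dTensor_leftMul {p : ℕ} {x : L} (hx : x ∈ L.deg p) (t : SymAlg L ⊗[R] L) :
    dTensor L (leftMul L x t) =
      leftMul L (L.d x) t + (-1 : R) ^ p • leftMul L x (dTensor L t) := by
  induction t using TensorProduct.induction_on with
  | zero => simp
  | tmul s y =>
    rw [dTensor_tmul, map_add, leftMul_tmul, leftMul_tmul, leftMul_tmul, leftMul_tmul,
      dTensor_tmul, d_ι_mul, sgn_ι_mul, L.sgn_of_mem hx, map_smul, smul_mul_assoc, smul_mul_assoc,
      TensorProduct.add_tmul, smul_add, TensorProduct.smul_tmul', TensorProduct.smul_tmul',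
      add_assoc]
  | add a b ha hb =>
    rw [map_add, map_add, map_add, ha, hb, map_add, map_add, smul_add]
    abel

theorem leftMul_mem {p n : ℕ} {x : L} (hx : x ∈ L.deg p) {t : SymAlg L ⊗[R] L}
    (ht : t ∈ tensorDeg (sym L) L n) : leftMul L x t ∈ tensorDeg (sym L) L (p + n) := by
  refine tensorDeg_le (M := sym L) (N := L)
    (E := (tensorDeg (sym L) L (p + n)).comap (leftMul L x)) ?_ ht
  rintro q r rfl s hs y hy
  exact tmul_mem_tensorDeg (M := sym L) (N := L) (add_assoc p q r) (ι_mul_mem_deg hx hs) hy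

variable [Algebra ℚ R]

theorem coaction_sgn (s : SymAlg L) :
    coaction L (sgn L s) = TensorProduct.map (sgn L).toLinearMap L.sgn (coaction L s) := by
  refine LinearMap.congr_fun (f := coaction L ∘ₗ (sgn L).toLinearMap)
    (g := TensorProduct.map (sgn L).toLinearMap L.sgn ∘ₗ coaction L) (linearMap_ext ?_ ?_) s
  · simp [coaction_one]
  · intro p x hx s hs
    change coaction L (sgn L s) = TensorProduct.map (sgn L).toLinearMap L.sgn (coaction L s) at hs
    change coaction L (sgn L (ι L x * s)) =
      TensorProduct.map (sgn L).toLinearMap L.sgn (coaction L (ι L x * s))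
    rw [sgn_ι_mul, L.sgn_of_mem hx, map_smul, smul_mul_assoc, map_smul, coaction_ι_mul hx,
      coaction_ι_mul hx, map_add, hs, sgnPow_sgn]
    rw [map_leftMul (sgn L).toLinearMap L.sgn x x ((-1) ^ p) (fun s => by
      rw [AlgHom.toLinearMap_apply, AlgHom.toLinearMap_apply, sgn_ι_mul, L.sgn_of_mem hx,
        map_smul, smul_mul_assoc])]
    rw [TensorProduct.map_tmul, L.sgn_of_mem hx, TensorProduct.tmul_smul, smul_add]
    rfl

theorem coaction_sgnPow (p : ℕ) (s : SymAlg L) :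
    coaction L (sgnPow L p s) =
      TensorProduct.map (sgnPow L p) (L.sgnPow p) (coaction L s) := by
  induction p generalizing s with
  | zero =>
    exact (LinearMap.congr_fun (TensorProduct.map_id (R := R) (M := SymAlg L) (N := L))
      (coaction L s)).symm
  | succ p ih =>
    rw [sgnPow_succ, ih, coaction_sgn]
    refine (TensorProduct.map_map _ _ _ _ _).trans ?_
    rfl

/-- Both sides satisfy the same recursion in the leading letter. The sign (-1)^p of moving `d` past
x appears once from the Leibniz rule and once from `sgnPow_d`, and cancels. -/
theorem coaction_d (s : SymAlg L) : coaction L (d L s) = dTensor L (coaction L s) := by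
  refine LinearMap.congr_fun (f := coaction L ∘ₗ d L)
    (g := dTensor L ∘ₗ coaction L) (linearMap_ext ?_ ?_) s
  · rw [LinearMap.comp_apply, LinearMap.comp_apply, d_one, map_zero, coaction_one, map_zero]
  · intro p x hx s hs
    rw [LinearMap.comp_apply, LinearMap.comp_apply] at hs ⊢
    rw [coaction_ι_mul hx, map_add, dTensor_leftMul hx, dTensor_tmul, d_ι_mul, map_add,
      coaction_ι_mul (L.d_mem hx), L.sgn_of_mem hx, map_smul, smul_mul_assoc, map_smul,
      coaction_ι_mul hx, hs, sgnPow_d, smul_add, ← TensorProduct.smul_tmul', smul_smul,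
      ← mul_pow, sgnPow_succ, sgnPow_sgn]
    simp only [mul_neg, mul_one, neg_neg, one_pow, one_smul]
    abel

theorem coaction_mem {n : ℕ} {s : SymAlg L} (hs : s ∈ deg L n) :
    coaction L s ∈ tensorDeg (sym L) L n := by
  induction hs using Submodule.span_induction with
  | mem s hs =>
    induction hs with
    | one => rw [coaction_one]; exact zero_mem _
    | @mul p n x s hx hs ih =>
      rw [coaction_ι_mul hx]
      exact add_mem (leftMul_mem hx ih) (tmul_mem_tensorDeg (M := sym L) (N := L) (add_comm n p)
        (sgnPow_mem (Submodule.subset_span hs) p) hx)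
  | zero => rw [map_zero]; exact zero_mem _
  | add a b _ _ ha hb => rw [map_add]; exact add_mem ha hb
  | smul r a _ ha => rw [map_smul]; exact Submodule.smul_mem _ _ ha

/-- The recursion at the right end: y is extracted without a sign, while a letter of s must pass y.
The formula for the symmetrization of a product s y rests on it. -/
theorem coaction_mul_ι {e : ℕ} {y : L} (hy : y ∈ L.deg e) (s : SymAlg L) :
    coaction L (s * ι L y) = s ⊗ₜ[R] y +
      TensorProduct.map (LinearMap.mulRight R (ι L y)) (L.sgnPow e) (coaction L s) := by
  refine LinearMap.congr_fun (f := coaction L ∘ₗ LinearMap.mulRight R (ι L y))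
    (g := (TensorProduct.mk R (SymAlg L) L).flip y +
      TensorProduct.map (LinearMap.mulRight R (ι L y)) (L.sgnPow e) ∘ₗ coaction L)
    (linearMap_ext ?_ ?_) s
  · have h := coaction_ι_mul hy 1
    rw [mul_one, coaction_one, map_zero, zero_add, sgnPow_one] at h
    simp [coaction_one, h]
  · intro p x hx s hs
    change coaction L (s * ι L y) = s ⊗ₜ[R] y +
      TensorProduct.map (LinearMap.mulRight R (ι L y)) (L.sgnPow e) (coaction L s) at hs
    change coaction L (ι L x * s * ι L y) = (ι L x * s) ⊗ₜ[R] y +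
      TensorProduct.map (LinearMap.mulRight R (ι L y)) (L.sgnPow e) (coaction L (ι L x * s))
    rw [mul_assoc, coaction_ι_mul hx, coaction_ι_mul hx, hs, map_add, map_add, leftMul_tmul,
      map_leftMul _ _ x x 1 (fun s => by simp [mul_assoc]), one_smul, TensorProduct.map_tmul,
      LinearMap.mulRight_apply, sgnPow_mul, sgnPow_ι, DGModule.sgnPow_of_mem hy,
      DGModule.sgnPow_of_mem hx, map_smul, mul_smul_comm, TensorProduct.tmul_smul,
      ← TensorProduct.smul_tmul', mul_comm e p, add_assoc]

variable (L) in
/-- The iterated coaction. -/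
noncomputable def coaction₂ : SymAlg L →ₗ[R] SymAlg L ⊗[R] (L ⊗[R] L) :=
  (TensorProduct.assoc R (SymAlg L) L L).toLinearMap ∘ₗ
    (coaction L).rTensor L ∘ₗ coaction L

/-- The letter x remains in the symmetric factor, or becomes the first or the second of the two
extracted letters. The braiding exchanges the last two cases, which proves cocommutativity by
induction. -/
theorem coaction₂_ι_mul {p : ℕ} {x : L} (hx : x ∈ L.deg p) (s : SymAlg L) :
    coaction₂ L (ι L x * s) =
      (LinearMap.mulLeft R (ι L x)).rTensor (L ⊗[R] L) (coaction₂ L s) +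
      TensorProduct.map (sgnPow L p) (TensorProduct.mk R L L x) (coaction L s) +
      TensorProduct.map (sgnPow L p) ((TensorProduct.mk R L L).flip x ∘ₗ L.sgnPow p)
        (coaction L s) := by
  have h1 : ∀ t : SymAlg L ⊗[R] L, TensorProduct.assoc R (SymAlg L) L L
      ((coaction L).rTensor L (leftMul L x t)) =
      (LinearMap.mulLeft R (ι L x)).rTensor (L ⊗[R] L) (TensorProduct.assoc R (SymAlg L) L L
        ((coaction L).rTensor L t)) +
      TensorProduct.map (sgnPow L p) (TensorProduct.mk R L L x) t := by
    intro t
    induction t using TensorProduct.induction_on with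
    | zero => simp
    | tmul s y =>
      rw [leftMul_tmul, LinearMap.rTensor_tmul, LinearMap.rTensor_tmul, coaction_ι_mul hx,
        TensorProduct.add_tmul, map_add, TensorProduct.assoc_tmul, TensorProduct.map_tmul]
      congr 1
      generalize coaction L s = t
      induction t using TensorProduct.induction_on with
      | zero => simp
      | tmul s z => simp [leftMul_tmul]
      | add a b ha hb => simp only [map_add, TensorProduct.add_tmul, ha, hb]
    | add a b ha hb => simp only [map_add, ha, hb]; abel
  have h2 : ∀ t : SymAlg L ⊗[R] L, TensorProduct.assoc R (SymAlg L) L L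
      ((TensorProduct.map (sgnPow L p) (L.sgnPow p) t) ⊗ₜ[R] x) =
      TensorProduct.map (sgnPow L p) ((TensorProduct.mk R L L).flip x ∘ₗ L.sgnPow p) t := by
    intro t
    induction t using TensorProduct.induction_on with
    | zero => simp
    | tmul s y => simp
    | add a b ha hb => simp only [map_add, TensorProduct.add_tmul, ha, hb]
  simp only [coaction₂, LinearMap.comp_apply, LinearEquiv.coe_coe]
  rw [coaction_ι_mul hx, map_add, map_add, h1, LinearMap.rTensor_tmul, coaction_sgnPow, h2]

/-- Cocommutativity of the iterated coaction. -/
theorem braid_coaction₂ (s : SymAlg L) :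
    (braid L L).lTensor (SymAlg L) (coaction₂ L s) = coaction₂ L s := by
  refine LinearMap.congr_fun (f := (braid L L).lTensor (SymAlg L) ∘ₗ coaction₂ L)
    (g := coaction₂ L) (linearMap_ext ?_ ?_) s
  · simp [coaction₂, coaction_one]
  · intro p x hx s hs
    rw [LinearMap.comp_apply] at hs ⊢
    have h1 : ∀ t : SymAlg L ⊗[R] (L ⊗[R] L), (braid L L).lTensor (SymAlg L)
        ((LinearMap.mulLeft R (ι L x)).rTensor (L ⊗[R] L) t) =
        (LinearMap.mulLeft R (ι L x)).rTensor (L ⊗[R] L) ((braid L L).lTensor (SymAlg L) t) := by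
      intro t
      induction t using TensorProduct.induction_on with
      | zero => simp
      | tmul s z => simp
      | add a b ha hb => simp only [map_add, ha, hb]
    have h2 : ∀ t : SymAlg L ⊗[R] L, (braid L L).lTensor (SymAlg L)
        (TensorProduct.map (sgnPow L p) (TensorProduct.mk R L L x) t) =
        TensorProduct.map (sgnPow L p) ((TensorProduct.mk R L L).flip x ∘ₗ L.sgnPow p) t := by
      intro t
      induction t using TensorProduct.induction_on with
      | zero => simp
      | tmul s z => simp [braid_of_mem_left hx]
      | add a b ha hb => simp only [map_add, ha, hb]
    have h3 : ∀ t : SymAlg L ⊗[R] L, (braid L L).lTensor (SymAlg L)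
        (TensorProduct.map (sgnPow L p) ((TensorProduct.mk R L L).flip x ∘ₗ L.sgnPow p) t) =
        TensorProduct.map (sgnPow L p) (TensorProduct.mk R L L x) t := by
      intro t
      induction t using TensorProduct.induction_on with
      | zero => simp
      | tmul s z =>
        simp only [TensorProduct.map_tmul, LinearMap.comp_apply, LinearMap.flip_apply,
          TensorProduct.mk_apply, LinearMap.lTensor_tmul]
        rw [braid_of_mem_right _ hx]
        congr 2
        -- Moving z past x and back costs the sign (-1)^{pn} twice, so the two occurrences cancel.
        refine LinearMap.congr_fun (f := L.sgnPow p ∘ₗ L.sgnPow p) (g := LinearMap.id)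
          (DGModule.linearMap_ext fun n z hz => ?_) z
        rw [LinearMap.comp_apply, DGModule.sgnPow_of_mem hz, map_smul, DGModule.sgnPow_of_mem hz,
          smul_smul, ← mul_pow]
        simp
      | add a b ha hb => simp only [map_add, ha, hb]
    rw [coaction₂_ι_mul hx, map_add, map_add, h1, hs, h2, h3]
    abel

end SymAlg

section Naturality

variable {R S : Type u} [CommRing R] [CommRing S] {φ : R →+* S} {L : DGModule R} {L' : DGModule S}

theorem symRes_sgnPow (F : Res φ L L') (p : ℕ) (s : SymAlg L) :
    symRes F (SymAlg.sgnPow L p s) = SymAlg.sgnPow L' p (symRes F s) := by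
  induction p generalizing s with
  | zero => rfl
  | succ p ih =>
    rw [SymAlg.sgnPow_succ, ih, SymAlg.sgnPow_succ]
    exact congrArg _ (F.sym.map_sgn s)

/-- Functoriality of `Sym L ⊗ L`. -/
noncomputable def symTensorRes (F : Res φ L L') : SymAlg L ⊗[R] L →+ SymAlg L' ⊗[S] L' :=
  tensorRes F.sym F

theorem symTensorRes_tmul (F : Res φ L L') (s : SymAlg L) (y : L) :
    symTensorRes F (s ⊗ₜ[R] y) = symRes F s ⊗ₜ[S] F.add y := rfl

theorem symTensorRes_smul (F : Res φ L L') (r : R) (t : SymAlg L ⊗[R] L) :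
    symTensorRes F (r • t) = φ r • symTensorRes F t := tensorRes_smul F.sym F r t

theorem symTensorRes_leftMul (F : Res φ L L') (x : L) (t : SymAlg L ⊗[R] L) :
    symTensorRes F (SymAlg.leftMul L x t) =
      SymAlg.leftMul L' (F.add x) (symTensorRes F t) := by
  induction t using TensorProduct.induction_on with
  | zero => simp only [map_zero]
  | tmul s y =>
    rw [SymAlg.leftMul_tmul, symTensorRes_tmul, symTensorRes_tmul, SymAlg.leftMul_tmul, map_mul,
      symRes_ι]
  | add a b ha hb => simp only [map_add, ha, hb]

theorem coaction_symRes [Algebra ℚ R] [Algebra ℚ S] (F : Res φ L L') (s : SymAlg L) :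
    SymAlg.coaction L' (symRes F s) = symTensorRes F (SymAlg.coaction L s) := by
  induction s using SymAlg.homogeneous_induction with
  | h0 => simp only [map_zero]
  | h1 => rw [map_one, SymAlg.coaction_one, SymAlg.coaction_one, map_zero]
  | hadd a b ha hb => simp only [map_add, ha, hb]
  | hsmul r a ha => rw [symRes_smul, map_smul, map_smul, ha, symTensorRes_smul]
  | hmul p x hx a ha =>
    rw [map_mul, symRes_ι, SymAlg.coaction_ι_mul (F.map_mem hx), SymAlg.coaction_ι_mul hx, ha,
      map_add, symTensorRes_leftMul, symTensorRes_tmul, symRes_sgnPow]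

end Naturality

end DGModule

end DPoly

/-! ### Symmetric powers, and the binomial formula for sums over orderings. -/

namespace DPoly

open scoped TensorProduct

namespace DGModule

namespace SymAlg

variable {R : Type u} [CommRing R] {L : DGModule R}

section Words

variable (L) in
/-- The `n`-th symmetric power. -/
noncomputable def pow : ℕ → Submodule R (SymAlg L)
  | 0 => Submodule.span R {1}
  | n + 1 => Submodule.span R {s | ∃ x : L, ∃ t ∈ pow n, ι L x * t = s}

theorem one_mem_pow : (1 : SymAlg L) ∈ pow L 0 := Submodule.subset_span rfl

theorem ι_mul_mem_pow (x : L) {n : ℕ} {s : SymAlg L} (hs : s ∈ pow L n) :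
    ι L x * s ∈ pow L (n + 1) :=
  Submodule.subset_span ⟨x, s, hs, rfl⟩

/-- Induction on symmetric powers. -/
theorem pow_induction {P : ℕ → SymAlg L → Prop} (h0 : ∀ n, P n 0) (h1 : P 0 1)
    (hadd : ∀ n a b, P n a → P n b → P n (a + b)) (hsmul : ∀ n (r : R) a, P n a → P n (r • a))
    (hmul : ∀ n p, ∀ x ∈ L.deg p, ∀ a ∈ pow L n, P n a → P (n + 1) (ι L x * a)) {n : ℕ}
    {s : SymAlg L} (hs : s ∈ pow L n) : P n s := by
  induction n generalizing s with
  | zero =>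
    induction hs using Submodule.span_induction with
    | mem s hs => obtain rfl : s = 1 := hs; exact h1
    | zero => exact h0 0
    | add a b _ _ ha hb => exact hadd 0 a b ha hb
    | smul r a _ ha => exact hsmul 0 r a ha
  | succ n ih =>
    induction hs using Submodule.span_induction with
    | mem s hs =>
      obtain ⟨x, t, ht, rfl⟩ := hs
      let N : Submodule R L :=
        { carrier := {x | P (n + 1) (ι L x * t)}
          zero_mem' := by
            change P (n + 1) (ι L 0 * t)
            rw [map_zero, zero_mul]; exact h0 _
          add_mem' := fun {a b} ha hb => by
            change P (n + 1) (ι L (a + b) * t)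
            rw [map_add, add_mul]; exact hadd _ _ _ ha hb
          smul_mem' := fun r a ha => by
            change P (n + 1) (ι L (r • a) * t)
            rw [map_smul, smul_mul_assoc]; exact hsmul _ _ _ ha }
      exact L.mem_of_deg N (fun p x hx => hmul n p x hx t ht (ih ht)) x
    | zero => exact h0 _
    | add a b _ _ ha hb => exact hadd _ a b ha hb
    | smul r a _ ha => exact hsmul _ r a ha

theorem iSup_pow : ⨆ n, pow L n = ⊤ := by
  rw [eq_top_iff]
  rintro s -
  refine mem_of_mul _ (Submodule.mem_iSup_of_mem 0 one_mem_pow) (fun p x _ s hs => ?_) s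
  induction hs using Submodule.iSup_induction' with
  | mem n s hs => exact Submodule.mem_iSup_of_mem (n + 1) (ι_mul_mem_pow x hs)
  | zero => rw [mul_zero]; exact zero_mem _
  | add a b _ _ ha hb => rw [mul_add]; exact add_mem ha hb

theorem sgnPow_mem_pow (p : ℕ) {n : ℕ} {s : SymAlg L} (hs : s ∈ pow L n) :
    sgnPow L p s ∈ pow L n := by
  refine pow_induction (P := fun n s => sgnPow L p s ∈ pow L n) ?_ ?_ ?_ ?_ ?_ hs
  · intro n; rw [map_zero]; exact zero_mem _
  · rw [sgnPow_one]; exact one_mem_pow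
  · intro n a b ha hb; rw [map_add]; exact add_mem ha hb
  · intro n r a ha; rw [map_smul]; exact Submodule.smul_mem _ _ ha
  · intro n q x hx a _ ha; rw [sgnPow_mul, sgnPow_ι]; exact ι_mul_mem_pow _ ha

variable (L) in
/-- The tensor products of elements of the `n`-th symmetric power with elements of `L`. -/
noncomputable def powTensor (n : ℕ) : Submodule R (SymAlg L ⊗[R] L) :=
  Submodule.span R {t | ∃ s ∈ pow L n, ∃ y : L, s ⊗ₜ[R] y = t}

theorem tmul_mem_powTensor {n : ℕ} {s : SymAlg L} (hs : s ∈ pow L n) (y : L) :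
    s ⊗ₜ[R] y ∈ powTensor L n := Submodule.subset_span ⟨s, hs, y, rfl⟩

theorem powTensor_le {n : ℕ} {E : Submodule R (SymAlg L ⊗[R] L)}
    (h : ∀ s ∈ pow L n, ∀ y : L, s ⊗ₜ[R] y ∈ E) : powTensor L n ≤ E := by
  refine Submodule.span_le.2 ?_
  rintro _ ⟨s, hs, y, rfl⟩
  exact h s hs y

theorem iSup_powTensor : ⨆ n, powTensor L n = ⊤ := by
  rw [eq_top_iff]
  rintro t -
  induction t using TensorProduct.induction_on with
  | zero => exact zero_mem _
  | add a b ha hb => exact add_mem ha hb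
  | tmul s y =>
    have hs : s ∈ ⨆ n, pow L n := iSup_pow (L := L) ▸ Submodule.mem_top
    induction hs using Submodule.iSup_induction' with
    | mem n s hs => exact Submodule.mem_iSup_of_mem n (tmul_mem_powTensor hs y)
    | zero => rw [TensorProduct.zero_tmul]; exact zero_mem _
    | add a b _ _ ha hb => rw [TensorProduct.add_tmul]; exact add_mem ha hb

theorem leftMul_mem_powTensor (x : L) {n : ℕ} {t : SymAlg L ⊗[R] L} (ht : t ∈ powTensor L n) :
    leftMul L x t ∈ powTensor L (n + 1) :=
  powTensor_le (E := (powTensor L (n + 1)).comap (leftMul L x))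
    (fun _ hs y => tmul_mem_powTensor (ι_mul_mem_pow x hs) y) ht

end Words

variable [Algebra ℚ R]

theorem coaction_mem_powTensor {n : ℕ} {s : SymAlg L} (hs : s ∈ pow L (n + 1)) :
    coaction L s ∈ powTensor L n := by
  -- The vanishing on constants is carried along: the first letter multiplies an element of the
  -- zeroth power, where the recursive term has to be zero.
  suffices h : ∀ m, ∀ s ∈ pow L m, (m = 0 → coaction L s = 0) ∧
      ∀ n, m = n + 1 → coaction L s ∈ powTensor L n from (h _ s hs).2 n rfl
  intro m s hs
  refine pow_induction (P := fun m s => (m = 0 → coaction L s = 0) ∧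
    ∀ n, m = n + 1 → coaction L s ∈ powTensor L n) ?_ ?_ ?_ ?_ ?_ hs
  · exact fun n => ⟨fun _ => map_zero _, fun _ _ => by rw [map_zero]; exact zero_mem _⟩
  · exact ⟨fun _ => coaction_one, fun n hn => absurd hn (by omega)⟩
  · intro n a b ha hb
    refine ⟨fun h => by rw [map_add, ha.1 h, hb.1 h, add_zero], fun k hk => ?_⟩
    rw [map_add]
    exact add_mem (ha.2 k hk) (hb.2 k hk)
  · intro n r a ha
    refine ⟨fun h => by rw [map_smul, ha.1 h, smul_zero], fun k hk => ?_⟩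
    rw [map_smul]
    exact Submodule.smul_mem _ _ (ha.2 k hk)
  · intro n p x hx a h ha
    refine ⟨fun h => absurd h (by omega), fun k hk => ?_⟩
    obtain rfl : n = k := by omega
    rw [coaction_ι_mul hx]
    refine add_mem ?_ (tmul_mem_powTensor (sgnPow_mem_pow p h) x)
    cases n with
    | zero => rw [ha.1 rfl, map_zero]; exact zero_mem _
    | succ n => exact leftMul_mem_powTensor x (ha.2 n rfl)

theorem coaction_of_mem_pow_zero {s : SymAlg L} (hs : s ∈ pow L 0) : coaction L s = 0 := by
  induction hs using Submodule.span_induction with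
  | mem s hs => obtain rfl : s = 1 := hs; exact coaction_one
  | zero => exact map_zero _
  | add a b _ _ ha hb => rw [map_add, ha, hb, add_zero]
  | smul r a _ ha => rw [map_smul, ha, smul_zero]

end SymAlg

section RightModule

open _root_.DPoly.DGModule.SymAlg

variable {R : Type u} [CommRing R] {L : DGModule R}
  {A : Type*} [AddCommGroup A] [Module R A]

/-- The product `Sym L ⊗ L → Sym L`. -/
noncomputable def symMul (L : DGModule R) : SymAlg L ⊗[R] L →ₗ[R] SymAlg L :=
  LinearMap.mul' R (SymAlg L) ∘ₗ (ι L).lTensor (SymAlg L)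

theorem symMul_tmul (s : SymAlg L) (y : L) : symMul L (s ⊗ₜ[R] y) = s * ι L y := by
  simp [symMul]

/-- The action of `L ⊗ L` on a module with a right action of `L`. -/
def act₂ (m : A ⊗[R] L →ₗ[R] A) : A ⊗[R] (L ⊗[R] L) →ₗ[R] A :=
  m ∘ₗ m.rTensor L ∘ₗ (TensorProduct.assoc R A L L).symm.toLinearMap

theorem act₂_tmul (m : A ⊗[R] L →ₗ[R] A) (a : A) (x y : L) :
    act₂ m (a ⊗ₜ[R] (x ⊗ₜ[R] y)) = m (m (a ⊗ₜ[R] x) ⊗ₜ[R] y) := rfl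

theorem tensor_linearMap_ext {M N : DGModule R} {P : Type*} [AddCommGroup P] [Module R P]
    {F G : M ⊗[R] N →ₗ[R] P}
    (h : ∀ p, ∀ x ∈ M.deg p, ∀ q, ∀ y ∈ N.deg q, F (x ⊗ₜ[R] y) = G (x ⊗ₜ[R] y)) : F = G := by
  refine TensorProduct.ext' fun x y => ?_
  refine LinearMap.congr_fun (DGModule.linearMap_ext (F := F ∘ₗ (TensorProduct.mk R M N).flip y)
    (G := G ∘ₗ (TensorProduct.mk R M N).flip y) fun p x hx => ?_) x
  exact LinearMap.congr_fun (DGModule.linearMap_ext (F := F ∘ₗ TensorProduct.mk R M N x)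
    (G := G ∘ₗ TensorProduct.mk R M N x) (h p x hx)) y

theorem tensor_ext_deg {P : Type*} [AddCommGroup P] [Module R P]
    {F G : SymAlg L ⊗[R] L →ₗ[R] P}
    (h : ∀ s, ∀ e, ∀ y ∈ L.deg e, F (s ⊗ₜ[R] y) = G (s ⊗ₜ[R] y)) : F = G :=
  TensorProduct.ext' fun s y =>
    LinearMap.congr_fun (DGModule.linearMap_ext (F := F ∘ₗ TensorProduct.mk R (SymAlg L) L s)
      (G := G ∘ₗ TensorProduct.mk R (SymAlg L) L s) (h s)) y

variable [Algebra ℚ R]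

/-- The map `s ⊗ y ↦ ∑ s' ⊗ [z, y]`, where `∑ s' ⊗ z` is the coaction on `s`. -/
noncomputable def adTensor (br : L ⊗[R] L →ₗ[R] L) : SymAlg L ⊗[R] L →ₗ[R] SymAlg L ⊗[R] L :=
  br.lTensor (SymAlg L) ∘ₗ (TensorProduct.assoc R (SymAlg L) L L).toLinearMap ∘ₗ
    (coaction L).rTensor L

/-- `m` is a right action of the graded Lie algebra `L` with bracket `br`. -/
def IsLieAction (br : L ⊗[R] L →ₗ[R] L) (m : A ⊗[R] L →ₗ[R] A) : Prop :=
  ∀ (a : A) (t : L ⊗[R] L), act₂ m (a ⊗ₜ[R] t) - act₂ m (a ⊗ₜ[R] braid L L t) = m (a ⊗ₜ[R] br t)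

/-- `s ⊗ y ↦ ∑ ± s' ⊗ y ⊗ z`, where `∑ s' ⊗ z` is the coaction on `s`. -/
noncomputable def moveLast (L : DGModule R) : SymAlg L ⊗[R] L →ₗ[R] (SymAlg L ⊗[R] L) ⊗[R] L :=
  (TensorProduct.assoc R (SymAlg L) L L).symm.toLinearMap ∘ₗ
    (braid L L).lTensor (SymAlg L) ∘ₗ (TensorProduct.assoc R (SymAlg L) L L).toLinearMap ∘ₗ
      (coaction L).rTensor L

theorem moveLast_tmul {e : ℕ} {y : L} (hy : y ∈ L.deg e) (s : SymAlg L) :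
    moveLast L (s ⊗ₜ[R] y) =
      TensorProduct.map ((TensorProduct.mk R (SymAlg L) L).flip y) (L.sgnPow e)
        (coaction L s) := by
  simp only [moveLast, LinearMap.comp_apply, LinearMap.rTensor_tmul, LinearEquiv.coe_coe]
  generalize coaction L s = t
  induction t using TensorProduct.induction_on with
  | zero => simp
  | tmul s z => simp [braid_of_mem_right z hy]
  | add a b ha hb => simp only [map_add, TensorProduct.add_tmul, ha, hb]

/-- Replaces the last letter `z` by `y`, and appends `z` at the end. -/
noncomputable def insertOp (m : A ⊗[R] L →ₗ[R] A) :
    (SymAlg L ⊗[R] L →ₗ[R] A) →ₗ[R] (SymAlg L ⊗[R] L →ₗ[R] A) where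
  toFun G := m ∘ₗ G.rTensor L ∘ₗ moveLast L
  map_add' G H := by rw [LinearMap.rTensor_add, LinearMap.add_comp, LinearMap.comp_add]
  map_smul' r G := by
    rw [LinearMap.rTensor_smul, LinearMap.smul_comp, LinearMap.comp_smul, RingHom.id_apply]

theorem insertOp_apply (m : A ⊗[R] L →ₗ[R] A) (G : SymAlg L ⊗[R] L →ₗ[R] A)
    (t : SymAlg L ⊗[R] L) : insertOp m G t = m (G.rTensor L (moveLast L t)) := rfl

theorem insertOp_tmul (m : A ⊗[R] L →ₗ[R] A) (G : SymAlg L ⊗[R] L →ₗ[R] A) {e : ℕ} {y : L}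
    (hy : y ∈ L.deg e) (s : SymAlg L) :
    insertOp m G (s ⊗ₜ[R] y) =
      m (TensorProduct.map (G ∘ₗ (TensorProduct.mk R (SymAlg L) L).flip y) (L.sgnPow e)
        (coaction L s)) := by
  rw [insertOp_apply, moveLast_tmul hy]
  generalize coaction L s = t
  congr 1
  induction t using TensorProduct.induction_on with
  | zero => simp
  | tmul s z => simp
  | add a b ha hb => simp only [map_add, ha, hb]

/-- Both composites extract two letters of s, bracket one of them with y and move the other to the
end. They differ only in which of the two is bracketed, and cocommutativity of the iterated coaction
identifies them. -/
theorem moveLast_adTensor {br : L ⊗[R] L →ₗ[R] L}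
    (hbr : ∀ {p q : ℕ} {x y : L}, x ∈ L.deg p → y ∈ L.deg q → br (x ⊗ₜ[R] y) ∈ L.deg (p + q)) :
    moveLast L ∘ₗ adTensor br = (adTensor br).rTensor L ∘ₗ moveLast L := by
  refine tensor_ext_deg (P := (SymAlg L ⊗[R] L) ⊗[R] L) fun s e y hy => ?_
  let P : SymAlg L ⊗[R] (L ⊗[R] L) →ₗ[R] (SymAlg L ⊗[R] L) ⊗[R] L :=
    (TensorProduct.assoc R (SymAlg L) L L).symm.toLinearMap ∘ₗ
      (TensorProduct.map (br ∘ₗ (TensorProduct.mk R L L).flip y) (L.sgnPow e)).lTensor (SymAlg L)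
  let Q : SymAlg L ⊗[R] (L ⊗[R] L) →ₗ[R] (SymAlg L ⊗[R] L) ⊗[R] L :=
    (TensorProduct.assoc R (SymAlg L) L L).symm.toLinearMap ∘ₗ
      (braid L L ∘ₗ (br ∘ₗ (TensorProduct.mk R L L).flip y).lTensor L).lTensor (SymAlg L)
  -- P brackets the first extracted letter with y, and Q the second; [b, y] has the sum of the
  -- degrees, so the signs differ exactly by the braiding of the two letters.
  have hPQ : Q = P ∘ₗ (braid L L).lTensor (SymAlg L) := by
    refine TensorProduct.ext' fun s t => ?_
    have : braid L L ∘ₗ (br ∘ₗ (TensorProduct.mk R L L).flip y).lTensor L =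
        TensorProduct.map (br ∘ₗ (TensorProduct.mk R L L).flip y) (L.sgnPow e) ∘ₗ braid L L := by
      refine tensor_linearMap_ext fun p a ha q b hb => ?_
      simp only [TensorProduct.mk_apply, LinearMap.comp_apply,
        LinearMap.lTensor_tmul, LinearMap.flip_apply]
      rw [braid_of_mem ha hb, braid_of_mem ha (hbr hb hy), map_smul, TensorProduct.map_tmul,
        LinearMap.comp_apply, LinearMap.flip_apply, TensorProduct.mk_apply,
        DGModule.sgnPow_of_mem ha, TensorProduct.tmul_smul, smul_smul]
      congr 1; ring
    simp only [P, Q, this, LinearMap.comp_apply, LinearMap.lTensor_tmul]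
  have h1 : moveLast L (adTensor br (s ⊗ₜ[R] y)) = Q (coaction₂ L s) := by
    simp only [adTensor, moveLast, coaction₂, Q, LinearMap.comp_apply, LinearMap.rTensor_tmul,
      LinearEquiv.coe_coe]
    generalize coaction L s = t
    congr 1
    induction t using TensorProduct.induction_on with
    | zero => simp
    | tmul s z =>
      simp only [LinearMap.rTensor_tmul, TensorProduct.assoc_tmul, LinearMap.lTensor_tmul]
      generalize coaction L s = t
      induction t using TensorProduct.induction_on with
      | zero => simp
      | tmul s z => simp
      | add a b ha hb => simp only [map_add, TensorProduct.add_tmul, ha, hb]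
    | add a b ha hb => simp only [map_add, TensorProduct.add_tmul, ha, hb]
  have h2 : (adTensor br).rTensor L (moveLast L (s ⊗ₜ[R] y)) = P (coaction₂ L s) := by
    rw [moveLast_tmul hy]
    simp only [adTensor, coaction₂, P, LinearMap.comp_apply, LinearEquiv.coe_coe]
    generalize coaction L s = t
    induction t using TensorProduct.induction_on with
    | zero => simp
    | tmul s z =>
      simp only [TensorProduct.map_tmul, LinearMap.rTensor_tmul, LinearMap.flip_apply,
        TensorProduct.mk_apply, LinearMap.comp_apply, LinearEquiv.coe_coe]
      generalize coaction L s = t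
      induction t using TensorProduct.induction_on with
      | zero => simp
      | tmul s z => simp
      | add a b ha hb => simp only [map_add, TensorProduct.add_tmul, ha, hb]
    | add a b ha hb => simp only [map_add, ha, hb]
  rw [LinearMap.comp_apply, LinearMap.comp_apply, h1, h2, hPQ, LinearMap.comp_apply,
    braid_coaction₂]

theorem insertOp_comp_adTensor {br : L ⊗[R] L →ₗ[R] L}
    (hbr : ∀ {p q : ℕ} {x y : L}, x ∈ L.deg p → y ∈ L.deg q → br (x ⊗ₜ[R] y) ∈ L.deg (p + q))
    (m : A ⊗[R] L →ₗ[R] A) (G : SymAlg L ⊗[R] L →ₗ[R] A) :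
    insertOp m (G ∘ₗ adTensor br) = insertOp m G ∘ₗ adTensor br := by
  refine LinearMap.ext fun t => ?_
  have h := LinearMap.congr_fun (moveLast_adTensor hbr) t
  rw [LinearMap.comp_apply, LinearMap.comp_apply] at h
  rw [LinearMap.comp_apply, insertOp_apply, insertOp_apply, h, LinearMap.rTensor_comp_apply]

/-- The maps `z_1 ⋯ z_k ↦ ∑ σ, ± e z_{σ(1)} ⋯ z_{σ(k)}`. -/
noncomputable def orderings (e : SymAlg L →ₗ[R] A) (m : A ⊗[R] L →ₗ[R] A) :
    ℕ → SymAlg L →ₗ[R] A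
  | 0 => e
  | k + 1 => m ∘ₗ (orderings e m k).rTensor L ∘ₗ coaction L

/-- Each coaction uses up one letter. With k < n some letters remain and `e` kills them; with k > n
there is eventually nothing left to extract. -/
theorem orderings_of_mem_pow {e : SymAlg L →ₗ[R] A} (he : ∀ n, ∀ s ∈ pow L (n + 1), e s = 0)
    (m : A ⊗[R] L →ₗ[R] A) {k n : ℕ} (hkn : k ≠ n) {s : SymAlg L} (hs : s ∈ pow L n) :
    orderings e m k s = 0 := by
  induction k generalizing n s with
  | zero =>
    cases n with
    | zero => exact absurd rfl hkn
    | succ n => exact he n s hs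
  | succ k ih =>
    cases n with
    | zero =>
      rw [orderings, LinearMap.comp_apply, LinearMap.comp_apply, coaction_of_mem_pow_zero hs,
        map_zero, map_zero]
    | succ n =>
      have h1 : (orderings e m k).rTensor L (coaction L s) = 0 := by
        refine powTensor_le (E := LinearMap.ker ((orderings e m k).rTensor L)) ?_
          (coaction_mem_powTensor hs)
        intro s hs y
        rw [LinearMap.mem_ker, LinearMap.rTensor_tmul, ih (by omega) hs, TensorProduct.zero_tmul]
      rw [orderings, LinearMap.comp_apply, LinearMap.comp_apply, h1, map_zero]

/-- The action relation ± a y z = a z y - a [z, y]: summed over the letters z, the first term orders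
one more letter before y, and the second is an application of `adTensor`. -/
theorem insertOp_orderings {br : L ⊗[R] L →ₗ[R] L} {m : A ⊗[R] L →ₗ[R] A}
    (hm : IsLieAction br m) (e : SymAlg L →ₗ[R] A) (k : ℕ) :
    insertOp m (m ∘ₗ (orderings e m k).rTensor L) =
      m ∘ₗ (orderings e m (k + 1)).rTensor L -
        (m ∘ₗ (orderings e m k).rTensor L) ∘ₗ adTensor br := by
  refine TensorProduct.ext' fun s y => ?_
  rw [LinearMap.sub_apply, eq_sub_iff_add_eq', ← eq_sub_iff_add_eq]
  simp only [LinearMap.comp_apply, insertOp_apply, moveLast, LinearMap.rTensor_tmul, orderings,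
    adTensor, LinearEquiv.coe_coe]
  generalize coaction L s = t
  induction t using TensorProduct.induction_on with
  | zero => simp
  | tmul s z =>
    simp only [LinearMap.rTensor_tmul, TensorProduct.assoc_tmul, LinearMap.lTensor_tmul]
    rw [← hm]
    congr 1
  | add a b ha hb =>
    simp only [map_add, TensorProduct.add_tmul, ha, hb]
    abel

/-- Orderings of s y are sorted by their last letter, which is y or a letter of s; this is
`coaction_mul_ι`. -/
theorem orderings_succ_symMul (e : SymAlg L →ₗ[R] A) (m : A ⊗[R] L →ₗ[R] A) (k : ℕ) :
    orderings e m (k + 1) ∘ₗ symMul L =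
      m ∘ₗ (orderings e m k).rTensor L + insertOp m (orderings e m k ∘ₗ symMul L) := by
  refine tensor_ext_deg fun s d y hy => ?_
  rw [LinearMap.add_apply, insertOp_tmul _ _ hy]
  simp only [LinearMap.comp_apply, LinearMap.rTensor_tmul, orderings, symMul_tmul]
  rw [coaction_mul_ι hy, map_add, map_add, LinearMap.rTensor_tmul]
  congr 2
  generalize coaction L s = t
  induction t using TensorProduct.induction_on with
  | zero => simp
  | tmul s z => simp [symMul_tmul]
  | add a b ha hb => simp only [map_add, ha, hb]

/-- The binomial formula for the symmetrization of a product. -/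
theorem orderings_symMul {br : L ⊗[R] L →ₗ[R] L}
    (hbr : ∀ {p q : ℕ} {x y : L}, x ∈ L.deg p → y ∈ L.deg q → br (x ⊗ₜ[R] y) ∈ L.deg (p + q))
    {m : A ⊗[R] L →ₗ[R] A} (hm : IsLieAction br m) {e : SymAlg L →ₗ[R] A}
    (he : e ∘ₗ symMul L = 0) (k : ℕ) :
    orderings e m (k + 1) ∘ₗ symMul L =
      ∑ i ∈ Finset.range (k + 1), ((-1 : ℤ) ^ i * ((k + 1).choose (i + 1) : ℤ)) •
        ((m ∘ₗ (orderings e m (k - i)).rTensor L) ∘ₗ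
          ((adTensor br : Module.End R (SymAlg L ⊗[R] L)) ^ i)) := by
  induction k with
  | zero =>
    rw [orderings_succ_symMul]
    have : insertOp m (orderings e m 0 ∘ₗ symMul L) = 0 := by
      rw [show orderings e m 0 ∘ₗ symMul L = 0 from he, map_zero]
    rw [this]
    simp [Module.End.one_eq_id]
  | succ k ih =>
    -- Because insertion commutes with `adTensor`, it need only be computed on the terms without
    -- `adTensor`.
    have hT : ∀ (G : SymAlg L ⊗[R] L →ₗ[R] A) (i : ℕ),
        insertOp m (G ∘ₗ ((adTensor br : Module.End R (SymAlg L ⊗[R] L)) ^ i)) =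
          insertOp m G ∘ₗ ((adTensor br : Module.End R (SymAlg L ⊗[R] L)) ^ i) := by
      intro G i
      induction i generalizing G with
      | zero => rfl
      | succ i ihi =>
        rw [pow_succ', Module.End.mul_eq_comp, ← LinearMap.comp_assoc, ihi,
          insertOp_comp_adTensor hbr, LinearMap.comp_assoc]
    rw [orderings_succ_symMul, ih, map_sum]
    simp only [map_zsmul, hT, insertOp_orderings hm, LinearMap.sub_comp, smul_sub]
    rw [Finset.sum_sub_distrib]
    rw [Finset.sum_range_succ' (n := k + 1)]
    set W : ℕ → ℕ → (SymAlg L ⊗[R] L →ₗ[R] A) := fun l i =>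
      (m ∘ₗ (orderings e m l).rTensor L) ∘ₗ
        ((adTensor br : Module.End R (SymAlg L ⊗[R] L)) ^ i) with hW
    -- The term i = 0 is split off and the others are shifted down by one; the sum on the right has
    -- one more term, whose coefficient C(k+1, k+2) is zero.
    have hA : ∑ i ∈ Finset.range (k + 1), ((-1 : ℤ) ^ i * ((k + 1).choose (i + 1) : ℤ)) •
        ((m ∘ₗ (orderings e m (k - i + 1)).rTensor L) ∘ₗ
          ((adTensor br : Module.End R (SymAlg L ⊗[R] L)) ^ i)) =
        ∑ i ∈ Finset.range (k + 1), ((-1 : ℤ) ^ (i + 1) * ((k + 1).choose (i + 2) : ℤ)) •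
          W (k - i) (i + 1) + ((k + 1 : ℕ) : ℤ) • W (k + 1) 0 := by
      rw [Finset.sum_range_succ', Finset.sum_range_succ (n := k)]
      simp only [Nat.choose_succ_self, Nat.cast_zero, mul_zero, zero_smul, add_zero, Nat.sub_zero,
        pow_zero, one_mul, zero_add, Nat.choose_one_right]
      congr 1
      refine Finset.sum_congr rfl fun i hi => ?_
      have := Finset.mem_range.1 hi
      rw [show k - (i + 1) + 1 = k - i by omega]
    have hB : ∑ i ∈ Finset.range (k + 1), ((-1 : ℤ) ^ i * ((k + 1).choose (i + 1) : ℤ)) •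
        (((m ∘ₗ (orderings e m (k - i)).rTensor L) ∘ₗ adTensor br) ∘ₗ
          ((adTensor br : Module.End R (SymAlg L ⊗[R] L)) ^ i)) =
        ∑ i ∈ Finset.range (k + 1), ((-1 : ℤ) ^ i * ((k + 1).choose (i + 1) : ℤ)) •
          W (k - i) (i + 1) := by
      refine Finset.sum_congr rfl fun i _ => ?_
      simp only [hW]
      rw [pow_succ', Module.End.mul_eq_comp, LinearMap.comp_assoc (adTensor br ^ i)]
    have hC : m ∘ₗ (orderings e m (k + 1)).rTensor L = W (k + 1) 0 := rfl
    rw [hA, hB, hC]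
    have hD : ∀ i, k + 1 - (i + 1) = k - i := fun i => by omega
    simp only [hD, Nat.sub_zero, pow_zero, one_mul, zero_add, Nat.choose_one_right]
    change _ = ∑ i ∈ Finset.range (k + 1), ((-1 : ℤ) ^ (i + 1) * ((k + 1 + 1).choose (i + 1 + 1) : ℤ)) •
      W (k - i) (i + 1) + ((k + 1 + 1 : ℕ) : ℤ) • W (k + 1) 0
    -- Pascal's rule, matching the two families of terms produced by `insertOp_orderings`.
    have hE : ∀ i, ((-1 : ℤ) ^ (i + 1) * ((k + 1 + 1).choose (i + 1 + 1) : ℤ)) =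
        (-1 : ℤ) ^ (i + 1) * ((k + 1).choose (i + 2) : ℤ) -
          (-1 : ℤ) ^ i * ((k + 1).choose (i + 1) : ℤ) := by
      intro i
      rw [Nat.choose_succ_succ]
      push_cast
      ring
    simp only [hE, sub_smul, Finset.sum_sub_distrib]
    push_cast
    simp only [add_smul, one_smul]
    abel

end RightModule

end DGModule

end DPoly

/-! ### Locally finite sums, power series, and the identity over one ring. -/

namespace DPoly

open scoped TensorProduct

section LocallyFinite

variable {R M N : Type*} [CommRing R] [AddCommGroup M] [Module R M] [AddCommGroup N] [Module R N]

/-- The sum of a locally finite sequence of linear maps. -/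
noncomputable def locallyFiniteSum (F : ℕ → M →ₗ[R] N)
    (h : ∀ x, ∃ n, ∀ k, n ≤ k → F k x = 0) : M →ₗ[R] N :=
  have hf : ∀ x, (Function.support fun k => F k x).Finite := fun x => by
    obtain ⟨n, hn⟩ := h x
    refine (Set.finite_lt_nat n).subset fun k hk => ?_
    by_contra hk'
    exact hk (hn k (not_lt.1 hk'))
  { toFun := fun x => ∑ᶠ k, F k x
    map_add' := fun x y => by
      simp only [map_add]
      exact finsum_add_distrib (hf x) (hf y)
    map_smul' := fun r x => by
      simp only [map_smul, RingHom.id_apply]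
      exact (smul_finsum' r (hf x)).symm }

theorem locallyFiniteSum_apply {F : ℕ → M →ₗ[R] N} (h : ∀ x, ∃ n, ∀ k, n ≤ k → F k x = 0)
    {x : M} {n : ℕ} (hn : ∀ k, n ≤ k → F k x = 0) :
    locallyFiniteSum F h x = ∑ k ∈ Finset.range n, F k x := by
  refine finsum_eq_sum_of_support_subset _ fun k hk => ?_
  rw [Finset.coe_range]
  by_contra hk'
  exact hk (hn k (not_lt.1 hk'))

theorem locallyFiniteSum_apply_single {F : ℕ → M →ₗ[R] N}
    (h : ∀ x, ∃ n, ∀ k, n ≤ k → F k x = 0) {x : M} {n : ℕ} (hn : ∀ k, k ≠ n → F k x = 0) :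
    locallyFiniteSum F h x = F n x :=
  finsum_eq_single _ n hn

theorem exists_forall_eq_zero_of_iSup {W : ℕ → Submodule R M} (hW : ⨆ n, W n = ⊤)
    {F : ℕ → M →ₗ[R] N} (h : ∀ n, ∀ x ∈ W n, ∀ k, n < k → F k x = 0) (x : M) :
    ∃ n, ∀ k, n ≤ k → F k x = 0 := by
  have hx : x ∈ ⨆ n, W n := hW ▸ Submodule.mem_top
  induction hx using Submodule.iSup_induction' with
  | mem n x hx => exact ⟨n + 1, fun k hk => h n x hx k hk⟩
  | zero => exact ⟨0, fun k _ => map_zero _⟩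
  | add x y _ _ hx hy =>
    obtain ⟨n, hn⟩ := hx
    obtain ⟨m, hm⟩ := hy
    exact ⟨max n m, fun k hk => by
      rw [map_add, hn k (le_of_max_le_left hk), hm k (le_of_max_le_right hk), add_zero]⟩

/-- A linear map that agrees on the members of a covering family. -/
theorem linearMap_ext_iSup {W : ℕ → Submodule R M} (hW : ⨆ n, W n = ⊤) {F G : M →ₗ[R] N}
    (h : ∀ n, ∀ x ∈ W n, F x = G x) : F = G := by
  have h1 : ⨆ n, W n ≤ LinearMap.eqLocus F G := iSup_le fun n x hx => h n x hx
  rw [hW] at h1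
  exact LinearMap.ext fun x => h1 Submodule.mem_top

variable [Algebra ℚ R]

/-- The evaluation of a power series at a locally nilpotent endomorphism. -/
noncomputable def evalSeries (c : PowerSeries ℚ) (ω : Module.End R M)
    (h : ∀ x, ∃ n, ∀ k, n ≤ k → (ω ^ k) x = 0) : M →ₗ[R] M :=
  locallyFiniteSum (fun j => algebraMap ℚ R (PowerSeries.coeff j c) • ω ^ j) fun x => by
    obtain ⟨n, hn⟩ := h x
    exact ⟨n, fun k hk => by rw [LinearMap.smul_apply, hn k hk, smul_zero]⟩

theorem evalSeries_apply (c : PowerSeries ℚ) {ω : Module.End R M}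
    (h : ∀ x, ∃ n, ∀ k, n ≤ k → (ω ^ k) x = 0) {x : M} {n : ℕ}
    (hn : ∀ k, n ≤ k → (ω ^ k) x = 0) :
    evalSeries c ω h x =
      ∑ j ∈ Finset.range n, algebraMap ℚ R (PowerSeries.coeff j c) • (ω ^ j) x :=
  locallyFiniteSum_apply _ fun k hk => by rw [LinearMap.smul_apply, hn k hk, smul_zero]

end LocallyFinite

/-- The power series `(1 - exp (-t)) / t`. -/
noncomputable def expQuotient : PowerSeries ℚ :=
  PowerSeries.mk fun i => (-1) ^ i * ((i + 1).factorial : ℚ)⁻¹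

theorem todd_mul_expQuotient : todd * expQuotient = 1 := by
  have h : PowerSeries.X * expQuotient =
      1 - PowerSeries.evalNegHom (PowerSeries.exp ℚ) := by
    ext n
    rw [map_sub, PowerSeries.evalNegHom, PowerSeries.coeff_rescale]
    cases n with
    | zero => simp
    | succ n =>
      rw [PowerSeries.coeff_succ_X_mul, expQuotient, PowerSeries.coeff_mk, PowerSeries.coeff_exp,
        PowerSeries.coeff_one, if_neg n.succ_ne_zero, pow_succ]
      simp
  -- After multiplication by t, the claim is the defining relation of `todd`.
  refine mul_left_cancel₀ (PowerSeries.X_ne_zero (R := ℚ)) ?_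
  rw [mul_left_comm, h, todd_mul, mul_one]

namespace DGModule

section Symmetrization

open _root_.DPoly.DGModule.SymAlg

variable {R : Type u} [CommRing R] {L : DGModule R}

theorem mul_ι_mem_pow (y : L) {n : ℕ} {s : SymAlg L} (hs : s ∈ SymAlg.pow L n) :
    s * ι L y ∈ SymAlg.pow L (n + 1) := by
  refine pow_induction (P := fun n s => s * ι L y ∈ SymAlg.pow L (n + 1)) ?_ ?_ ?_ ?_ ?_ hs
  · intro n; rw [zero_mul]; exact zero_mem _
  · have := ι_mul_mem_pow y (one_mem_pow (L := L))
    rw [mul_one] at this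
    rwa [one_mul]
  · intro n a b ha hb; rw [add_mul]; exact add_mem ha hb
  · intro n r a ha; rw [smul_mul_assoc]; exact Submodule.smul_mem _ _ ha
  · intro n q x hx a _ ha; rw [mul_assoc]; exact ι_mul_mem_pow _ ha

theorem symMul_mem_pow {n : ℕ} {t : SymAlg L ⊗[R] L} (ht : t ∈ powTensor L n) :
    symMul L t ∈ SymAlg.pow L (n + 1) := by
  refine powTensor_le (E := (SymAlg.pow L (n + 1)).comap (symMul L)) (fun s hs y => ?_) ht
  rw [Submodule.mem_comap, symMul_tmul]
  exact mul_ι_mem_pow y hs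

variable [Algebra ℚ R]
  {A : Type*} [AddCommGroup A] [Module R A]

/-- A letter leaves the symmetric factor and is absorbed by the bracket into the factor L. This drop
of the symmetric degree is the cause of local nilpotence. -/
theorem adTensor_mem_powTensor (br : L ⊗[R] L →ₗ[R] L) {n : ℕ} {t : SymAlg L ⊗[R] L}
    (ht : t ∈ powTensor L (n + 1)) : adTensor br t ∈ powTensor L n := by
  refine powTensor_le (E := (powTensor L n).comap (adTensor br)) (fun s hs y => ?_) ht
  have h1 := coaction_mem_powTensor hs
  simp only [Submodule.mem_comap, adTensor, LinearMap.comp_apply, LinearMap.rTensor_tmul,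
    LinearEquiv.coe_coe]
  refine powTensor_le (E := (powTensor L n).comap (br.lTensor (SymAlg L) ∘ₗ
    (TensorProduct.assoc R (SymAlg L) L L).toLinearMap ∘ₗ
      (TensorProduct.mk R (SymAlg L ⊗[R] L) L).flip y)) (fun s hs z => ?_) h1
  exact tmul_mem_powTensor hs _

theorem adTensor_of_mem_powTensor_zero (br : L ⊗[R] L →ₗ[R] L) {t : SymAlg L ⊗[R] L}
    (ht : t ∈ powTensor L 0) : adTensor br t = 0 := by
  refine powTensor_le (E := LinearMap.ker (adTensor br)) (fun s hs y => ?_) ht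
  simp [adTensor, coaction_of_mem_pow_zero hs]

theorem adTensor_pow_mem_powTensor (br : L ⊗[R] L →ₗ[R] L) {n : ℕ} {t : SymAlg L ⊗[R] L}
    (ht : t ∈ powTensor L n) {k : ℕ} (hk : k ≤ n) :
    ((adTensor br : Module.End R (SymAlg L ⊗[R] L)) ^ k) t ∈ powTensor L (n - k) := by
  induction k with
  | zero => exact ht
  | succ k ih =>
    rw [pow_succ', Module.End.mul_apply]
    refine adTensor_mem_powTensor br ?_
    rw [show n - (k + 1) + 1 = n - k by omega]
    exact ih (by omega)

theorem adTensor_pow_eq_zero (br : L ⊗[R] L →ₗ[R] L) {n : ℕ} {t : SymAlg L ⊗[R] L}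
    (ht : t ∈ powTensor L n) {k : ℕ} (hk : n < k) :
    ((adTensor br : Module.End R (SymAlg L ⊗[R] L)) ^ k) t = 0 := by
  obtain ⟨k, rfl⟩ : ∃ j, k = j + (n + 1) := ⟨k - (n + 1), by omega⟩
  have h := adTensor_pow_mem_powTensor br ht le_rfl
  rw [Nat.sub_self] at h
  rw [pow_add, pow_succ', Module.End.mul_apply, Module.End.mul_apply,
    adTensor_of_mem_powTensor_zero br h, map_zero]

/-- `adTensor` is locally nilpotent. -/
theorem adTensor_locally_nilpotent (br : L ⊗[R] L →ₗ[R] L) (t : SymAlg L ⊗[R] L) :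
    ∃ n, ∀ k, n ≤ k → ((adTensor br : Module.End R (SymAlg L ⊗[R] L)) ^ k) t = 0 :=
  exists_forall_eq_zero_of_iSup iSup_powTensor
    (fun _ _ ht _ hk => adTensor_pow_eq_zero br ht hk) t

variable {e : SymAlg L →ₗ[R] A} (he : ∀ n, ∀ s ∈ SymAlg.pow L (n + 1), e s = 0)
  (m : A ⊗[R] L →ₗ[R] A)

/-- The symmetrization map. -/
noncomputable def symmetrization : SymAlg L →ₗ[R] A :=
  locallyFiniteSum (fun k => algebraMap ℚ R ((k.factorial : ℚ)⁻¹) • orderings e m k)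
    (exists_forall_eq_zero_of_iSup SymAlg.iSup_pow fun n s hs k hk => by
      rw [LinearMap.smul_apply, orderings_of_mem_pow he m hk.ne' hs, smul_zero])

theorem symmetrization_of_mem_pow {n : ℕ} {s : SymAlg L} (hs : s ∈ SymAlg.pow L n) :
    symmetrization he m s = algebraMap ℚ R ((n.factorial : ℚ)⁻¹) • orderings e m n s :=
  locallyFiniteSum_apply_single _ fun k hk => by
    rw [LinearMap.smul_apply, orderings_of_mem_pow he m hk hs, smul_zero]

theorem symmetrization_rTensor_of_mem {n : ℕ} {t : SymAlg L ⊗[R] L} (ht : t ∈ powTensor L n) :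
    m ((symmetrization he m).rTensor L t) =
      algebraMap ℚ R ((n.factorial : ℚ)⁻¹) • m ((orderings e m n).rTensor L t) := by
  refine powTensor_le (E := LinearMap.eqLocus (m ∘ₗ (symmetrization he m).rTensor L)
    (algebraMap ℚ R ((n.factorial : ℚ)⁻¹) • (m ∘ₗ (orderings e m n).rTensor L)))
    (fun s hs y => ?_) ht
  simp only [LinearMap.mem_eqLocus, LinearMap.comp_apply, LinearMap.rTensor_tmul,
    LinearMap.smul_apply]
  rw [symmetrization_of_mem_pow he m hs, ← TensorProduct.smul_tmul', map_smul]

theorem choose_mul_inv_factorial {n i : ℕ} (hi : i ≤ n) :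
    ((n + 1).factorial : ℚ)⁻¹ * ((n + 1).choose (i + 1) : ℚ) =
      ((i + 1).factorial : ℚ)⁻¹ * ((n - i).factorial : ℚ)⁻¹ := by
  have h := Nat.choose_mul_factorial_mul_factorial (show i + 1 ≤ n + 1 by omega)
  rw [show n + 1 - (i + 1) = n - i by omega] at h
  have h' : ((n + 1).choose (i + 1) : ℚ) * (i + 1).factorial * (n - i).factorial =
    (n + 1).factorial := by exact_mod_cast h
  have h1 : ((n + 1).factorial : ℚ) ≠ 0 := Nat.cast_ne_zero.2 (Nat.factorial_ne_zero _)
  have h2 : ((i + 1).factorial : ℚ) ≠ 0 := Nat.cast_ne_zero.2 (Nat.factorial_ne_zero _)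
  have h3 : ((n - i).factorial : ℚ) ≠ 0 := Nat.cast_ne_zero.2 (Nat.factorial_ne_zero _)
  field_simp
  linear_combination h'

/-- The binomial formula divided by (n+1)!. The i-th term lives in symmetric degree n - i, where
orderings are (n-i)! times the symmetrization, so the coefficient C(n+1, i+1) becomes 1 / (i+1)!. -/
theorem symmetrization_symMul {br : L ⊗[R] L →ₗ[R] L}
    (hbr : ∀ {p q : ℕ} {x y : L}, x ∈ L.deg p → y ∈ L.deg q → br (x ⊗ₜ[R] y) ∈ L.deg (p + q))
    {m : A ⊗[R] L →ₗ[R] A} (hm : IsLieAction br m)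
    {n : ℕ} {t : SymAlg L ⊗[R] L} (ht : t ∈ powTensor L n) :
    symmetrization he m (symMul L t) = ∑ i ∈ Finset.range (n + 1),
      algebraMap ℚ R (PowerSeries.coeff i expQuotient) • m ((symmetrization he m).rTensor L
        (((adTensor br : Module.End R (SymAlg L ⊗[R] L)) ^ i) t)) := by
  have he' : e ∘ₗ symMul L = 0 := by
    refine linearMap_ext_iSup iSup_powTensor fun n t ht => ?_
    exact he n _ (symMul_mem_pow ht)
  rw [symmetrization_of_mem_pow he m (symMul_mem_pow ht)]
  have h := LinearMap.congr_fun (orderings_symMul hbr hm he' n) t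
  rw [LinearMap.comp_apply] at h
  rw [h, LinearMap.sum_apply, Finset.smul_sum]
  refine Finset.sum_congr rfl fun i hi => ?_
  have hi' : i ≤ n := Nat.lt_succ_iff.1 (Finset.mem_range.1 hi)
  rw [symmetrization_rTensor_of_mem he m (adTensor_pow_mem_powTensor br ht hi'), smul_smul,
    LinearMap.smul_apply, ← Int.cast_smul_eq_zsmul R, smul_smul, ← map_intCast (algebraMap ℚ R),
    ← map_mul, ← map_mul, LinearMap.comp_apply, LinearMap.comp_apply, expQuotient,
    PowerSeries.coeff_mk]
  congr 2
  push_cast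
  linear_combination ((-1 : ℚ) ^ i) * choose_mul_inv_factorial hi'

/-- `m ∘ (I ⊗ id) = I ∘ μ ∘ ω / (1 - exp (-ω))`. -/
theorem symmetrization_comp_evalSeries {br : L ⊗[R] L →ₗ[R] L}
    (hbr : ∀ {p q : ℕ} {x y : L}, x ∈ L.deg p → y ∈ L.deg q → br (x ⊗ₜ[R] y) ∈ L.deg (p + q))
    {m : A ⊗[R] L →ₗ[R] A} (hm : IsLieAction br m) :
    m ∘ₗ (symmetrization he m).rTensor L =
      symmetrization he m ∘ₗ symMul L ∘ₗ
        evalSeries todd (adTensor br) (adTensor_locally_nilpotent br) := by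
  refine linearMap_ext_iSup iSup_powTensor fun n t ht => ?_
  set Q := m ∘ₗ (symmetrization he m).rTensor L with hQ
  set ω : Module.End R (SymAlg L ⊗[R] L) := adTensor br with hω
  -- ω^j t has symmetric degree n - j, so the expansion stops there; this truncation makes the
  -- double sum a triangle that can be rearranged by total degree.
  have h1 : ∀ j ∈ Finset.range (n + 1), symmetrization he m (symMul L ((ω ^ j) t)) =
      ∑ i ∈ Finset.range (n + 1 - j),
        algebraMap ℚ R (PowerSeries.coeff i expQuotient) • Q ((ω ^ (j + i)) t) := by
    intro j hj
    have hj' : j ≤ n := Nat.lt_succ_iff.1 (Finset.mem_range.1 hj)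
    rw [symmetrization_symMul he hbr hm (adTensor_pow_mem_powTensor br ht hj'),
      show n + 1 - j = n - j + 1 by omega]
    refine Finset.sum_congr rfl fun i _ => ?_
    rw [add_comm j i, pow_add, Module.End.mul_apply]
    rfl
  change Q t = symmetrization he m (symMul L (evalSeries todd ω (adTensor_locally_nilpotent br) t))
  rw [evalSeries_apply todd _ (n := n + 1) (fun k hk => adTensor_pow_eq_zero br ht hk), map_sum,
    map_sum]
  simp only [map_smul]
  rw [Finset.sum_congr rfl fun j hj => congrArg _ (h1 j hj)]
  simp only [Finset.smul_sum, smul_smul, ← map_mul]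
  rw [← Finset.sum_range_diag_flip (n + 1) fun j i => algebraMap ℚ R
    (PowerSeries.coeff j todd * PowerSeries.coeff i expQuotient) • Q ((ω ^ (j + i)) t)]
  -- On a diagonal the coefficients form the Cauchy product of the two mutually inverse series, so
  -- only k = 0 survives.
  have h2 : ∀ k, ∑ j ∈ Finset.range (k + 1), algebraMap ℚ R
      (PowerSeries.coeff j todd * PowerSeries.coeff (k - j) expQuotient) •
        Q ((ω ^ (j + (k - j))) t) = if k = 0 then Q t else 0 := by
    intro k
    have h3 : ∀ j ∈ Finset.range (k + 1), algebraMap ℚ R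
      (PowerSeries.coeff j todd * PowerSeries.coeff (k - j) expQuotient) •
        Q ((ω ^ (j + (k - j))) t) = algebraMap ℚ R
      (PowerSeries.coeff j todd * PowerSeries.coeff (k - j) expQuotient) • Q ((ω ^ k) t) := by
      intro j hj
      rw [show j + (k - j) = k by have := Finset.mem_range.1 hj; omega]
    rw [Finset.sum_congr rfl h3, ← Finset.sum_smul, ← map_sum,
      ← Finset.Nat.sum_antidiagonal_eq_sum_range_succ
        (fun a b => PowerSeries.coeff a todd * PowerSeries.coeff b expQuotient),
      ← PowerSeries.coeff_mul, todd_mul_expQuotient, PowerSeries.coeff_one]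
    split_ifs with hk
    · subst hk; simp
    · simp
  rw [Finset.sum_congr rfl fun k _ => h2 k]
  simp

end Symmetrization

end DGModule

end DPoly

/-! ### Explicit formulas on words, and sums over permutations with Koszul signs. -/

namespace DPoly

open scoped TensorProduct

theorem eraseIdx_ofFn {α : Type*} {n : ℕ} (g : Fin (n + 1) → α) (i : Fin (n + 1)) :
    (List.ofFn g).eraseIdx i = List.ofFn fun j => g (i.succAbove j) := by
  induction n with
  | zero => fin_cases i; simp
  | succ n ih =>
    induction i using Fin.cases with
    | zero => simp [List.ofFn_succ]
    | succ i =>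
      rw [List.ofFn_succ, Fin.val_succ, List.eraseIdx_cons_succ, ih, List.ofFn_succ (n := n)]
      simp

namespace DGModule

namespace SymAlg

variable {R : Type u} [CommRing R] {L : DGModule R}

theorem ι_mul_comm {p : ℕ} {x : L} (hx : x ∈ L.deg p) (s : SymAlg L) :
    ι L x * s = sgnPow L p s * ι L x := by
  refine LinearMap.congr_fun (f := LinearMap.mulLeft R (ι L x))
    (g := LinearMap.mulRight R (ι L x) ∘ₗ sgnPow L p) (linearMap_ext ?_ ?_) s
  · simp [sgnPow_one]
  · intro q y hy s hs
    change ι L x * s = sgnPow L p s * ι L x at hs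
    change ι L x * (ι L y * s) = sgnPow L p (ι L y * s) * ι L x
    rw [← mul_assoc, ι_comm hx hy, smul_mul_assoc, mul_assoc, hs, sgnPow_ι_mul hy, smul_mul_assoc,
      mul_assoc]

theorem ofFn_prod_mem_deg {k : ℕ} {d : Fin k → ℕ} {z : Fin k → L} (hz : ∀ i, z i ∈ L.deg (d i)) :
    (List.ofFn fun i => ι L (z i)).prod ∈ deg L (∑ i, d i) := by
  induction k with
  | zero => simpa using one_mem_deg
  | succ k ih =>
    rw [List.ofFn_succ, List.prod_cons, Fin.sum_univ_succ]
    exact ι_mul_mem_deg (hz 0) (ih fun i => hz i.succ)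

theorem ofFn_prod_mem_pow {k : ℕ} (z : Fin k → L) :
    (List.ofFn fun i => ι L (z i)).prod ∈ pow L k := by
  induction k with
  | zero => simpa using one_mem_pow
  | succ k ih =>
    rw [List.ofFn_succ, List.prod_cons]
    exact ι_mul_mem_pow _ (ih fun i => z i.succ)

theorem sgnPow_ofFn_prod {k : ℕ} {d : Fin k → ℕ} {z : Fin k → L} (hz : ∀ i, z i ∈ L.deg (d i))
    (p : ℕ) : sgnPow L p (List.ofFn fun i => ι L (z i)).prod =
      (-1 : ℤ) ^ (p * ∑ i, d i) • (List.ofFn fun i => ι L (z i)).prod := by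
  refine (DGModule.sgnPow_of_mem (M := sym L) (ofFn_prod_mem_deg hz) p).trans ?_
  rw [← Int.cast_smul_eq_zsmul R]
  push_cast
  rfl

theorem sum_Ioi_succ {k : ℕ} (d : Fin (k + 1) → ℕ) (i : Fin k) :
    ∑ j ∈ Finset.Ioi i.succ, d j = ∑ j ∈ Finset.Ioi i, d j.succ := by
  rw [Fin.Ioi_succ, Finset.sum_map]; rfl

theorem sum_Ioi_zero {k : ℕ} (d : Fin (k + 1) → ℕ) :
    ∑ j ∈ Finset.Ioi 0, d j = ∑ j : Fin k, d j.succ := by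
  rw [Fin.Ioi_zero_eq_map, Finset.sum_map]; rfl

/-- Replacing a letter of a word by a letter moved from the end. -/
theorem prod_set_ofFn {k : ℕ} {d : Fin k → ℕ} {z : Fin k → L} (hz : ∀ i, z i ∈ L.deg (d i))
    (i : Fin k) {p : ℕ} {x : L} (hx : x ∈ L.deg p) :
    ((List.ofFn fun i => ι L (z i)).set i (ι L x)).prod =
      (-1 : ℤ) ^ (p * ∑ j ∈ Finset.Ioi i, d j) •
        (((List.ofFn fun i => ι L (z i)).eraseIdx i).prod * ι L x) := by
  induction k with
  | zero => exact i.elim0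
  | succ k ih =>
    rw [List.ofFn_succ]
    induction i using Fin.cases with
    | zero =>
      rw [Fin.val_zero, List.set_cons_zero, List.eraseIdx_cons_zero, List.prod_cons,
        ι_mul_comm hx, sgnPow_ofFn_prod fun i => hz i.succ, sum_Ioi_zero, smul_mul_assoc]
    | succ i =>
      rw [Fin.val_succ, List.set_cons_succ, List.eraseIdx_cons_succ, List.prod_cons,
        List.prod_cons, ih (d := fun j => d j.succ) (fun j => hz j.succ), sum_Ioi_succ,
        mul_smul_comm, mul_assoc]

variable [Algebra ℚ R]

/-- The sign comes from moving z_i past the letters to its right; it is the sign in the definition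
of ω. -/
theorem coaction_ofFn_prod {k : ℕ} {d : Fin k → ℕ} {z : Fin k → L}
    (hz : ∀ i, z i ∈ L.deg (d i)) :
    coaction L (List.ofFn fun i => ι L (z i)).prod =
      ∑ i : Fin k, (-1 : ℤ) ^ (d i * ∑ j ∈ Finset.Ioi i, d j) •
        (((List.ofFn fun i => ι L (z i)).eraseIdx i).prod ⊗ₜ[R] z i) := by
  induction k with
  | zero => simp [coaction_one]
  | succ k ih =>
    rw [List.ofFn_succ, List.prod_cons, coaction_ι_mul (hz 0),
      ih (d := fun j => d j.succ) fun j => hz j.succ, sgnPow_ofFn_prod fun j => hz j.succ,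
      Fin.sum_univ_succ, sum_Ioi_zero, map_sum (leftMul L (z 0)), add_comm]
    congr 1
    refine Finset.sum_congr rfl fun i _ => ?_
    rw [map_zsmul, leftMul_tmul, sum_Ioi_succ, Fin.val_succ, List.eraseIdx_cons_succ,
      List.prod_cons]

end SymAlg

end DGModule

/-! ### Permutations -/

/-- The permutation that sends the last element to `i`, and the others to the complement of `i`
by `τ`. -/
def permLast {k : ℕ} (i : Fin (k + 1)) (τ : Equiv.Perm (Fin k)) : Equiv.Perm (Fin (k + 1)) :=
  finSuccEquivLast.trans ((Equiv.optionCongr τ).trans (finSuccEquiv' i).symm)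

theorem permLast_last {k : ℕ} (i : Fin (k + 1)) (τ : Equiv.Perm (Fin k)) :
    permLast i τ (Fin.last k) = i := by
  simp [permLast]

theorem permLast_castSucc {k : ℕ} (i : Fin (k + 1)) (τ : Equiv.Perm (Fin k)) (j : Fin k) :
    permLast i τ j.castSucc = i.succAbove (τ j) := by
  simp [permLast]

/-- A permutation is determined by its last value and the arrangement of the rest; surjectivity
follows by counting, (k+1)! = (k+1) k!. -/
theorem permLast_bijective (k : ℕ) :
    Function.Bijective fun x : Fin (k + 1) × Equiv.Perm (Fin k) => permLast x.1 x.2 := by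
  rw [Fintype.bijective_iff_injective_and_card]
  constructor
  · rintro ⟨i, τ⟩ ⟨i', τ'⟩ h
    have h1 : i = i' := by
      have := congrArg (fun σ => σ (Fin.last k)) h
      simpa only [permLast_last] using this
    subst h1
    refine Prod.ext rfl (Equiv.ext fun j => ?_)
    have := congrArg (fun σ => σ j.castSucc) h
    simpa only [permLast_castSucc, Fin.succAbove_right_inj] using this
  · rw [Fintype.card_prod, Fintype.card_perm, Fintype.card_perm, Fintype.card_fin,
      Fintype.card_fin, Nat.factorial_succ]

/-- Inversions are split by whether they involve the last position. Since i comes last, it is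
inverted with every larger index; the remaining inversions are those of τ, because `succAbove` is
increasing. -/
theorem koszulSign_permLast {k : ℕ} (d : Fin (k + 1) → ℕ) (i : Fin (k + 1))
    (τ : Equiv.Perm (Fin k)) :
    koszulSign d (permLast i τ) = (-1) ^ (d i * ∑ j ∈ Finset.Ioi i, d j) *
      koszulSign (fun j => d (i.succAbove j)) τ := by
  have h1 : ∏ j : Fin k, (if i < i.succAbove (τ j) then
      (-1 : ℤ) ^ (d (i.succAbove (τ j)) * d i) else 1) =
      (-1) ^ (d i * ∑ j ∈ Finset.Ioi i, d j) := by
    rw [Equiv.prod_comp τ fun j => if i < i.succAbove j then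
      (-1 : ℤ) ^ (d (i.succAbove j) * d i) else 1]
    have h2 : Finset.Ioi i = Finset.univ.filter fun j => i < j := by ext; simp
    rw [h2, Finset.sum_filter, Fin.sum_univ_succAbove _ i, if_neg (lt_irrefl i), zero_add,
      Finset.mul_sum, ← Finset.prod_pow_eq_pow_sum]
    refine Finset.prod_congr rfl fun j _ => ?_
    split_ifs
    · rw [mul_comm]
    · simp
  rw [koszulSign, Fin.prod_univ_castSucc]
  have h3 : ∏ j : Fin (k + 1), (if Fin.last k < j ∧ permLast i τ j < permLast i τ (Fin.last k) then
      (-1 : ℤ) ^ (d (permLast i τ (Fin.last k)) * d (permLast i τ j)) else 1) = 1 :=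
    Finset.prod_eq_one fun j _ => if_neg fun h => absurd h.1 (not_lt.2 (Fin.le_last j))
  rw [h3, mul_one]
  simp only [Fin.prod_univ_castSucc, permLast_castSucc, permLast_last, Fin.castSucc_lt_castSucc_iff,
    Fin.castSucc_lt_last, true_and, Fin.succAbove_lt_succAbove_iff]
  rw [Finset.prod_mul_distrib, h1, mul_comm]
  rfl

namespace DGModule

open _root_.DPoly.DGModule.SymAlg

variable {R : Type u} [CommRing R] {L : DGModule R} [Algebra ℚ R]

/-- Each step of the recursion chooses the last letter z_i and orders the others, which is the
decomposition of permutations by `permLast`. -/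
theorem orderings_ofFn_prod {A : Type*} [Ring A] [Module R A] {e : SymAlg L →ₗ[R] A}
    (he : e 1 = 1) {m : A ⊗[R] L →ₗ[R] A} (g : L → A) (hm : ∀ a y, m (a ⊗ₜ[R] y) = a * g y)
    {k : ℕ} {d : Fin k → ℕ} {z : Fin k → L} (hz : ∀ i, z i ∈ L.deg (d i)) :
    orderings e m k (List.ofFn fun i => ι L (z i)).prod =
      ∑ σ : Equiv.Perm (Fin k), koszulSign d σ • (List.ofFn fun i => g (z (σ i))).prod := by
  induction k with
  | zero => simpa [orderings, koszulSign] using he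
  | succ k ih =>
    rw [orderings, LinearMap.comp_apply, LinearMap.comp_apply, coaction_ofFn_prod hz, map_sum,
      map_sum, ← (permLast_bijective k).sum_comp, Fintype.sum_prod_type]
    refine Finset.sum_congr rfl fun i _ => ?_
    rw [map_zsmul, map_zsmul, LinearMap.rTensor_tmul, hm, eraseIdx_ofFn,
      ih (d := fun j => d (i.succAbove j)) (z := fun j => z (i.succAbove j))
        fun j => hz (i.succAbove j), Finset.sum_mul, Finset.smul_sum]
    refine Finset.sum_congr rfl fun τ _ => ?_
    rw [koszulSign_permLast, List.ofFn_succ', List.concat_eq_append, List.prod_append,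
      smul_mul_assoc, smul_smul]
    simp only [permLast_castSucc, permLast_last, List.prod_singleton]

end DGModule

end DPoly

/-! ### The constructions as morphisms of presheaves of differential graded modules. -/

namespace DPoly

open AlgebraicGeometry
open scoped TensorProduct

namespace DGModule

namespace SymAlg

variable {R : Type u} [CommRing R] (L : DGModule R)

/-- The augmentation of the symmetric algebra. -/
noncomputable def augmentation : SymAlg L →ₐ[R] R := lift (0 : L →ₗ[R] R) (by simp)

variable {L}

theorem augmentation_ι_mul (x : L) (s : SymAlg L) : augmentation L (ι L x * s) = 0 := by
  rw [map_mul]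
  exact (congrArg (· * augmentation L s) (lift_ι (0 : L →ₗ[R] R) (by simp) x)).trans (zero_mul _)

theorem augmentation_d (s : SymAlg L) : augmentation L (d L s) = 0 := by
  induction s using SymAlg.induction with
  | h0 => simp
  | h1 => rw [d_one, map_zero]
  | hadd a b ha hb => rw [map_add, map_add, ha, hb, add_zero]
  | hsmul r a ha => rw [map_smul, map_smul, ha, smul_zero]
  | hmul x a _ => rw [d_ι_mul, map_add, augmentation_ι_mul, augmentation_ι_mul, add_zero]

theorem augmentation_of_mem_pow {n : ℕ} {s : SymAlg L} (hs : s ∈ pow L (n + 1)) :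
    augmentation L s = 0 := by
  induction hs using Submodule.span_induction with
  | mem s hs => obtain ⟨x, t, _, rfl⟩ := hs; exact augmentation_ι_mul x t
  | zero => exact map_zero _
  | add a b _ _ ha hb => rw [map_add, ha, hb, add_zero]
  | smul r a _ ha => rw [map_smul, ha, smul_zero]

theorem augmentation_smul_mem {M : DGModule R} {a : M} (ha : a ∈ M.deg 0) {n : ℕ} {s : SymAlg L}
    (hs : s ∈ deg L n) : augmentation L s • a ∈ M.deg n := by
  induction hs using Submodule.span_induction with
  | mem s hs =>
    cases hs with
    | one => rw [map_one, one_smul]; exact ha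
    | mul hx hs => rw [augmentation_ι_mul, zero_smul]; exact zero_mem _
  | zero => rw [map_zero, zero_smul]; exact zero_mem _
  | add a b _ _ ha hb => rw [map_add, add_smul]; exact add_mem ha hb
  | smul r a _ ha => rw [map_smul, smul_assoc]; exact Submodule.smul_mem _ _ ha

theorem augmentation_symRes {S : Type u} [CommRing S] {φ : R →+* S} {L' : DGModule S}
    (F : Res φ L L') (s : SymAlg L) : augmentation L' (symRes F s) = φ (augmentation L s) := by
  induction s using SymAlg.induction with
  | h0 => simp
  | h1 => simp
  | hadd a b ha hb => simp only [map_add, ha, hb]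
  | hsmul r a ha => rw [symRes_smul, map_smul, map_smul, ha, smul_eq_mul, smul_eq_mul, map_mul]
  | hmul x a _ => rw [map_mul, symRes_ι, augmentation_ι_mul, augmentation_ι_mul, map_zero]

/-- Degrees are defined through multiplication on the left, so y is first moved to the front, up to
a sign. -/
theorem mul_ι_mem_deg {p q : ℕ} {s : SymAlg L} {y : L} (hs : s ∈ deg L p) (hy : y ∈ L.deg q) :
    s * ι L y ∈ deg L (p + q) := by
  have h := DGModule.sgnPow_of_mem (M := sym L) hs q
  have h1 : sgnPow L q s = (-1 : R) ^ (q * p) • s := h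
  have h2 : s * ι L y = (-1 : R) ^ (q * p) • (ι L y * s) := by
    rw [ι_mul_comm hy, h1, smul_mul_assoc, smul_smul, ← mul_pow]
    simp
  rw [h2, add_comm]
  exact Submodule.smul_mem _ _ (ι_mul_mem_deg hy hs)

theorem d_mul_ι (s : SymAlg L) (y : L) :
    d L (s * ι L y) = d L s * ι L y + sgn L s * ι L (L.d y) := by
  induction s using SymAlg.induction with
  | h0 => simp
  | h1 =>
    have h := d_ι_mul y 1
    rw [d_one, mul_zero, add_zero, mul_one, mul_one] at h
    rw [one_mul, h, d_one, zero_mul, map_one, one_mul, zero_add]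
  | hadd a b ha hb => simp only [add_mul, map_add, ha, hb]; abel
  | hsmul r a ha => simp only [smul_mul_assoc, map_smul, ha, smul_add]
  | hmul x a ha =>
    rw [mul_assoc, d_ι_mul, ha, d_ι_mul, sgn_ι_mul, mul_add, add_mul, mul_assoc, mul_assoc,
      mul_assoc, add_assoc]

end SymAlg

theorem symMul_mem {R : Type u} [CommRing R] {L : DGModule R} {n : ℕ} {t : SymAlg L ⊗[R] L}
    (ht : t ∈ tensorDeg (sym L) L n) : symMul L t ∈ SymAlg.deg L n := by
  have h : tensorDeg (sym L) L n ≤ (SymAlg.deg L n).comap (symMul L) := by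
    refine tensorDeg_le (M := sym L) (N := L) ?_
    rintro p q rfl s hs y hy
    change symMul L (show SymAlg L ⊗[R] L from s ⊗ₜ[R] y) ∈ SymAlg.deg L (p + q)
    exact (symMul_tmul (L := L) s y) ▸ SymAlg.mul_ι_mem_deg hs hy
  exact h ht

theorem symMul_dTensor {R : Type u} [CommRing R] {L : DGModule R} (t : SymAlg L ⊗[R] L) :
    symMul L (SymAlg.dTensor L t) = SymAlg.d L (symMul L t) := by
  induction t using TensorProduct.induction_on with
  | zero => simp only [map_zero]
  | tmul s y =>
    rw [SymAlg.dTensor_tmul, map_add, symMul_tmul, symMul_tmul, symMul_tmul, SymAlg.d_mul_ι]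
  | add a b ha hb => simp only [map_add, ha, hb]

theorem symMul_symTensorRes {R S : Type u} [CommRing R] [CommRing S] {φ : R →+* S}
    {L : DGModule R} {L' : DGModule S} (F : Res φ L L') (t : SymAlg L ⊗[R] L) :
    symMul L' (symTensorRes F t) = symRes F (symMul L t) := by
  induction t using TensorProduct.induction_on with
  | zero => simp only [map_zero]
  | tmul s y => rw [symTensorRes_tmul, symMul_tmul, symMul_tmul, map_mul, symRes_ι]
  | add a b ha hb => simp only [map_add, ha, hb]

end DGModule

/-- Needed in an additive form: restriction maps are linear only over a change of rings. -/
theorem addMonoidHom_ext_threefold {R M N P : Type*} [CommRing R] [AddCommGroup M] [Module R M]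
    [AddCommGroup N] [Module R N] [AddCommGroup P] [Module R P] {A : Type*} [AddCommGroup A]
    {f g : (M ⊗[R] N) ⊗[R] P →+ A} (h : ∀ x y z, f ((x ⊗ₜ y) ⊗ₜ z) = g ((x ⊗ₜ y) ⊗ₜ z)) :
    f = g := by
  ext t
  induction t using TensorProduct.induction_on with
  | zero => simp only [map_zero]
  | tmul s z =>
    induction s using TensorProduct.induction_on with
    | zero => simp only [TensorProduct.zero_tmul, map_zero]
    | tmul x y => exact h x y z
    | add a b ha hb => simp only [TensorProduct.add_tmul, map_add, ha, hb]
  | add a b ha hb => simp only [map_add, ha, hb]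

namespace DGPresheaf

variable {X : Scheme.{u}}

theorem Hom.ext_lin {M N : DGPresheaf X} {F G : Hom M N}
    (h : ∀ U, (F.app U).lin = (G.app U).lin) : F = G := by
  have h' : F.app = G.app := by
    funext U
    have hU := h U
    cases hF : F.app U
    cases hG : G.app U
    rw [hF, hG] at hU
    congr
  cases F
  cases G
  congr

/-- The identity. -/
noncomputable def Hom.id (M : DGPresheaf X) : Hom M M where
  app _ := { lin := LinearMap.id, map_mem := fun hx => hx, map_d := fun _ => rfl }
  naturality _ _ := rfl

/-- The powers of an endomorphism. -/
noncomputable def Hom.npow {M : DGPresheaf X} (F : Hom M M) : ℕ → Hom M M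
  | 0 => Hom.id M
  | k + 1 => (F.npow k).comp F

theorem Hom.npow_lin {M : DGPresheaf X} (F : Hom M M) (k : ℕ) (U : X.Opens) :
    ((F.npow k).app U).lin = ((F.app U).lin ^ k : Module.End Γ(X, U) (M.obj U)) := by
  induction k with
  | zero => rfl
  | succ k ih =>
    rw [pow_succ', ← ih]
    rfl

/-- The associativity of the tensor product. -/
noncomputable def Hom.assoc (M N P : DGPresheaf X) :
    Hom ((M.tensor N).tensor P) (M.tensor (N.tensor P)) where
  app U :=
    { lin := (TensorProduct.assoc Γ(X, U) (M.obj U) (N.obj U) (P.obj U)).toLinearMap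
      map_mem := fun {n t} ht => by
        refine DGModule.tensorDeg_le (M := (M.obj U).tensor (N.obj U)) (N := P.obj U)
          (E := (DGModule.tensorDeg (M.obj U) ((N.obj U).tensor (P.obj U)) n).comap
            (TensorProduct.assoc Γ(X, U) (M.obj U) (N.obj U) (P.obj U)).toLinearMap) ?_ ht
        rintro p q rfl t ht z hz
        refine DGModule.tensorDeg_le (M := M.obj U) (N := N.obj U)
          (E := (DGModule.tensorDeg (M.obj U) ((N.obj U).tensor (P.obj U)) (p + q)).comap
            ((TensorProduct.assoc Γ(X, U) (M.obj U) (N.obj U) (P.obj U)).toLinearMap ∘ₗ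
              (TensorProduct.mk Γ(X, U) (M.obj U ⊗[Γ(X, U)] N.obj U) (P.obj U)).flip z)) ?_ ht
        rintro a b rfl x hx y hy
        exact DGModule.tmul_mem_tensorDeg (M := M.obj U) (N := (N.obj U).tensor (P.obj U))
          (add_assoc a b q).symm hx (DGModule.tmul_mem_tensorDeg rfl hy hz)
      map_d := fun t => by
        refine LinearMap.congr_fun
          (f := (TensorProduct.assoc Γ(X, U) (M.obj U) (N.obj U) (P.obj U)).toLinearMap ∘ₗ
            DGModule.tensorD ((M.obj U).tensor (N.obj U)) (P.obj U))
          (g := DGModule.tensorD (M.obj U) ((N.obj U).tensor (P.obj U)) ∘ₗ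
            (TensorProduct.assoc Γ(X, U) (M.obj U) (N.obj U) (P.obj U)).toLinearMap)
          (TensorProduct.ext_threefold fun x y z => ?_) t
        change TensorProduct.assoc Γ(X, U) (M.obj U) (N.obj U) (P.obj U)
          (((M.obj U).d x ⊗ₜ y + (M.obj U).sgn x ⊗ₜ (N.obj U).d y) ⊗ₜ z +
            ((M.obj U).sgn x ⊗ₜ (N.obj U).sgn y) ⊗ₜ (P.obj U).d z) =
          (M.obj U).d x ⊗ₜ (y ⊗ₜ z) + (M.obj U).sgn x ⊗ₜ
            ((N.obj U).d y ⊗ₜ z + (N.obj U).sgn y ⊗ₜ (P.obj U).d z)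
        rw [TensorProduct.add_tmul, map_add, map_add, TensorProduct.tmul_add,
          TensorProduct.assoc_tmul, TensorProduct.assoc_tmul, TensorProduct.assoc_tmul, add_assoc] }
  naturality {U V} h t :=
    DFunLike.congr_fun (addMonoidHom_ext_threefold
      (f := (TensorProduct.assoc Γ(X, V) (M.obj V) (N.obj V) (P.obj V)).toLinearMap.toAddMonoidHom.comp
        (DGModule.tensorRes ((M.res h).tensor (N.res h)) (P.res h)))
      (g := (DGModule.tensorRes (M.res h) ((N.res h).tensor (P.res h))).comp
        (TensorProduct.assoc Γ(X, U) (M.obj U) (N.obj U) (P.obj U)).toLinearMap.toAddMonoidHom)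
      fun _ _ _ => rfl) t

/-- The morphism `id ⊗ G`. -/
noncomputable def Hom.idTensor (M : DGPresheaf X) {N N' : DGPresheaf X} (G : Hom N N') :
    Hom (M.tensor N) (M.tensor N') where
  app U :=
    { lin := ((G.app U).lin.lTensor (M.obj U) :
        M.obj U ⊗[Γ(X, U)] N.obj U →ₗ[Γ(X, U)] M.obj U ⊗[Γ(X, U)] N'.obj U)
      map_mem := fun {n t} ht => by
        refine DGModule.tensorDeg_le (E := (DGModule.tensorDeg (M.obj U) (N'.obj U) n).comap
          ((G.app U).lin.lTensor (M.obj U))) ?_ ht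
        rintro p q rfl x hx y hy
        exact DGModule.tmul_mem_tensorDeg rfl hx ((G.app U).map_mem hy)
      map_d := fun t => by
        refine LinearMap.congr_fun
          (f := (G.app U).lin.lTensor (M.obj U) ∘ₗ DGModule.tensorD (M.obj U) (N.obj U))
          (g := DGModule.tensorD (M.obj U) (N'.obj U) ∘ₗ (G.app U).lin.lTensor (M.obj U))
          (TensorProduct.ext' fun x y => ?_) t
        simp [DGModule.tensorD_tmul, (G.app U).map_d] }
  naturality {U V} h t := by
    change (G.app V).lin.lTensor (M.obj V) (DGModule.tensorRes _ _ t) =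
      DGModule.tensorRes _ _ ((G.app U).lin.lTensor (M.obj U) t)
    induction t using TensorProduct.induction_on with
    | zero => simp only [map_zero]
    | tmul x y =>
      rw [DGModule.tensorRes_tmul, LinearMap.lTensor_tmul, LinearMap.lTensor_tmul,
        DGModule.tensorRes_tmul, G.naturality]
    | add a b ha hb => simp only [map_add, ha, hb]

/-- The product `Sym L ⊗ L → Sym L`. -/
noncomputable def symMul (L : DGPresheaf X) : Hom (L.sym.tensor L) L.sym where
  app U :=
    { lin := DGModule.symMul (L.obj U)
      map_mem := DGModule.symMul_mem
      map_d := DGModule.symMul_dTensor }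
  naturality h t := DGModule.symMul_symTensorRes (L.res h) t

/-- The morphism `Sym L → M` that annihilates `L`, given by a global closed section of degree
zero. -/
noncomputable def augmentation (L : DGPresheaf X) {M : DGPresheaf X} (a : ∀ U, M.obj U)
    (ha : ∀ U, a U ∈ (M.obj U).deg 0) (had : ∀ U, (M.obj U).d (a U) = 0)
    (har : ∀ {U V : X.Opens} (h : V ≤ U), (M.res h).add (a U) = a V) : Hom L.sym M where
  app U :=
    { lin := (DGModule.SymAlg.augmentation (L.obj U)).toLinearMap.smulRight (a U)
      map_mem := fun hs => DGModule.SymAlg.augmentation_smul_mem (ha U) hs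
      map_d := fun s => by
        refine (congrArg (· • a U) (DGModule.SymAlg.augmentation_d (L := L.obj U) s)).trans ?_
        refine (zero_smul _ _).trans (Eq.symm ?_)
        refine (map_smul (M.obj U).d (DGModule.SymAlg.augmentation (L.obj U) s) (a U)).trans ?_
        rw [had, smul_zero] }
  naturality {U V} h s := by
    refine (congrArg (· • a V) (DGModule.SymAlg.augmentation_symRes (L.res h) s)).trans ?_
    refine Eq.trans ?_ ((M.res h).map_smul (DGModule.SymAlg.augmentation (L.obj U) s) (a U)).symm
    rw [har]

variable [∀ U : X.Opens, Algebra ℚ Γ(X, U)]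

/-- The morphism `∑ k, c k • F k`. -/
noncomputable def Hom.locallyFiniteSum {M N : DGPresheaf X} (c : ℕ → ℚ) (F : ℕ → Hom M N)
    (hF : ∀ U x, ∃ n, ∀ k, n ≤ k → ((F k).app U).lin x = 0) : Hom M N :=
  have hF' : ∀ U x, ∃ n, ∀ k, n ≤ k →
      (algebraMap ℚ Γ(X, U) (c k) • ((F k).app U).lin) x = 0 := fun U x => by
    obtain ⟨n, hn⟩ := hF U x
    exact ⟨n, fun k hk => by rw [LinearMap.smul_apply, hn k hk, smul_zero]⟩
  { app := fun U =>
      { lin := DPoly.locallyFiniteSum (fun k => algebraMap ℚ Γ(X, U) (c k) • ((F k).app U).lin)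
          (hF' U)
        map_mem := fun {_ x} hx => by
          obtain ⟨n, hn⟩ := hF' U x
          rw [locallyFiniteSum_apply _ hn]
          exact sum_mem fun k _ => Submodule.smul_mem _ _ (((F k).app U).map_mem hx)
        map_d := fun x => by
          obtain ⟨n, hn⟩ := hF' U x
          have hn' : ∀ k, n ≤ k →
              (algebraMap ℚ Γ(X, U) (c k) • ((F k).app U).lin) ((M.obj U).d x) = 0 := by
            intro k hk
            have := hn k hk
            rw [LinearMap.smul_apply] at this ⊢
            rw [((F k).app U).map_d, ← map_smul, this, map_zero]
          rw [locallyFiniteSum_apply _ hn, locallyFiniteSum_apply _ hn', map_sum]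
          refine Finset.sum_congr rfl fun k _ => ?_
          rw [LinearMap.smul_apply, LinearMap.smul_apply, map_smul, ((F k).app U).map_d] }
    naturality := fun {U V} h x => by
      obtain ⟨n, hn⟩ := hF' U x
      have hk : ∀ k, (algebraMap ℚ Γ(X, V) (c k) • ((F k).app V).lin) ((M.res h).add x) =
          (N.res h).add ((algebraMap ℚ Γ(X, U) (c k) • ((F k).app U).lin) x) := by
        intro k
        -- The coefficients are rational, and any ring homomorphism between ℚ-algebras fixes them,
        -- so restriction may be taken term by term.
        rw [LinearMap.smul_apply, LinearMap.smul_apply, (N.res h).map_smul, (F k).naturality,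
          RingHom.map_rat_algebraMap]
      rw [locallyFiniteSum_apply _ hn, locallyFiniteSum_apply _ fun k hk' => by
        rw [hk, hn k hk', map_zero], map_sum]
      exact Finset.sum_congr rfl fun k _ => hk k }

/-- The coaction `Sym L → Sym L ⊗ L`. -/
noncomputable def coaction (L : DGPresheaf X) : Hom L.sym (L.sym.tensor L) where
  app U :=
    { lin := DGModule.SymAlg.coaction (L.obj U)
      map_mem := DGModule.SymAlg.coaction_mem
      map_d := DGModule.SymAlg.coaction_d }
  naturality h s := DGModule.coaction_symRes (L.res h) s

/-- The morphism `s ⊗ y ↦ ∑ s' ⊗ [z, y]`, where `∑ s' ⊗ z` is the coaction on `s`. -/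
noncomputable def adTensor {L : DGPresheaf X} (br : Hom (L.tensor L) L) :
    Hom (L.sym.tensor L) (L.sym.tensor L) :=
  (((coaction L).tensorId L).comp (Hom.assoc L.sym L L)).comp (Hom.idTensor L.sym br)

/-- The maps `z_1 ⋯ z_k ↦ ∑ σ, ± e z_{σ(1)} ⋯ z_{σ(k)}`. -/
noncomputable def orderings {L A : DGPresheaf X} (e : Hom L.sym A) (m : Hom (A.tensor L) A) :
    ℕ → Hom L.sym A
  | 0 => e
  | k + 1 => (coaction L).comp (((orderings e m k).tensorId L).comp m)

theorem orderings_lin {L A : DGPresheaf X} (e : Hom L.sym A) (m : Hom (A.tensor L) A) (k : ℕ)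
    (U : X.Opens) : ((orderings e m k).app U).lin =
      DGModule.orderings (L := L.obj U) (A := A.obj U) (e.app U).lin (m.app U).lin k := by
  induction k with
  | zero => rfl
  | succ k ih =>
    exact congrArg (fun g : DGModule.SymAlg (L.obj U) →ₗ[Γ(X, U)] A.obj U =>
      (m.app U).lin ∘ₗ g.rTensor (L.obj U) ∘ₗ DGModule.SymAlg.coaction (L.obj U)) ih

end DGPresheaf

end DPoly

/-! ### The identity for presheaves, and passage to complexes of sheaves. -/

namespace DPoly

open AlgebraicGeometry CategoryTheory
open scoped TensorProduct

namespace DGPresheaf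

variable {X : Scheme.{u}}

theorem Hom.complex_comp {M N P : DGPresheaf X} (F : Hom M N) (G : Hom N P) :
    (F.comp G).complex = F.complex ≫ G.complex := by
  have h : (F.comp G).presheafComplex = F.presheafComplex ≫ G.presheafComplex := by
    ext n : 1
    rfl
  rw [Hom.complex, h, Functor.map_comp]
  rfl

section RatAlgebra

variable [∀ U : X.Opens, Algebra ℚ Γ(X, U)] {L A : DGPresheaf X}

/-- The summands are compared through a free variable G, because the finiteness proof depends on
them and they cannot be rewritten in place. -/
theorem Hom.locallyFiniteSum_lin {M N : DGPresheaf X} {c : ℕ → ℚ} {F : ℕ → Hom M N}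
    (hF : ∀ U x, ∃ n, ∀ k, n ≤ k → ((F k).app U).lin x = 0) {U : X.Opens}
    {G : ℕ → M.obj U →ₗ[Γ(X, U)] N.obj U} (hG : ∀ x, ∃ n, ∀ k, n ≤ k → G k x = 0)
    (h : ∀ k, algebraMap ℚ Γ(X, U) (c k) • ((F k).app U).lin = G k) :
    ((Hom.locallyFiniteSum c F hF).app U).lin = DPoly.locallyFiniteSum G hG := by
  obtain rfl : _ = G := funext h
  rfl

/-- The symmetrization map. -/
noncomputable def symmetrization (e : Hom L.sym A) (m : Hom (A.tensor L) A)
    (he : ∀ U n, ∀ s ∈ DGModule.SymAlg.pow (L.obj U) (n + 1), (e.app U).lin s = 0) :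
    Hom L.sym A :=
  Hom.locallyFiniteSum (fun k => (k.factorial : ℚ)⁻¹) (orderings e m) fun U =>
    exists_forall_eq_zero_of_iSup (DGModule.SymAlg.iSup_pow (L := L.obj U))
      fun _ s hs k hk => by
        rw [orderings_lin]
        exact DGModule.orderings_of_mem_pow (L := L.obj U) (he U) (m.app U).lin hk.ne' hs

theorem symmetrization_lin {e : Hom L.sym A} {m : Hom (A.tensor L) A}
    (he : ∀ U n, ∀ s ∈ DGModule.SymAlg.pow (L.obj U) (n + 1), (e.app U).lin s = 0) (U : X.Opens) :
    ((symmetrization e m he).app U).lin =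
      DGModule.symmetrization (L := L.obj U) (A := A.obj U) (he U) (m.app U).lin :=
  Hom.locallyFiniteSum_lin _ _ fun k =>
    congrArg (algebraMap ℚ Γ(X, U) ((k.factorial : ℚ)⁻¹) • ·) (orderings_lin e m k U)

/-- The evaluation of a power series at a locally nilpotent endomorphism. -/
noncomputable def evalSeries {M : DGPresheaf X} (c : PowerSeries ℚ) (ω : Hom M M)
    (hω : ∀ U x, ∃ n, ∀ k, n ≤ k →
      ((ω.app U).lin ^ k : Module.End Γ(X, U) (M.obj U)) x = 0) : Hom M M :=
  Hom.locallyFiniteSum (fun k => PowerSeries.coeff k c) ω.npow fun U x => by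
    obtain ⟨n, hn⟩ := hω U x
    exact ⟨n, fun k hk => by rw [Hom.npow_lin, hn k hk]⟩

theorem evalSeries_lin {M : DGPresheaf X} (c : PowerSeries ℚ) {ω : Hom M M}
    (hω : ∀ U x, ∃ n, ∀ k, n ≤ k →
      ((ω.app U).lin ^ k : Module.End Γ(X, U) (M.obj U)) x = 0) (U : X.Opens) :
    ((evalSeries c ω hω).app U).lin = DPoly.evalSeries c (ω.app U).lin (hω U) :=
  Hom.locallyFiniteSum_lin _ _ fun k =>
    congrArg (algebraMap ℚ Γ(X, U) (PowerSeries.coeff k c) • ·) (Hom.npow_lin ω k U)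

theorem adTensor_locally_nilpotent (br : Hom (L.tensor L) L) (U : X.Opens)
    (x : (L.sym.tensor L).obj U) : ∃ n, ∀ k, n ≤ k →
      (((adTensor br).app U).lin ^ k : Module.End Γ(X, U) ((L.sym.tensor L).obj U)) x = 0 :=
  DGModule.adTensor_locally_nilpotent (L := L.obj U) (br.app U).lin x

/-- `m ∘ (I ⊗ id) = I ∘ μ ∘ ω / (1 - exp (-ω))`. -/
theorem symmetrization_comp_evalSeries {e : Hom L.sym A} {m : Hom (A.tensor L) A}
    (he : ∀ U n, ∀ s ∈ DGModule.SymAlg.pow (L.obj U) (n + 1), (e.app U).lin s = 0)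
    {br : Hom (L.tensor L) L}
    (hm : ∀ U, DGModule.IsLieAction (L := L.obj U) (A := A.obj U) (br.app U).lin (m.app U).lin) :
    ((symmetrization e m he).tensorId L).comp m =
      ((evalSeries todd (adTensor br) (adTensor_locally_nilpotent br)).comp (symMul L)).comp
        (symmetrization e m he) := by
  refine Hom.ext_lin fun U => ?_
  have h := DGModule.symmetrization_comp_evalSeries (L := L.obj U) (A := A.obj U) (he U)
    (br := (br.app U).lin)
    -- Additivity of degrees under the bracket is part of `br` being a morphism.
    (fun hx hy => (br.app U).map_mem (DGModule.tmul_mem_tensorDeg rfl hx hy)) (hm U)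
  have h1 := symmetrization_lin (m := m) he U
  have h2 := evalSeries_lin todd (adTensor_locally_nilpotent br) U
  refine Eq.trans ?_ (h.trans ?_)
  · exact congrArg (fun g : DGModule.SymAlg (L.obj U) →ₗ[Γ(X, U)] A.obj U =>
      (m.app U).lin ∘ₗ g.rTensor (L.obj U)) h1
  · exact (congrArg₂ (fun (g : DGModule.SymAlg (L.obj U) →ₗ[Γ(X, U)] A.obj U)
      (φ : DGModule.SymAlg (L.obj U) ⊗[Γ(X, U)] L.obj U →ₗ[Γ(X, U)]
        DGModule.SymAlg (L.obj U) ⊗[Γ(X, U)] L.obj U) =>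
      g ∘ₗ DGModule.symMul (L.obj U) ∘ₗ φ) h1 h2).symm

end RatAlgebra

end DGPresheaf

section Field

variable {K : Type u} [Field K] [CharZero K] {X : Scheme.{u}} (f : X ⟶ Spec (CommRingCat.of K))

/-- There is at most one ring homomorphism out of ℚ, so coefficients sent through K agree with those
of the ℚ-algebra structure. -/
theorem secMap_ratCast (U : X.Opens) [Algebra ℚ Γ(X, U)] (q : ℚ) :
    secMap f U (q : K) = algebraMap ℚ Γ(X, U) q := by
  have h : (secMap f U).comp (algebraMap ℚ K) = algebraMap ℚ Γ(X, U) := Subsingleton.elim _ _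
  rw [← h, RingHom.comp_apply, eq_ratCast]

theorem isPowerSeriesEval_evalSeries [∀ U : X.Opens, Algebra ℚ Γ(X, U)] (c : PowerSeries ℚ)
    {M : DGPresheaf X} {ω : DGPresheaf.Hom M M}
    (hω : ∀ U x, ∃ n, ∀ k, n ≤ k →
      ((ω.app U).lin ^ k : Module.End Γ(X, U) (M.obj U)) x = 0) :
    IsPowerSeriesEval f c ω (DGPresheaf.evalSeries c ω hω) := by
  intro U x
  obtain ⟨n, hn⟩ := hω U x
  refine ⟨n, hn n le_rfl, ?_⟩
  rw [DGPresheaf.evalSeries_lin, evalSeries_apply c (hω U) hn]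
  exact Finset.sum_congr rfl fun j _ => by rw [secMap_ratCast]

end Field

end DPoly

/-! ### The bracket of L, and its right action on polydifferential operators, as morphisms. -/

namespace DPoly

open AlgebraicGeometry CategoryTheory
open scoped TensorProduct

section GradedBilinear

variable {R : Type u} [CommRing R] {M N P : ℕ → Type u}
  [∀ n, AddCommGroup (M n)] [∀ n, Module R (M n)] [∀ n, AddCommGroup (N n)] [∀ n, Module R (N n)]
  [∀ n, AddCommGroup (P n)] [∀ n, Module R (P n)]

/-- The linear map on tensor products of direct sums given by graded bilinear maps. -/
noncomputable def gradedLift (b : ∀ p q, M p →ₗ[R] N q →ₗ[R] P (p + q)) :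
    DirectSum ℕ M ⊗[R] DirectSum ℕ N →ₗ[R] DirectSum ℕ P :=
  TensorProduct.lift (DirectSum.toModule R ℕ _ fun p => LinearMap.flip
    (DirectSum.toModule R ℕ _ fun q => LinearMap.flip
      ((b p q).compr₂ (DirectSum.lof R ℕ P (p + q)))))

theorem gradedLift_tmul_of (b : ∀ p q, M p →ₗ[R] N q →ₗ[R] P (p + q)) {p q : ℕ} (x : M p)
    (y : N q) : gradedLift b (DirectSum.of M p x ⊗ₜ[R] DirectSum.of N q y) =
      DirectSum.of P (p + q) (b p q x y) := by
  rw [← DirectSum.lof_eq_of R, ← DirectSum.lof_eq_of R, ← DirectSum.lof_eq_of R]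
  simp [gradedLift]

theorem addMonoidHom_ext_gradedTensor {A : Type*} [AddCommGroup A]
    {g h : DirectSum ℕ M ⊗[R] DirectSum ℕ N →+ A}
    (H : ∀ p q (x : M p) (y : N q), g (DirectSum.of M p x ⊗ₜ[R] DirectSum.of N q y) =
      h (DirectSum.of M p x ⊗ₜ[R] DirectSum.of N q y)) : g = h := by
  ext t
  induction t using TensorProduct.induction_on with
  | zero => simp only [map_zero]
  | tmul x y =>
    induction x using DirectSum.induction_on with
    | zero => simp only [TensorProduct.zero_tmul, map_zero]
    | of p x =>
      induction y using DirectSum.induction_on with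
      | zero => simp only [TensorProduct.tmul_zero, map_zero]
      | of q y => exact H p q x y
      | add a b ha hb => simp only [TensorProduct.tmul_add, map_add, ha, hb]
    | add a b ha hb => simp only [TensorProduct.add_tmul, map_add, ha, hb]
  | add a b ha hb => simp only [map_add, ha, hb]

variable {dM : ∀ n, M n →ₗ[R] M (n + 1)} {hM : ∀ n x, dM (n + 1) (dM n x) = 0}
  {dN : ∀ n, N n →ₗ[R] N (n + 1)} {hN : ∀ n x, dN (n + 1) (dN n x) = 0}
  {dP : ∀ n, P n →ₗ[R] P (n + 1)} {hP : ∀ n x, dP (n + 1) (dP n x) = 0}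

theorem ofComplex_d_of {p : ℕ} (x : M p) :
    (DGModule.ofComplex M dM hM).d (DirectSum.of M p x) =
      (DirectSum.of M (p + 1) (dM p x) : DirectSum ℕ M) := by
  change DirectSum.toModule R ℕ (DirectSum ℕ M) (fun n => DirectSum.lof R ℕ M (n + 1) ∘ₗ dM n)
    (DirectSum.of M p x) = _
  rw [← DirectSum.lof_eq_of R, ← DirectSum.lof_eq_of R, DirectSum.toModule_lof]
  rfl

theorem ofComplex_sgn_of {p : ℕ} (x : M p) :
    (DGModule.ofComplex M dM hM).sgn (DirectSum.of M p x) =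
      ((-1 : ℤ) ^ p • DirectSum.of M p x : DirectSum ℕ M) := by
  change DirectSum.toModule R ℕ (DirectSum ℕ M) (fun n => (-1 : R) ^ n • DirectSum.lof R ℕ M n)
    (DirectSum.of M p x) = _
  rw [← DirectSum.lof_eq_of R, DirectSum.toModule_lof, ← Int.cast_smul_eq_zsmul R]
  push_cast
  rfl

variable (hM hN hP) in
/-- A graded bilinear map that satisfies the Leibniz rule, as a morphism of differential graded
modules. -/
noncomputable def gradedLiftHom (b : ∀ p q, M p →ₗ[R] N q →ₗ[R] P (p + q))
    (hb : ∀ p q x y, (DirectSum.of P _ (dP _ (b p q x y)) : DirectSum ℕ P) =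
      DirectSum.of P _ (b _ _ (dM _ x) y) +
        (-1 : ℤ) ^ p • DirectSum.of P _ (b _ _ x (dN _ y))) :
    DGModule.Hom ((DGModule.ofComplex M dM hM).tensor (DGModule.ofComplex N dN hN))
      (DGModule.ofComplex P dP hP) where
  lin := gradedLift b
  map_mem {n t} ht := by
    refine DGModule.tensorDeg_le (M := DGModule.ofComplex M dM hM)
      (N := DGModule.ofComplex N dN hN)
      (E := ((DGModule.ofComplex P dP hP).deg n).comap (gradedLift b)) ?_ ht
    rintro p q rfl _ ⟨x, rfl⟩ _ ⟨y, rfl⟩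
    exact ⟨b p q x y, (gradedLift_tmul_of b x y).symm⟩
  map_d t := by
    refine DFunLike.congr_fun (addMonoidHom_ext_gradedTensor (R := R) (M := M) (N := N)
      (g := (gradedLift b).toAddMonoidHom.comp (DGModule.tensorD (DGModule.ofComplex M dM hM)
        (DGModule.ofComplex N dN hN)).toAddMonoidHom)
      (h := (DGModule.ofComplex P dP hP).d.toAddMonoidHom.comp (gradedLift b).toAddMonoidHom)
      fun p q x y => ?_) t
    change gradedLift b (DGModule.tensorD (DGModule.ofComplex M dM hM)
      (DGModule.ofComplex N dN hN) (DirectSum.of M p x ⊗ₜ[R] DirectSum.of N q y)) =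
      (DGModule.ofComplex P dP hP).d
        (gradedLift b (DirectSum.of M p x ⊗ₜ[R] DirectSum.of N q y))
    have h1 : DGModule.tensorD (DGModule.ofComplex M dM hM) (DGModule.ofComplex N dN hN)
        (DirectSum.of M p x ⊗ₜ[R] DirectSum.of N q y) =
        ((DirectSum.of M (p + 1) (dM p x) : DirectSum ℕ M) ⊗ₜ[R] DirectSum.of N q y +
          ((-1 : ℤ) ^ p • (DirectSum.of M p x : DirectSum ℕ M)) ⊗ₜ[R]
            (DirectSum.of N (q + 1) (dN q y)) : DirectSum ℕ M ⊗[R] DirectSum ℕ N) :=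
      congrArg₂ (· + ·)
        (congrArg (fun z : DirectSum ℕ M => z ⊗ₜ[R] (DirectSum.of N q y : DirectSum ℕ N))
          (ofComplex_d_of (hM := hM) x))
        (congrArg₂ (fun (z : DirectSum ℕ M) (w : DirectSum ℕ N) => z ⊗ₜ[R] w)
          (ofComplex_sgn_of (hM := hM) x) (ofComplex_d_of (hM := hN) y))
    have h2 : (DGModule.ofComplex P dP hP).d
        (gradedLift b (DirectSum.of M p x ⊗ₜ[R] DirectSum.of N q y)) =
        (DirectSum.of P _ (dP _ (b p q x y)) : DirectSum ℕ P) :=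
      (congrArg (DGModule.ofComplex P dP hP).d (gradedLift_tmul_of b x y)).trans
        (ofComplex_d_of (hM := hP) _)
    refine (congrArg (gradedLift b) h1).trans (Eq.trans ?_ h2.symm)
    rw [map_add, gradedLift_tmul_of, hb, ← TensorProduct.smul_tmul', map_zsmul,
      gradedLift_tmul_of]

theorem gradedLift_tensorRes {S : Type u} [CommRing S] {φ : R →+* S} {M' N' P' : ℕ → Type u}
    [∀ n, AddCommGroup (M' n)] [∀ n, Module S (M' n)] [∀ n, AddCommGroup (N' n)]
    [∀ n, Module S (N' n)] [∀ n, AddCommGroup (P' n)] [∀ n, Module S (P' n)]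
    {dM' : ∀ n, M' n →ₗ[S] M' (n + 1)} {hM' : ∀ n x, dM' (n + 1) (dM' n x) = 0}
    {dN' : ∀ n, N' n →ₗ[S] N' (n + 1)} {hN' : ∀ n x, dN' (n + 1) (dN' n x) = 0}
    (F : DGModule.Res φ (DGModule.ofComplex M dM hM) (DGModule.ofComplex M' dM' hM'))
    (G : DGModule.Res φ (DGModule.ofComplex N dN hN) (DGModule.ofComplex N' dN' hN'))
    {rM : ∀ n, M n →+ M' n} {rN : ∀ n, N n →+ N' n} {rP : ∀ n, P n →+ P' n}
    (hF : F.add = DirectSum.map rM) (hG : G.add = DirectSum.map rN)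
    {b : ∀ p q, M p →ₗ[R] N q →ₗ[R] P (p + q)} {b' : ∀ p q, M' p →ₗ[S] N' q →ₗ[S] P' (p + q)}
    (h : ∀ p q x y, b' p q (rM p x) (rN q y) = rP (p + q) (b p q x y))
    (t : DirectSum ℕ M ⊗[R] DirectSum ℕ N) :
    gradedLift b' (DGModule.tensorRes F G t) = DirectSum.map rP (gradedLift b t) := by
  refine DFunLike.congr_fun (addMonoidHom_ext_gradedTensor (R := R) (M := M) (N := N)
    (g := (gradedLift b').toAddMonoidHom.comp (DGModule.tensorRes F G))
    (h := (DirectSum.map rP).comp (gradedLift b).toAddMonoidHom) fun p q x y => ?_) t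
  have h1 : DGModule.tensorRes F G (DirectSum.of M p x ⊗ₜ[R] DirectSum.of N q y) =
      ((DirectSum.of M' p (rM p x) : DirectSum ℕ M') ⊗ₜ[S] DirectSum.of N' q (rN q y) :
        DirectSum ℕ M' ⊗[S] DirectSum ℕ N') :=
    congrArg₂ (fun (z : DirectSum ℕ M') (w : DirectSum ℕ N') => z ⊗ₜ[S] w)
      ((DFunLike.congr_fun hF _).trans (DirectSum.map_of rM p x))
      ((DFunLike.congr_fun hG _).trans (DirectSum.map_of rN q y))
  refine (congrArg (gradedLift b') h1).trans ?_
  change _ = DirectSum.map rP (gradedLift b (DirectSum.of M p x ⊗ₜ[R] DirectSum.of N q y))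
  rw [gradedLift_tmul_of, gradedLift_tmul_of, DirectSum.map_of, h]

end GradedBilinear

section Sheaf

variable {K : Type u} [Field K] {X : Scheme.{u}} {f : X ⟶ Spec (CommRingCat.of K)}
  {U : X.Opens}

theorem PD.mul_smul {k l : ℕ} (F : PD f U k) (r : Γ(X, U)) (G : PD f U l) :
    F.mul (r • G) = r • F.mul G := PD.ext fun V a => by
  rw [PD.mul_apply, PD.smul_apply, PD.smul_apply, PD.mul_apply, mul_left_comm]

theorem PD.smul_mul {k l : ℕ} (r : Γ(X, U)) (F : PD f U k) (G : PD f U l) :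
    (r • F).mul G = r • F.mul G := PD.ext fun V a => by
  rw [PD.mul_apply, PD.smul_apply, PD.smul_apply, PD.mul_apply, mul_assoc]

theorem pdOf_smul {n : ℕ} (r : Γ(X, U)) (F : PD f U n) : pdOf (r • F) = r • pdOf F :=
  map_smul (DirectSum.lof Γ(X, U) ℕ (PD f U) n) r F

/-- This and the next three rules are checked in the direct sum, where the bracket is a graded
commutator in a ring. -/
theorem PD.bracket_add {k l : ℕ} (F : PD f U k) (G H : PD f U l) :
    F.bracket (G + H) = F.bracket G + F.bracket H := pdOf_injective _ <| by
  rw [pdOf_add, pdOf_bracket, pdOf_bracket, pdOf_bracket, pdOf_add, mul_add, add_mul, smul_add]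
  abel

theorem PD.add_bracket {k l : ℕ} (F G : PD f U k) (H : PD f U l) :
    (F + G).bracket H = F.bracket H + G.bracket H := pdOf_injective _ <| by
  rw [pdOf_add, pdOf_bracket, pdOf_bracket, pdOf_bracket, pdOf_add, mul_add, add_mul, smul_add]
  abel

theorem PD.bracket_smul {k l : ℕ} (F : PD f U k) (r : Γ(X, U)) (G : PD f U l) :
    F.bracket (r • G) = r • F.bracket G := pdOf_injective _ <| by
  rw [pdOf_smul, pdOf_bracket, pdOf_bracket, smul_sub, smul_comm r, ← pdOf_mul, ← pdOf_mul,
    ← pdOf_mul, ← pdOf_mul, PD.mul_smul, PD.smul_mul, pdOf_smul, pdOf_smul]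

theorem PD.smul_bracket {k l : ℕ} (r : Γ(X, U)) (F : PD f U k) (G : PD f U l) :
    (r • F).bracket G = r • F.bracket G := pdOf_injective _ <| by
  rw [pdOf_smul, pdOf_bracket, pdOf_bracket, smul_sub, smul_comm r, ← pdOf_mul, ← pdOf_mul,
    ← pdOf_mul, ← pdOf_mul, PD.mul_smul, PD.smul_mul, pdOf_smul, pdOf_smul]

/-- The bracket as a bilinear map. -/
noncomputable def bracketBilin (f : X ⟶ Spec (CommRingCat.of K)) (U : X.Opens) (p q : ℕ) :
    freeLie f U p →ₗ[Γ(X, U)] freeLie f U q →ₗ[Γ(X, U)] freeLie f U (p + q) :=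
  LinearMap.mk₂ _ lieBracket
    (fun _ _ _ => Subtype.ext (PD.add_bracket _ _ _))
    (fun _ _ _ => Subtype.ext (PD.smul_bracket _ _ _))
    (fun _ _ _ => Subtype.ext (PD.bracket_add _ _ _))
    (fun _ _ _ => Subtype.ext (PD.bracket_smul _ _ _))

/-- The right multiplication by elements of the free Lie algebra, as a bilinear map. -/
noncomputable def mulBilin (f : X ⟶ Spec (CommRingCat.of K)) (U : X.Opens) (p q : ℕ) :
    PD f U p →ₗ[Γ(X, U)] freeLie f U q →ₗ[Γ(X, U)] PD f U (p + q) :=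
  LinearMap.mk₂ _ (fun F G => F.mul G.1)
    (fun F G H => PD.ext fun _ _ => by
      rw [PD.mul_apply, PD.add_apply, PD.add_apply, PD.mul_apply, PD.mul_apply, add_mul])
    (fun _ _ _ => PD.smul_mul _ _ _)
    (fun F G H => PD.ext fun _ _ => mul_add _ _ _)
    (fun _ _ _ => PD.mul_smul _ _ _)

variable (hL : PreservesFreeLie f)

theorem freeLie_of_d_bracket {p q : ℕ} (x : freeLie f U p) (y : freeLie f U q) :
    (DirectSum.of (fun n => freeLie f U n) _
      ((PD.d (p + q)).restrict (hL U (p + q)) (bracketBilin f U p q x y))) =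
      DirectSum.of (fun n => freeLie f U n) _
        (bracketBilin f U _ _ ((PD.d p).restrict (hL U p) x) y) +
      (-1 : ℤ) ^ p • DirectSum.of (fun n => freeLie f U n) _
        (bracketBilin f U _ _ x ((PD.d q).restrict (hL U q) y)) := by
  -- The two terms of the Leibniz rule sit in the degrees p + 1 + q and p + (q + 1). The first must
  -- be transported, and the direct sum does not see the transport.
  have hcast : ∀ {m n : ℕ} (h : m = n) (z : freeLie f U m),
      DirectSum.of (fun n => freeLie f U n) m z =
        DirectSum.of (fun n => freeLie f U n) n ⟨h ▸ z.1, cast_mem_freeLie h z.2⟩ := by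
    rintro m _ rfl z; rfl
  have key : (PD.d (p + q)).restrict (hL U (p + q)) (bracketBilin f U p q x y) =
      ⟨Nat.add_right_comm p 1 q ▸ (bracketBilin f U _ _ ((PD.d p).restrict (hL U p) x) y).1,
        cast_mem_freeLie _ (Subtype.property _)⟩ +
      (-1 : ℤ) ^ p • bracketBilin f U p (q + 1) x ((PD.d q).restrict (hL U q) y) :=
    Subtype.ext (PD.d_bracket x.1 y.1)
  exact (congrArg (DirectSum.of (fun n => freeLie f U n) (p + q + 1)) key).trans
    ((map_add _ _ _).trans (congrArg₂ (· + ·) (hcast _ _).symm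
      (map_zsmul (DirectSum.of (fun n => freeLie f U n) (p + q + 1)) _ _)))

theorem freeLie_d_d (U : X.Opens) (n : ℕ) (x : freeLie f U n) :
    (PD.d (n + 1)).restrict (hL U (n + 1)) ((PD.d n).restrict (hL U n) x) = 0 :=
  Subtype.ext (PD.d_d x.1)

/-- The bracket as a morphism. -/
noncomputable def bracketHom : DGPresheaf.Hom ((Lie hL).tensor (Lie hL)) (Lie hL) where
  app U := gradedLiftHom (freeLie_d_d hL U) (freeLie_d_d hL U) (freeLie_d_d hL U)
    (bracketBilin f U) fun _ _ => freeLie_of_d_bracket hL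
  naturality {U V} h t := gradedLift_tensorRes (hM := freeLie_d_d hL U) (hN := freeLie_d_d hL U)
    (hM' := freeLie_d_d hL V) (hN' := freeLie_d_d hL V) ((Lie hL).res h) ((Lie hL).res h) rfl rfl
    (fun _ _ x y => Subtype.ext (PD.res_bracket h x.1 y.1).symm) t

/-- The right action of the free Lie algebra on `D_poly`. -/
noncomputable def mulHom : DGPresheaf.Hom ((Dpoly f).tensor (Lie hL)) (Dpoly f) where
  app U := gradedLiftHom (fun _ F => PD.d_d F) (freeLie_d_d hL U) (fun _ F => PD.d_d F)
    (mulBilin f U) fun p q x y => by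
    refine (pdOf_d_mul x y.1).trans ?_
    rw [← pdOf_mul, ← pdOf_mul]
    rfl
  naturality {U V} h t := gradedLift_tensorRes (hM := fun _ F => PD.d_d F)
    (hN := freeLie_d_d hL U) (hM' := fun _ F => PD.d_d F) (hN' := freeLie_d_d hL V)
    ((Dpoly f).res h) ((Lie hL).res h) rfl rfl
    (fun _ _ x y => (PD.res_mul h x y.1).symm) t

/-- The inclusion of the free Lie algebra. -/
noncomputable def lieIncl (U : X.Opens) : (Lie hL).obj U →+ DirectSum ℕ (PD f U) :=
  (DirectSum.map fun n => (freeLie f U n).subtype.toAddMonoidHom :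
    DirectSum ℕ (fun n => freeLie f U n) →+ DirectSum ℕ (PD f U))

theorem lieIncl_lieOf {n : ℕ} (y : freeLie f U n) : lieIncl hL U (lieOf hL y) = pdOf y.1 :=
  DirectSum.map_of (fun n => (freeLie f U n).subtype.toAddMonoidHom) n y

theorem gradedLift_mulBilin_tmul (a : DirectSum ℕ (PD f U))
    (y : DirectSum ℕ fun n => freeLie f U n) : gradedLift (mulBilin f U) (a ⊗ₜ y) =
      a * DirectSum.map (fun n => (freeLie f U n).subtype.toAddMonoidHom) y := by
  induction y using DirectSum.induction_on with
  | zero => rw [TensorProduct.tmul_zero, map_zero, map_zero, mul_zero]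
  | of q y =>
    induction a using DirectSum.induction_on with
    | zero => rw [TensorProduct.zero_tmul, map_zero, zero_mul]
    | of p x =>
      rw [gradedLift_tmul_of, DirectSum.map_of]
      exact pdOf_mul x y.1
    | add a b ha hb => rw [TensorProduct.add_tmul, map_add, ha, hb, add_mul]
  | add a b ha hb => rw [TensorProduct.tmul_add, map_add, ha, hb, map_add, mul_add]

/-- The bracket as a linear map. -/
noncomputable def bracketLin (U : X.Opens) :
    (Lie hL).obj U ⊗[Γ(X, U)] (Lie hL).obj U →ₗ[Γ(X, U)] (Lie hL).obj U :=
  gradedLift (bracketBilin f U)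

theorem gradedLift_bracketBilin_tmul {p q : ℕ} (x : freeLie f U p) (y : freeLie f U q) :
    gradedLift (bracketBilin f U) (DirectSum.of (fun n => freeLie f U n) p x ⊗ₜ[Γ(X, U)]
      DirectSum.of (fun n => freeLie f U n) q y) =
        DirectSum.of (fun n => freeLie f U n) (p + q) (lieBracket x y) :=
  gradedLift_tmul_of (M := fun n => freeLie f U n) (N := fun n => freeLie f U n)
    (P := fun n => freeLie f U n) (bracketBilin f U) x y

theorem bracketLin_tmul {p q : ℕ} (x : freeLie f U p) (y : freeLie f U q) :
    bracketLin hL U (lieOf hL x ⊗ₜ[Γ(X, U)] lieOf hL y) = lieOf hL (lieBracket x y) :=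
  gradedLift_bracketBilin_tmul x y

/-- The right action of the free Lie algebra on `D_poly` as a linear map. -/
noncomputable def mulLin (U : X.Opens) :
    DirectSum ℕ (PD f U) ⊗[Γ(X, U)] (Lie hL).obj U →ₗ[Γ(X, U)] DirectSum ℕ (PD f U) :=
  gradedLift (mulBilin f U)

theorem mulLin_tmul (a : DirectSum ℕ (PD f U)) (y : (Lie hL).obj U) :
    mulLin hL U (a ⊗ₜ[Γ(X, U)] y) = a * lieIncl hL U y := gradedLift_mulBilin_tmul a y

theorem isMultiplication_mulHom : IsMultiplication (mulHom hL) := fun _ a _ y =>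
  (mulLin_tmul hL a (lieOf hL y)).trans (congrArg (a * ·) (lieIncl_lieOf hL y))

end Sheaf

end DPoly

/-! ### Verification of the prescribed formulas for the constructed morphisms. -/

namespace DPoly

open AlgebraicGeometry CategoryTheory
open scoped TensorProduct

namespace DGModule

open _root_.DPoly.DGModule.SymAlg

variable {R : Type u} [CommRing R] [Algebra ℚ R] {L : DGModule R} {br : L ⊗[R] L →ₗ[R] L}
  {k : ℕ} {d : Fin k → ℕ} {z : Fin k → L}

theorem adTensor_ofFn_prod (hz : ∀ i, z i ∈ L.deg (d i)) (y : L) :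
    adTensor br ((List.ofFn fun i => ι L (z i)).prod ⊗ₜ[R] y) =
      ∑ i : Fin k, (-1 : ℤ) ^ (d i * ∑ j ∈ Finset.Ioi i, d j) •
        (((List.ofFn fun i => ι L (z i)).eraseIdx i).prod ⊗ₜ[R] br (z i ⊗ₜ[R] y)) := by
  change (br.lTensor (SymAlg L) ∘ₗ (TensorProduct.assoc R (SymAlg L) L L).toLinearMap ∘ₗ
    (TensorProduct.mk R (SymAlg L ⊗[R] L) L).flip y) (coaction L _) = _
  rw [coaction_ofFn_prod hz, map_sum]
  refine Finset.sum_congr rfl fun i _ => ?_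
  rw [map_zsmul]
  rfl

/-- Let S be the total degree of the letters after z_i. Extracting z_i costs (-1)^{d_i S}, and
moving [z_i, y], of degree d_i + e, back to its place costs (-1)^{(d_i + e) S}; together they leave
the sign (-1)^{e S} of the adjoint action. -/
theorem symMul_adTensor_ofFn_prod (hz : ∀ i, z i ∈ L.deg (d i)) {e : ℕ} {y : L}
    (hbr : ∀ i, br (z i ⊗ₜ[R] y) ∈ L.deg (d i + e)) :
    symMul L (adTensor br ((List.ofFn fun i => ι L (z i)).prod ⊗ₜ[R] y)) =
      ∑ i : Fin k, (-1 : ℤ) ^ (e * ∑ j ∈ Finset.Ioi i, d j) •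
        ((List.ofFn fun i => ι L (z i)).set i (ι L (br (z i ⊗ₜ[R] y)))).prod := by
  rw [adTensor_ofFn_prod hz, map_sum]
  refine Finset.sum_congr rfl fun i _ => ?_
  rw [map_zsmul, symMul_tmul, prod_set_ofFn hz i (hbr i), smul_smul, ← pow_add]
  congr 1
  generalize ∑ j ∈ Finset.Ioi i, d j = S
  rw [show e * S + (d i + e) * S = d i * S + 2 * (e * S) by ring, pow_add, pow_mul (-1 : ℤ) 2]
  simp

end DGModule

variable {K : Type u} [Field K] {X : Scheme.{u}} {f : X ⟶ Spec (CommRingCat.of K)}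
  (hL : PreservesFreeLie f) {U : X.Opens}

theorem lieOf_mem {n : ℕ} (x : freeLie f U n) : lieOf hL x ∈ ((Lie hL).obj U).deg n := ⟨x, rfl⟩

/-- The morphism `Sym L → D_poly` that annihilates `L` and sends `1` to `1`. -/
noncomputable def unitHom : DGPresheaf.Hom (Lie hL).sym (Dpoly f) :=
  DGPresheaf.augmentation (Lie hL) (M := Dpoly f) (fun _ => pdOf PD.one) (fun _ => ⟨PD.one, rfl⟩)
    (fun U => by
      refine (ofComplex_d_of (hM := fun _ F => PD.d_d F) (PD.one : PD f U 0)).trans ?_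
      -- In degree zero only the two outer terms remain, a_0 · 1 - 1 · a_0.
      have : PD.d 0 (PD.one : PD f U 0) = 0 := PD.ext fun V a => by
        refine (hochD_apply _ a).trans ?_
        rw [PD.one_apply, PD.one_apply, PD.zero_apply]
        simp
      rw [this, map_zero]
      rfl)
    (fun h => DirectSum.map_of (PD.res h) 0 PD.one)

theorem unitHom_of_mem_pow (U : X.Opens) (n : ℕ) (s : DGModule.SymAlg ((Lie hL).obj U))
    (hs : s ∈ DGModule.SymAlg.pow ((Lie hL).obj U) (n + 1)) :
    ((unitHom hL).app U).lin s = 0 :=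
  (congrArg (· • (show (Dpoly f).obj U from pdOf PD.one))
    (DGModule.SymAlg.augmentation_of_mem_pow hs)).trans (zero_smul _ _)

/-- The underlying linear map of `unitHom`. -/
noncomputable def unitLin (U : X.Opens) :
    DGModule.SymAlg ((Lie hL).obj U) →ₗ[Γ(X, U)] DirectSum ℕ (PD f U) :=
  (DGModule.SymAlg.augmentation ((Lie hL).obj U)).toLinearMap.smulRight (pdOf PD.one)

theorem unitLin_one : unitLin hL U 1 = 1 := by
  rw [unitLin, LinearMap.smulRight_apply, AlgHom.toLinearMap_apply, map_one, one_smul]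
  rfl

theorem isSymProduct_symMul : IsSymProduct (DGPresheaf.symMul (Lie hL)) := fun U s y =>
  DGModule.symMul_tmul (L := (Lie hL).obj U) s y

variable [∀ U : X.Opens, Algebra ℚ Γ(X, U)]

/-- The product of polydifferential operators is associative and the bracket of L is its graded
commutator. -/
theorem isLieAction_mulLin (U : X.Opens) :
    DGModule.IsLieAction (bracketLin hL U) (mulLin hL U) := by
  intro a t
  refine LinearMap.congr_fun
    (f := DGModule.act₂ (mulLin hL U) ∘ₗ TensorProduct.mk Γ(X, U) _ _ a -
      DGModule.act₂ (mulLin hL U) ∘ₗ TensorProduct.mk Γ(X, U) _ _ a ∘ₗ DGModule.braid _ _)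
    (g := mulLin hL U ∘ₗ TensorProduct.mk Γ(X, U) _ _ a ∘ₗ bracketLin hL U)
    (DGModule.tensor_linearMap_ext ?_) t
  rintro p _ ⟨x, rfl⟩ q _ ⟨y, rfl⟩
  change DGModule.act₂ (mulLin hL U) (a ⊗ₜ (lieOf hL x ⊗ₜ lieOf hL y)) -
    DGModule.act₂ (mulLin hL U) (a ⊗ₜ DGModule.braid _ _ (lieOf hL x ⊗ₜ lieOf hL y)) =
      mulLin hL U (a ⊗ₜ bracketLin hL U (lieOf hL x ⊗ₜ lieOf hL y))
  rw [DGModule.braid_of_mem (lieOf_mem hL x) (lieOf_mem hL y), TensorProduct.tmul_smul, map_smul,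
    DGModule.act₂_tmul, DGModule.act₂_tmul, bracketLin_tmul]
  simp only [mulLin_tmul, lieIncl_lieOf]
  have h := pdOf_bracket x.1 y.1
  refine Eq.trans ?_ (congrArg (a * ·) h).symm
  have h1 : ((-1 : Γ(X, U)) ^ (p * q)) • (a * pdOf y.1 * pdOf x.1) =
      (-1 : ℤ) ^ (p * q) • (a * pdOf y.1 * pdOf x.1) := by
    rw [← Int.cast_smul_eq_zsmul Γ(X, U)]
    push_cast
    rfl
  rw [h1, mul_assoc, mul_assoc, mul_sub, mul_smul_comm]

/-- The symmetrization map. -/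
noncomputable def symmetrizationHom : DGPresheaf.Hom (Lie hL).sym (Dpoly f) :=
  DGPresheaf.symmetrization (unitHom hL) (mulHom hL) (unitHom_of_mem_pow hL)

theorem isSymmetrization_symmetrizationHom [CharZero K] :
    IsSymmetrization (symmetrizationHom hL) := by
  intro U k d z
  have h1 := DGPresheaf.symmetrization_lin (m := mulHom hL) (unitHom_of_mem_pow hL) U
  refine (LinearMap.congr_fun h1 _).trans ?_
  refine (DGModule.symmetrization_of_mem_pow (e := unitLin hL U) (unitHom_of_mem_pow hL U)
    (mulLin hL U) (DGModule.SymAlg.ofFn_prod_mem_pow fun i => lieOf hL (z i))).trans ?_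
  rw [DGModule.orderings_ofFn_prod (unitLin_one hL) (lieIncl hL U) (mulLin_tmul hL)
    fun i => lieOf_mem hL (z i), ← secMap_ratCast f]
  simp only [lieIncl_lieOf]
  push_cast
  rfl

theorem isOmega_adTensor : IsOmega (DGPresheaf.adTensor (bracketHom hL)) := by
  intro U k d z e y
  refine (DGModule.adTensor_ofFn_prod (br := bracketLin hL U)
    (fun i => lieOf_mem hL (z i)) (lieOf hL y)).trans ?_
  simp only [bracketLin_tmul]
  rfl

theorem isRightAdjoint_adTensor_comp_symMul :
    IsRightAdjoint ((DGPresheaf.adTensor (bracketHom hL)).comp (DGPresheaf.symMul (Lie hL))) := by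
  intro U k d z e y
  refine (DGModule.symMul_adTensor_ofFn_prod (br := bracketLin hL U) (e := e)
    (fun i => lieOf_mem hL (z i)) (y := lieOf hL y)
    fun i => bracketLin_tmul hL (z i) y ▸ lieOf_mem hL _).trans ?_
  simp only [bracketLin_tmul]
  rfl

end DPoly

theorem theorem1 {K : Type u} [Field K] [CharZero K] {X : Scheme.{u}}
    (f : X ⟶ Spec (CommRingCat.of K)) [Smooth f] :
    ∃ hL : DPoly.PreservesFreeLie f,
    ∃ (m : DPoly.DGPresheaf.Hom ((DPoly.Dpoly f).tensor (DPoly.Lie hL)) (DPoly.Dpoly f))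
      (μ : DPoly.DGPresheaf.Hom ((DPoly.Lie hL).sym.tensor (DPoly.Lie hL)) (DPoly.Lie hL).sym)
      (I : DPoly.DGPresheaf.Hom (DPoly.Lie hL).sym (DPoly.Dpoly f))
      (ω : DPoly.DGPresheaf.Hom ((DPoly.Lie hL).sym.tensor (DPoly.Lie hL))
        ((DPoly.Lie hL).sym.tensor (DPoly.Lie hL)))
      (ad : DPoly.DGPresheaf.Hom ((DPoly.Lie hL).sym.tensor (DPoly.Lie hL)) (DPoly.Lie hL).sym)
      (φ : DPoly.DGPresheaf.Hom ((DPoly.Lie hL).sym.tensor (DPoly.Lie hL))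
        ((DPoly.Lie hL).sym.tensor (DPoly.Lie hL))),
      DPoly.IsMultiplication m ∧
      DPoly.IsSymProduct μ ∧
      DPoly.IsSymmetrization I ∧
      DPoly.IsOmega ω ∧
      DPoly.IsRightAdjoint ad ∧
      ω.comp μ = ad ∧
      DPoly.IsPowerSeriesEval f DPoly.todd ω φ ∧
      (I.tensorId (DPoly.Lie hL)).complex ≫ m.complex = φ.complex ≫ μ.complex ≫ I.complex := by
  -- Characteristic 0 enters here for the coefficients 1 / k! and those of the power series:
  -- functions become ℚ-algebras through K.
  let _ : ∀ U : X.Opens, Algebra ℚ Γ(X, U) := fun U =>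
    ((DPoly.secMap f U).comp (algebraMap ℚ K)).toAlgebra
  have hL : DPoly.PreservesFreeLie f := DPoly.preservesFreeLie
  -- The morphism `ad` is taken to be μ ∘ ω, so that this equation is `rfl` and the content lies in
  -- the explicit formula for it.
  refine ⟨hL, DPoly.mulHom hL, DPoly.DGPresheaf.symMul (DPoly.Lie hL),
    DPoly.symmetrizationHom hL, DPoly.DGPresheaf.adTensor (DPoly.bracketHom hL), _,
    DPoly.DGPresheaf.evalSeries DPoly.todd (DPoly.DGPresheaf.adTensor (DPoly.bracketHom hL))
      (DPoly.DGPresheaf.adTensor_locally_nilpotent _),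
    DPoly.isMultiplication_mulHom hL, DPoly.isSymProduct_symMul hL,
    DPoly.isSymmetrization_symmetrizationHom hL, DPoly.isOmega_adTensor hL,
    DPoly.isRightAdjoint_adTensor_comp_symMul hL, rfl,
    DPoly.isPowerSeriesEval_evalSeries f _ _, ?_⟩
  -- Both composites come from presheaf morphisms, which are already equal before sheafification.
  rw [← DPoly.DGPresheaf.Hom.complex_comp, ← DPoly.DGPresheaf.Hom.complex_comp,
    ← DPoly.DGPresheaf.Hom.complex_comp]
  exact congrArg DPoly.DGPresheaf.Hom.complex
    (DPoly.DGPresheaf.symmetrization_comp_evalSeries (DPoly.unitHom_of_mem_pow hL)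
      (br := DPoly.bracketHom hL) (DPoly.isLieAction_mulLin hL))
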